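/- **Setting.** Let $(\Omega,\mathcal F,\mathbb P)$ be a probability space and $L=\{L(A)\}$ a homogeneous Lévy basis on $\mathbb R^2$ with characteristic triplet $(\gamma,b,\nu)$, $b\ge 0$, $\nu$ a Lévy measure: a random measure on the Borel sets $A$ with $Leb(A)<\infty$ that is independently scattered, almost surely $\sigma$-additive, and satisfies $\mathbb E e^{izL(A)}=e^{Leb(A)\psi(z)}$, $z\in\mathbb R$, where $$\psi(z)=i\gamma z-\tfrac12 b^2z^2+\int_{\mathbb R\setminus\{0\}}\big(e^{izx}-1-izx\mathbf 1_{|x|\le 1}\big)\nu(dx).$$ Let $L'$ be a random variable with $\mathbb E e^{izL'}=e^{\psi(z)}$ and assume $\mathbb E|L'|<\infty$. Let $a:[0,\infty)\to[0,\infty)$ be non-increasing, integrable and continuous, and continuously differentiable on some $[0,\delta)$, $\delta>0$. Put $A=\{(r,y): r\le 0,\ 0\le y\le a(-r)\}$, $X_t=L(A+(t,0))$ and $\tilde X_t=X_t-\mathbb E X_t$. Let $\Delta_n>0$ $(n\ge1)$ with $n\Delta_n\to 0$, and for $t\ge 0$ let $$S^n_t=\sum_{k=0}^{[nt]-1}\tilde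 X_{k\Delta_n},\qquad Z^n_t=\frac{[nt]}{n}\tilde X_0-\frac1n S^n_t .$$ $\mathcal F$-stable convergence of finite-dimensional distributions, $Z^n\overset{\mathcal F\text{-}fd}{\longrightarrow}H$, for a process $H$ defined on an extension $\pi:(\Omega',\mathcal F',\mathbb P')\to(\Omega,\mathcal F,\mathbb P)$ ($\pi$ measure preserving) means: for all $u_1,\dots,u_q\ge 0$ and every $F\in\mathcal F$ with $\mathbb P(F)>0$, the conditional law of $(Z^n_{u_1},\dots,Z^n_{u_q})$ given $F$ converges weakly to the conditional law of $(H_{u_1},\dots,H_{u_q})$ given $\pi^{-1}(F)$. For a process $Y$ and a continuous deterministic $f$, $\int_0^t f\,dY$ denotes the limit in probability of the sums $\sum_i f(u_i)(Y_{u_{i+1}}-Y_{u_i})$ along partitions $0=u_0\le\dots\le u_N=t$ with mesh tending to $0$. For $0<\beta<2$, $K_\pm\ge0$, $\gamma'\in\mathbb R$ let $$\psi(z;\beta,K_+,K_-,\gamma')=\begin{cases}-s|z|^\beta\big(1-i\rho\,\mathrm{sign}(z)\tan(\pi\beta/2)\big),&\beta\ne1,\\ -K_+\pi|z|+i\gamma'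 z,&\beta=1,\end{cases}$$ with $s=\frac{\Gamma(2-\beta)}{\beta(1-\beta)}\cos(\pi\beta/2)(K_++K_-)$ and $\rho=\frac{K_+-K_-}{K_++K_-}$ ($\rho:=0$ if $K_++K_-=0$). **Theorem.** Let $\pi:(\Omega',\mathcal F',\mathbb P')\to(\Omega,\mathcal F,\mathbb P)$ be an extension as above. (i) Suppose $b>0$. If $B^{(1)},B^{(2)}$ are independent standard Brownian motions on the extension, jointly independent of $\mathcal F$ (in particular of $L$), then the integrals below exist for all $t\ge0$ and $$\frac1{\sqrt{n\Delta_n}}Z^n_t\ \overset{\mathcal F\text{-}fd}{\longrightarrow}\ \sigma\int_0^t(t-r)\,d\big(B^{(1)}_r+B^{(2)}_r\big),\quad t\ge0,\qquad \sigma=\sqrt{b^2a(0)} .$$ (ii) Suppose $b=0$ and that for some $0<\beta<2$ and $\tilde K_\pm$ with $\tilde K_++\tilde K_->0$ one has, as $x\downarrow0$, $x^\beta\nu((x,\infty))\to\tilde K_+$ and $x^\beta\nu((-\infty,-x))\to\tilde K_-$; if $\beta=1$ suppose in addition that $\tilde K_+=\tilde K_-$ and that the principal value $\mathrm{PV}\int_{-1}^1x\,\nu(dx)=\lim_{\varepsilon\downarrow0}\int_{\varepsilon<|x|\le1}x\,\nu(dx)$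 exists in $\mathbb R$. If $Y^{(1)},Y^{(2)}$ are independent Lévy processes on the extension, jointly independent of $\mathcal F$ (in particular of $L$), with $$\mathbb E e^{izY^{(q)}_1}=\exp\psi\big(z;\beta,\varrho\tilde K_+,\varrho\tilde K_-,\tilde\gamma\big),\quad z\in\mathbb R,\ q=1,2,\qquad \varrho=\beta a(0),$$ where $\tilde\gamma=\gamma+\mathrm{PV}\int_{-1}^1x\,\nu(dx)$ when $\beta=1$ ($\tilde\gamma$ plays no role when $\beta\neq1$), then the integrals below exist for all $t\ge0$ and $$\frac1{(n\Delta_n)^{1/\beta}}Z^n_t\ \overset{\mathcal F\text{-}fd}{\longrightarrow}\ \int_0^t(t-s)\,d\big(Y^{(1)}_s-Y^{(2)}_s\big),\quad t\ge0 .$$ -/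

import Mathlib

open MeasureTheory ProbabilityTheory Filter Topology
open scoped NNReal ENNReal BoundedContinuousFunction

noncomputable section

/-! ### Lévy bases -/

/-- `ν` is a Lévy measure on `ℝ`: `ν({0}) = 0` and `∫ (1 ∧ x²) ν(dx) < ∞`. -/
structure IsLevyMeasure (ν : Measure ℝ) : Prop where
  zero : ν {0} = 0
  integrable : Integrable (fun x : ℝ => min 1 (x ^ 2)) ν

/-- The characteristic exponent of the triplet `(γ, b, ν)`,
`ψ(z) = iγz - b²z²/2 + ∫_{ℝ∖{0}} (e^{izx} - 1 - izx 1_{|x| ≤ 1}) ν(dx)`. -/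
def levyExponent (γ b : ℝ) (ν : Measure ℝ) (z : ℝ) : ℂ :=
  Complex.I * γ * z - (1 / 2 : ℂ) * b ^ 2 * z ^ 2
    + ∫ x in ({0}ᶜ : Set ℝ),
        (Complex.exp (Complex.I * z * x) - 1
          - Complex.I * z * x * (if |x| ≤ 1 then (1 : ℂ) else 0)) ∂ν

/-- `L` is a homogeneous Lévy basis on `ℝ²` with characteristic triplet `(γ, b, ν)`: a random
measure on the Borel sets of finite Lebesgue measure (the values of `L` on other sets play no
role) which is independently scattered, almost surely σ-additive, and such that
`E exp(i z L(A)) = exp(Leb(A) ψ(z))`; in particular every `L(A)` is infinitely divisible. The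
series in `sigma_additive` converges in the given order, not necessarily absolutely. -/
structure IsHomogeneousLevyBasis {Ω : Type*} [MeasurableSpace Ω] (P : Measure Ω)
    (γ b : ℝ) (ν : Measure ℝ) (L : Set (ℝ × ℝ) → Ω → ℝ) : Prop where
  measurable : ∀ A : Set (ℝ × ℝ), MeasurableSet A → volume A ≠ ∞ → Measurable (L A)
  indep : ∀ A : ℕ → Set (ℝ × ℝ), (∀ i, MeasurableSet (A i)) → (∀ i, volume (A i) ≠ ∞) →
    Pairwise (fun i j => Disjoint (A i) (A j)) → iIndepFun (fun i => L (A i)) P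
  sigma_additive : ∀ A : ℕ → Set (ℝ × ℝ), (∀ i, MeasurableSet (A i)) →
    Pairwise (fun i j => Disjoint (A i) (A j)) → volume (⋃ i, A i) ≠ ∞ →
    ∀ᵐ ω ∂P, Tendsto (fun m : ℕ => ∑ i ∈ Finset.range m, L (A i) ω) atTop
      (𝓝 (L (⋃ i, A i) ω))
  charFun_eq : ∀ A : Set (ℝ × ℝ), MeasurableSet A → volume A ≠ ∞ → ∀ z : ℝ,
    charFun (P.map (L A)) z = Complex.exp ((volume.real A : ℂ) * levyExponent γ b ν z)

/-- `κ` is the law of the Lévy seed `L'` with characteristic triplet `(γ, b, ν)`. -/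
def IsSeedLaw (γ b : ℝ) (ν κ : Measure ℝ) : Prop :=
  IsProbabilityMeasure κ ∧ ∀ z : ℝ, charFun κ z = Complex.exp (levyExponent γ b ν z)

/-! ### Trawl processes and their partial sums -/

/-- `a` (restricted to `[0, ∞)`) is a trawl function: nonnegative, non-increasing, integrable and
continuous on `[0, ∞)`. -/
structure IsTrawlFunction (a : ℝ → ℝ) : Prop where
  nonneg : ∀ s, 0 ≤ s → 0 ≤ a s
  antitone : AntitoneOn a (Set.Ici 0)
  integrable : IntegrableOn a (Set.Ici 0)
  continuous : ContinuousOn a (Set.Ici 0)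

/-- The trawl set `A = {(r, y) : r ≤ 0, 0 ≤ y ≤ a(-r)}`. -/
def trawlSet (a : ℝ → ℝ) : Set (ℝ × ℝ) :=
  {p | p.1 ≤ 0 ∧ 0 ≤ p.2 ∧ p.2 ≤ a (-p.1)}

/-- The translated trawl set `A_t = A + (t, 0)`. -/
def trawlSetAt (a : ℝ → ℝ) (t : ℝ) : Set (ℝ × ℝ) :=
  {p | (p.1 - t, p.2) ∈ trawlSet a}

/-- The trawl process `X_t = L(A_t)`. -/
def trawlProcess {Ω : Type*} (L : Set (ℝ × ℝ) → Ω → ℝ) (a : ℝ → ℝ) (t : ℝ) (ω : Ω) : ℝ :=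
  L (trawlSetAt a t) ω

/-- The centered partial sum `S_m^Δ = ∑_{k=0}^{m-1} (X_{Δk} - E X_{Δk})`. -/
def centeredSum {Ω : Type*} [MeasurableSpace Ω] (P : Measure Ω) (X : ℝ → Ω → ℝ)
    (Δ : ℝ) (m : ℕ) (ω : Ω) : ℝ :=
  ∑ k ∈ Finset.range m, (X (Δ * k) ω - ∫ ω', X (Δ * k) ω' ∂P)

/-- `Z^n_t = ([nt]/n) (X_0 - E X_0) - (1/n) S_{[nt]}^{Δ_n}`. -/
def secondOrderError {Ω : Type*} [MeasurableSpace Ω] (P : Measure Ω) (X : ℝ → Ω → ℝ)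
    (Δ : ℕ → ℝ) (n : ℕ) (t : ℝ≥0) (ω : Ω) : ℝ :=
  (⌊(n : ℝ) * (t : ℝ)⌋₊ : ℝ) / n * (X 0 ω - ∫ ω', X 0 ω' ∂P)
    - 1 / (n : ℝ) * centeredSum P X (Δ n) ⌊(n : ℝ) * (t : ℝ)⌋₊ ω

/-! ### Stable convergence of finite-dimensional distributions -/

/-- `𝒢`-stable convergence of the finite-dimensional distributions of the processes `Xn n` on
`(Ω, P)` to those of a process `X` defined on an extension `π : (Ω', P') → (Ω, P)`: conditionally
on any non-null event `F ∈ 𝒢`, the vectors `(Xn n (u i))_i` converge in distribution to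
`(X (u i))_i`. -/
def FddStablyTendsto {Ω Ω' T : Type*} [MeasurableSpace Ω] [MeasurableSpace Ω']
    (𝒢 : MeasurableSpace Ω) (P : Measure Ω) (P' : Measure Ω') (π : Ω' → Ω)
    (Xn : ℕ → T → Ω → ℝ) (X : T → Ω' → ℝ) : Prop :=
  (∀ n t, AEMeasurable (Xn n t) P) ∧ (∀ t, AEMeasurable (X t) P') ∧
  ∀ (q : ℕ) (u : Fin q → T) (F : Set Ω), MeasurableSet[𝒢] F → P F ≠ 0 →
    ∀ f : (Fin q → ℝ) →ᵇ ℝ,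
      Tendsto (fun n => ∫ ω, f (fun i => Xn n (u i) ω) ∂(P[|F])) atTop
        (𝓝 (∫ ω, f (fun i => X (u i) ω) ∂(P'[|π ⁻¹' F])))

/-! ### Lévy processes and integrals against them -/

/-- `Y` is a (real) Lévy process: it starts at `0`, has independent and stationary increments and
almost surely càdlàg paths. -/
structure IsLevyProcess {Ω : Type*} [MeasurableSpace Ω] (P : Measure Ω)
    (Y : ℝ≥0 → Ω → ℝ) : Prop where
  measurable : ∀ t, Measurable (Y t)
  zero : ∀ᵐ ω ∂P, Y 0 ω = 0
  indep_increments : HasIndepIncrements Y P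
  stationary : ∀ s t : ℝ≥0, IdentDistrib (fun ω => Y (s + t) ω - Y s ω) (Y t) P P
  cadlag : ∀ᵐ ω ∂P, ∀ t : ℝ≥0, ContinuousWithinAt (fun s => Y s ω) (Set.Ici t) t ∧
    ∃ l : ℝ, Tendsto (fun s => Y s ω) (𝓝[<] t) (𝓝 l)

/-- The characteristic exponent `ψ(z; β, K₊, K₋, γ)` of the strictly `β`-stable law with Lévy
density `K₊ x^{-1-β}` on `(0, ∞)` and `K₋ |x|^{-1-β}` on `(-∞, 0)`; for `β = 1` one has `K₊ = K₋`
and `γ` is the drift, which is not used for `β ≠ 1`. -/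
def stableExponent (β Kp Km γ : ℝ) (z : ℝ) : ℂ :=
  if β = 1 then
    -((Kp * Real.pi * |z| : ℝ) : ℂ) + Complex.I * γ * z
  else
    -((Real.Gamma (2 - β) / (β * (1 - β)) * Real.cos (Real.pi * β / 2) * (Kp + Km)
        * |z| ^ β : ℝ) : ℂ)
      * (1 - Complex.I
          * (((Kp - Km) / (Kp + Km) * Real.sign z * Real.tan (Real.pi * β / 2) : ℝ) : ℂ))

/-- `H = ∫_0^t f(r) dY_r`, the Wiener-type integral of a (continuous) deterministic function with
respect to the process `Y`: `H` is the limit in probability of the sums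
`∑_i f(u_i) (Y_{u_{i+1}} - Y_{u_i})` along every sequence of partitions
`0 = u_0 ≤ u_1 ≤ ⋯ ≤ u_N = t` with mesh tending to `0`. -/
def IsWienerIntegral {Ω : Type*} [MeasurableSpace Ω] (P : Measure Ω)
    (f : ℝ → ℝ) (Y : ℝ≥0 → Ω → ℝ) (t : ℝ≥0) (H : Ω → ℝ) : Prop :=
  AEMeasurable H P ∧
  ∀ (N : ℕ → ℕ) (u : ℕ → ℕ → ℝ≥0), (∀ m, Monotone (u m)) → (∀ m, u m 0 = 0) →
    (∀ m, u m (N m) = t) →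
    Tendsto (fun m => (Finset.range (N m)).sup (fun i => u m (i + 1) - u m i)) atTop (𝓝 0) →
    TendstoInMeasure P
      (fun m ω => ∑ i ∈ Finset.range (N m), f (u m i) * (Y (u m (i + 1)) ω - Y (u m i) ω))
      atTop H

/-- The processes `Y₁`, `Y₂` on `(Ω', P')` are independent of each other, and jointly independent
of the σ-field of the original space `Ω`, pulled back along `π : Ω' → Ω`. -/
structure IndepPairOfBase {Ω Ω' : Type*} [MeasurableSpace Ω] [MeasurableSpace Ω']
    (P' : Measure Ω') (π : Ω' → Ω) (Y₁ Y₂ : ℝ≥0 → Ω' → ℝ) : Prop where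
  measurable_fst : ∀ t, Measurable (Y₁ t)
  measurable_snd : ∀ t, Measurable (Y₂ t)
  indep : IndepFun (fun ω t => Y₁ t ω) (fun ω t => Y₂ t ω) P'
  indep_base : IndepFun (fun ω => ((fun t => Y₁ t ω), (fun t => Y₂ t ω))) π P'

end

/-! The law of `X_t` does not depend on `t`, so the centring cancels and `Z^n_t` is `1/n` times the
sum over `k < [nt]` of `L(A_0) - L(A_{kΔ})`. By Cramér–Wold it suffices to study the combinations
`Y_n = ∑ θ_l Z^n_{u_l} / (nΔ_n)^{1/β}`. Each is the integral against `L` of a simple function `h_n`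
(`scaledKernel`), so that `E e^{iY_n} = exp ∫ ψ(h_n)`.

Put `ε = nΔ_n`. Left of the vertical axis the sets `A_0 \ A_{kΔ}` increase with `k`, and a point
lost at time `εx` carries the weight `w_n(x) = ε^{-1/β} · discreteRamp`, where the discrete ramp
tends to `ramp(x) = ∑ θ_l (u_l - x)⁺`. Right of the axis the point `(εx, y)` with `0 ≤ y < a(0)`
carries exactly `-w_n(x)` once `n` is large. Hence `∫ ψ(h_n)` is close to `a(0) ε ∫ (ψ(w_n) +
ψ(-w_n)) dx = 2 a(0) ε ∫ Re ψ(w_n) dx`. Drift and skewness disappear, and the two sides account for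
the two independent processes in the limit.

If `Re ψ(z) ~ -κ|z|^β` at infinity, the limit is `-2κ a(0) ∫ |ramp|^β`. With a Gaussian part, `β =
2` and `κ = b²/2`; otherwise `κ` comes from the tails of `ν` at `0` through `∫_0^∞ (1 - cos u)
u^{-1-β} du`. `IsStableLike` records what is needed: the asymptotics of the real part, and a bound,
up to a drift, that serves as domination in `tendsto_integral_scaledKernel`.

For stability, `h_n` is supported in a set of area `O(ε)`. By the quasi-additivity
`norm_levyExponent_add_le`, `Y_n` is then asymptotically independent of every fixed `Y_m`, and a
Hilbert space argument (`tendsto_setIntegral_of_mixing`) extends this to every event.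

On the limit side, summation by parts along càdlàg paths turns `∫ (t - s) dY_s` into `∫_0^t Y_s ds`
(`pathIntegral`). Its joint characteristic function is a limit of products over grid increments, and
gives the same exponent. -/

noncomputable section

/-! ### The characteristic exponent -/

/-- The integrand of the jump part of `levyExponent`. -/
def levyKernel (z x : ℝ) : ℂ :=
  Complex.exp (Complex.I * z * x) - 1 - Complex.I * z * x * (if |x| ≤ 1 then (1 : ℂ) else 0)

lemma measurable_levyKernel (z : ℝ) : Measurable (levyKernel z) := by
  unfold levyKernel
  have : Measurable fun x : ℝ => (if |x| ≤ 1 then (1 : ℂ) else 0) :=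
    Measurable.ite (measurableSet_le (by fun_prop) measurable_const) measurable_const
      measurable_const
  fun_prop

lemma norm_exp_I_mul_sub_one_le_two (u : ℝ) : ‖Complex.exp (Complex.I * u) - 1‖ ≤ 2 := by
  refine (norm_sub_le _ _).trans ?_
  rw [mul_comm, Complex.norm_exp_ofReal_mul_I]
  norm_num

lemma norm_exp_I_mul_sub_one_sub_le (u : ℝ) :
    ‖Complex.exp (Complex.I * u) - 1 - Complex.I * u‖ ≤ 3 * u ^ 2 := by
  rcases le_or_gt |u| 1 with h | h
  · have := Complex.norm_exp_sub_one_sub_id_le (x := Complex.I * u) (by simpa using h)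
    simp only [Complex.norm_mul, Complex.norm_I, one_mul, Complex.norm_real, Real.norm_eq_abs,
      sq_abs] at this
    nlinarith [sq_nonneg u]
  · have h1 := norm_sub_le (Complex.exp (Complex.I * u) - 1) (Complex.I * u)
    have h2 := norm_exp_I_mul_sub_one_le_two u
    have h3 : ‖Complex.I * (u : ℂ)‖ = |u| := by simp
    rw [← sq_abs u]
    nlinarith

lemma norm_levyKernel_le (z x : ℝ) : ‖levyKernel z x‖ ≤ (2 + 3 * z ^ 2) * min 1 (x ^ 2) := by
  unfold levyKernel
  rw [show Complex.I * z * x = Complex.I * ((z * x : ℝ) : ℂ) by push_cast; ring]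
  split_ifs with h
  · have h1 := norm_exp_I_mul_sub_one_sub_le (z * x)
    have h2 : x ^ 2 ≤ 1 := by rw [← sq_abs]; nlinarith [abs_nonneg x]
    rw [mul_one, min_eq_right h2]
    nlinarith [sq_nonneg x]
  · have h1 := norm_exp_I_mul_sub_one_le_two (z * x)
    have h2 : 1 ≤ x ^ 2 := by rw [← sq_abs]; nlinarith [abs_nonneg x]
    rw [mul_zero, sub_zero, min_eq_left h2]
    nlinarith [sq_nonneg z]

/-- The compensator is purely imaginary, so it leaves no trace here. -/
lemma levyKernel_re (z x : ℝ) : (levyKernel z x).re = Real.cos (z * x) - 1 := by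
  unfold levyKernel
  rw [show Complex.I * z * x = ((z * x : ℝ) : ℂ) * Complex.I by push_cast; ring]
  split_ifs <;> simp [-Complex.ofReal_mul, Complex.exp_ofReal_mul_I_re]

lemma normSq_exp_sub_one (u : ℝ) :
    ‖Complex.exp (Complex.I * u) - 1‖ ^ 2 = 2 * (1 - Real.cos u) := by
  rw [mul_comm, ← Complex.normSq_eq_norm_sq, Complex.normSq_apply]
  simp only [Complex.sub_re, Complex.sub_im, Complex.exp_ofReal_mul_I_re,
    Complex.exp_ofReal_mul_I_im, Complex.one_re, Complex.one_im]
  nlinarith [Real.sin_sq_add_cos_sq u]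

/-- The compensator is additive in the first argument and cancels; what remains is `e^{ixu} e^{iyu}
- e^{ixu} - e^{iyu} + 1`, which factors. -/
lemma levyKernel_add (x y u : ℝ) :
    levyKernel (x + y) u - levyKernel x u - levyKernel y u
      = (Complex.exp (Complex.I * (x * u : ℝ)) - 1) * (Complex.exp (Complex.I * (y * u : ℝ)) - 1) := by
  unfold levyKernel
  rw [show Complex.I * ((x + y : ℝ) : ℂ) * u
    = Complex.I * (x * u : ℝ) + Complex.I * (y * u : ℝ) by push_cast; ring, Complex.exp_add]
  push_cast
  ring_nf

/-- Since `|e^{ixu} - 1|² = -2 Re (levyKernel x u)`, this is the weighted inequality `2AB ≤ δA² +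
δ⁻¹B²`. The free weight `δ` later makes the contribution of one argument small at the expense of the
other. -/
lemma norm_levyKernel_add_le {δ : ℝ} (hδ : 0 < δ) (x y u : ℝ) :
    ‖levyKernel (x + y) u - levyKernel x u - levyKernel y u‖
      ≤ δ * -(levyKernel x u).re + δ⁻¹ * -(levyKernel y u).re := by
  rw [levyKernel_add, norm_mul, levyKernel_re, levyKernel_re]
  have h1 := normSq_exp_sub_one (x * u)
  have h2 := normSq_exp_sub_one (y * u)
  set A := ‖Complex.exp (Complex.I * (x * u : ℝ)) - 1‖
  set B := ‖Complex.exp (Complex.I * (y * u : ℝ)) - 1‖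
  have h3 : δ * (δ⁻¹ * B) = B := by field_simp
  have h4 : 0 ≤ δ * (A - δ⁻¹ * B) ^ 2 := by positivity
  have h5 : δ * (A - δ⁻¹ * B) ^ 2 = δ * A ^ 2 - 2 * (A * B) + δ⁻¹ * B ^ 2 := by
    field_simp
    ring
  rw [h5, h1, h2] at h4
  linarith

/-! ### Continuity, symmetry and quasi-additivity of the exponent. -/

section

variable {γ b : ℝ} {ν : Measure ℝ}

lemma IsLevyMeasure.integrable_levyKernel (hν : IsLevyMeasure ν) (z : ℝ) :
    Integrable (levyKernel z) ν :=
  (hν.integrable.const_mul (2 + 3 * z ^ 2)).mono' (measurable_levyKernel z).aestronglyMeasurable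
    (ae_of_all _ (norm_levyKernel_le z))

lemma IsLevyMeasure.levyExponent_eq (hν : IsLevyMeasure ν) (z : ℝ) :
    levyExponent γ b ν z = Complex.I * γ * z - (1 / 2 : ℂ) * b ^ 2 * z ^ 2
      + ∫ x, levyKernel z x ∂ν := by
  have : ν.restrict {0}ᶜ = ν := by
    refine Measure.restrict_eq_self_of_ae_mem ?_
    rw [ae_iff]
    simpa using hν.zero
  simp only [levyExponent, this, levyKernel]

lemma continuous_levyKernel_left (x : ℝ) : Continuous fun z => levyKernel z x := by
  unfold levyKernel
  fun_prop

lemma IsLevyMeasure.continuous_levyExponent (hν : IsLevyMeasure ν) :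
    Continuous (levyExponent γ b ν) := by
  have h : Continuous fun z => ∫ x, levyKernel z x ∂ν := by
    refine continuous_iff_continuousAt.2 fun z₀ => ?_
    refine continuousAt_of_dominated
      (bound := fun x => (2 + 3 * (|z₀| + 1) ^ 2) * min 1 (x ^ 2))
      (Eventually.of_forall fun z => (measurable_levyKernel z).aestronglyMeasurable) ?_
      (hν.integrable.const_mul _)
      (ae_of_all _ fun x => (continuous_levyKernel_left x).continuousAt)
    filter_upwards [Metric.ball_mem_nhds z₀ one_pos] with z hz
    refine ae_of_all _ fun x => (norm_levyKernel_le z x).trans ?_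
    have h1 : |z| ≤ |z₀| + 1 := by
      have := abs_sub_abs_le_abs_sub z z₀
      rw [Metric.mem_ball, Real.dist_eq] at hz
      linarith
    have h2 : z ^ 2 ≤ (|z₀| + 1) ^ 2 := by
      rw [← sq_abs]
      gcongr
    gcongr
  rw [funext hν.levyExponent_eq]
  fun_prop

lemma IsLevyMeasure.levyExponent_zero (hν : IsLevyMeasure ν) : levyExponent γ b ν 0 = 0 := by
  rw [hν.levyExponent_eq]
  simp [levyKernel]

lemma levyKernel_neg (z x : ℝ) : levyKernel (-z) x = starRingEnd ℂ (levyKernel z x) := by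
  unfold levyKernel
  split_ifs <;> simp [← Complex.exp_conj]

lemma IsLevyMeasure.levyExponent_neg (hν : IsLevyMeasure ν) (z : ℝ) :
    levyExponent γ b ν (-z) = starRingEnd ℂ (levyExponent γ b ν z) := by
  rw [hν.levyExponent_eq, hν.levyExponent_eq]
  simp only [levyKernel_neg, integral_conj, map_add, map_sub, map_mul, map_pow, Complex.conj_I,
    Complex.conj_ofReal, map_div₀, map_one, map_ofNat]
  push_cast
  ring

lemma IsLevyMeasure.levyExponent_re (hν : IsLevyMeasure ν) (z : ℝ) :
    (levyExponent γ b ν z).re = -(1 / 2) * b ^ 2 * z ^ 2 - ∫ x, (1 - Real.cos (z * x)) ∂ν := by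
  have h1 : (∫ x, levyKernel z x ∂ν).re = ∫ x, (levyKernel z x).re ∂ν :=
    (integral_re (hν.integrable_levyKernel z)).symm
  rw [hν.levyExponent_eq, Complex.add_re, h1]
  simp only [levyKernel_re]
  rw [show (Complex.I * γ * z - (1 / 2 : ℂ) * b ^ 2 * z ^ 2)
    = ((-(1 / 2) * b ^ 2 * z ^ 2 : ℝ) : ℂ) + ((γ * z : ℝ) : ℂ) * Complex.I by push_cast; ring,
    Complex.add_re, Complex.ofReal_re, Complex.re_ofReal_mul, Complex.I_re, mul_zero, add_zero,
    sub_eq_add_neg, ← integral_neg]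
  simp only [neg_sub]

/-- Quasi-additivity of the characteristic exponent. -/
lemma IsLevyMeasure.norm_levyExponent_add_le (hν : IsLevyMeasure ν) {δ : ℝ} (hδ : 0 < δ)
    (x y : ℝ) :
    ‖levyExponent γ b ν (x + y) - levyExponent γ b ν x - levyExponent γ b ν y‖
      ≤ δ * -(levyExponent γ b ν x).re + δ⁻¹ * -(levyExponent γ b ν y).re := by
  have ix := hν.integrable_levyKernel x
  have iy := hν.integrable_levyKernel y
  have ixy := hν.integrable_levyKernel (x + y)
  -- The drift is linear and drops out; the Gaussian part leaves its cross term only.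
  have e1 : levyExponent γ b ν (x + y) - levyExponent γ b ν x - levyExponent γ b ν y
      = -((b ^ 2 * (x * y) : ℝ) : ℂ)
        + ∫ u, (levyKernel (x + y) u - levyKernel x u - levyKernel y u) ∂ν := by
    rw [integral_sub (f := fun u => levyKernel (x + y) u - levyKernel x u) (ixy.sub ix) iy,
      integral_sub ixy ix]
    simp only [hν.levyExponent_eq]
    push_cast
    ring
  have e2 : ‖∫ u, (levyKernel (x + y) u - levyKernel x u - levyKernel y u) ∂ν‖
      ≤ δ * -(∫ u, (levyKernel x u).re ∂ν) + δ⁻¹ * -(∫ u, (levyKernel y u).re ∂ν) := by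
    have rx : Integrable (fun u => δ * -(levyKernel x u).re) ν := ix.re.neg.const_mul δ
    have ry : Integrable (fun u => δ⁻¹ * -(levyKernel y u).re) ν := iy.re.neg.const_mul δ⁻¹
    rw [← integral_neg, ← integral_neg, ← integral_const_mul, ← integral_const_mul,
      ← integral_add rx ry]
    exact norm_integral_le_of_norm_le
      (rx.add ry)
      (ae_of_all _ fun u => norm_levyKernel_add_le hδ x y u)
  have e3 : ‖(-((b ^ 2 * (x * y) : ℝ) : ℂ))‖
      ≤ δ * (1 / 2 * b ^ 2 * x ^ 2) + δ⁻¹ * (1 / 2 * b ^ 2 * y ^ 2) := by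
    rw [norm_neg, Complex.norm_real, Real.norm_eq_abs, abs_mul, abs_of_nonneg (sq_nonneg b)]
    have h4 : |x * y| ≤ (δ * x ^ 2 + δ⁻¹ * y ^ 2) / 2 := by
      rw [abs_mul, ← sq_abs x, ← sq_abs y]
      have h4 : 0 ≤ δ * (|x| - δ⁻¹ * |y|) ^ 2 := by positivity
      have h5 : δ * (|x| - δ⁻¹ * |y|) ^ 2 = δ * |x| ^ 2 - 2 * (|x| * |y|) + δ⁻¹ * |y| ^ 2 := by
        field_simp
        ring
      linarith
    nlinarith [sq_nonneg b, mul_le_mul_of_nonneg_left h4 (sq_nonneg b)]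
  have hre : ∀ z, (levyExponent γ b ν z).re
      = -(1 / 2) * b ^ 2 * z ^ 2 + ∫ u, (levyKernel z u).re ∂ν := fun z => by
    rw [hν.levyExponent_re, sub_eq_add_neg, ← integral_neg]
    simp only [levyKernel_re, neg_sub]
  rw [e1, hre, hre]
  refine (norm_add_le _ _).trans ((add_le_add e3 e2).trans_eq (by ring))

/-! ### Stable-like exponents. -/

/-- `Ψ` behaves at infinity like a symmetric `β`-stable exponent `-κ|z|^β`, up to a drift `c` and
up to an imaginary part of order at most `|z|^β`. -/
structure IsStableLike (Ψ : ℝ → ℂ) (β c κ : ℝ) : Prop where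
  bound : ∃ C, ∀ z : ℝ, ‖Ψ z - Complex.I * c * z‖ ≤ C * (1 + |z| ^ β)
  re_asymp : ∀ δ > 0, ∃ C, ∀ z : ℝ, |(Ψ z).re + κ * |z| ^ β| ≤ δ * |z| ^ β + C

/-- Conjugation symmetry carries large positive arguments to large negative ones, and continuity
absorbs the compact middle range into the constants. -/
lemma IsStableLike.of_tendsto {Ψ : ℝ → ℂ} {β c κ C : ℝ} (hΨ : Continuous Ψ)
    (hneg : ∀ z, Ψ (-z) = starRingEnd ℂ (Ψ z)) (hβ : 0 < β)
    (hb : ∀ z, 1 ≤ z → ‖Ψ z - Complex.I * c * z‖ ≤ C * z ^ β)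
    (hre : Tendsto (fun z => (Ψ z).re / z ^ β) atTop (𝓝 (-κ))) :
    IsStableLike Ψ β c κ := by
  constructor
  · obtain ⟨D, hD⟩ := (isCompact_Icc (a := (-1 : ℝ)) (b := 1)).exists_bound_of_continuousOn
      (f := fun z : ℝ => Ψ z - Complex.I * c * z) (by fun_prop)
    have hpos : ∀ z, 1 ≤ z → ‖Ψ z - Complex.I * c * z‖ ≤ max C D * (1 + |z| ^ β) := by
      intro z hz
      have h0 : 0 ≤ z ^ β := by positivity
      have hC : 0 ≤ max C D := (norm_nonneg _).trans ((hD 0 (by simp)).trans (le_max_right _ _))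
      rw [abs_of_nonneg (by linarith)]
      refine (hb z hz).trans ?_
      calc C * z ^ β ≤ max C D * z ^ β := by gcongr; exact le_max_left _ _
        _ ≤ _ := by gcongr; linarith
    refine ⟨max C D, fun z => ?_⟩
    by_cases h1 : 1 ≤ z
    · exact hpos z h1
    by_cases h2 : z ≤ -1
    · have := hpos (-z) (by linarith)
      rw [hneg, abs_neg] at this
      rwa [← Complex.norm_conj, map_sub, map_mul, map_mul, Complex.conj_I, Complex.conj_ofReal,
        Complex.conj_ofReal,
        show -Complex.I * (c : ℂ) * z = Complex.I * c * ((-z : ℝ) : ℂ) by push_cast; ring]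
    · have h3 : ‖Ψ z - Complex.I * c * z‖ ≤ D := hD z ⟨by linarith, by linarith⟩
      have h4 : 0 ≤ |z| ^ β := by positivity
      have hC : 0 ≤ max C D := (norm_nonneg _).trans ((hD 0 (by simp)).trans (le_max_right _ _))
      have := le_max_right C D
      nlinarith
  · intro δ hδ
    obtain ⟨M, hM⟩ := (Metric.tendsto_atTop.1 hre) δ hδ
    obtain ⟨D, hD⟩ := (isCompact_Icc (a := -(max M 1)) (b := max M 1)).exists_bound_of_continuousOn
      (f := fun z : ℝ => (Ψ z).re + κ * |z| ^ β)
      (((Complex.continuous_re.comp hΨ).add (continuous_const.mul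
        (continuous_abs.rpow_const fun _ => Or.inr hβ.le))).continuousOn)
    have hpos : ∀ z, max M 1 ≤ z → |(Ψ z).re + κ * |z| ^ β| ≤ δ * |z| ^ β := by
      intro z hz
      have h1 : 0 < z := by linarith [le_max_right M 1]
      have h0 : 0 < z ^ β := by positivity
      have := (hM z ((le_max_left _ _).trans hz)).le
      rw [abs_of_pos h1]
      rw [Real.dist_eq, show (Ψ z).re / z ^ β - -κ = ((Ψ z).re + κ * z ^ β) / z ^ β by
        field_simp; ring, abs_div, abs_of_pos h0, div_le_iff₀ h0] at this
      exact this
    have hD0 : 0 ≤ D := (norm_nonneg _).trans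
      (hD 0 ⟨by linarith [le_max_right M 1], by linarith [le_max_right M 1]⟩)
    refine ⟨D, fun z => ?_⟩
    have h0 : 0 ≤ |z| ^ β := by positivity
    by_cases h1 : max M 1 ≤ z
    · linarith [hpos z h1]
    by_cases h2 : z ≤ -(max M 1)
    · have := hpos (-z) (by linarith)
      rw [hneg, Complex.conj_re, abs_neg] at this
      linarith
    · have := hD z ⟨by linarith, by linarith⟩
      rw [Real.norm_eq_abs] at this
      nlinarith

/-- With a Gaussian part the characteristic exponent is asymptotically quadratic. -/
lemma IsLevyMeasure.isStableLike_gaussian (hν : IsLevyMeasure ν) :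
    IsStableLike (levyExponent γ b ν) 2 γ (b ^ 2 / 2) := by
  refine IsStableLike.of_tendsto
    (C := |b| ^ 2 / 2 + 5 * ∫ x, min 1 (x ^ 2) ∂ν)
    hν.continuous_levyExponent hν.levyExponent_neg two_pos ?_ ?_
  · intro z hz
    have h1 : ‖∫ x, levyKernel z x ∂ν‖ ≤ (2 + 3 * z ^ 2) * ∫ x, min 1 (x ^ 2) ∂ν := by
      rw [← integral_const_mul]
      exact norm_integral_le_of_norm_le (hν.integrable.const_mul _)
        (ae_of_all _ (norm_levyKernel_le z))
    have h2 : 0 ≤ ∫ x, min 1 (x ^ 2) ∂ν := integral_nonneg fun x => by positivity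
    have h3 : ‖((1 / 2 : ℂ) * b ^ 2 * z ^ 2)‖ = |b| ^ 2 / 2 * z ^ 2 := by
      simp only [norm_mul, norm_pow, Complex.norm_real, Real.norm_eq_abs, sq_abs]
      norm_num
      left
      ring
    rw [hν.levyExponent_eq, show Complex.I * (γ : ℂ) * z - 1 / 2 * (b : ℂ) ^ 2 * z ^ 2
      + ∫ x, levyKernel z x ∂ν - Complex.I * γ * z
      = (∫ x, levyKernel z x ∂ν) - 1 / 2 * (b : ℂ) ^ 2 * z ^ 2 by ring]
    refine (norm_sub_le _ _).trans ?_
    rw [h3, Real.rpow_ofNat]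
    nlinarith [mul_le_mul_of_nonneg_right (show 1 ≤ z ^ 2 by nlinarith) h2]
  -- The jump part is `o(z²)`: the integrand tends to `0` pointwise, and the dominating factor `5`
  -- comes from `2 + 3z² ≤ 5z²` for `z ≥ 1`.
  · have h : Tendsto (fun z : ℝ => ∫ x, (1 - Real.cos (z * x)) / z ^ 2 ∂ν) atTop
        (𝓝 (∫ _, (0 : ℝ) ∂ν)) := by
      refine tendsto_integral_filter_of_dominated_convergence (fun x => 5 * min 1 (x ^ 2))
        (Eventually.of_forall fun z => by fun_prop) ?_ (hν.integrable.const_mul _) ?_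
      · filter_upwards [eventually_ge_atTop 1] with z hz
        refine ae_of_all _ fun x => ?_
        have h1 := (Complex.abs_re_le_norm _).trans (norm_levyKernel_le z x)
        rw [levyKernel_re, abs_sub_comm] at h1
        have h2 : (1 : ℝ) ≤ z ^ 2 := by nlinarith
        have h3 : 0 ≤ min 1 (x ^ 2) := by positivity
        rw [norm_div, Real.norm_eq_abs, Real.norm_eq_abs, abs_of_nonneg (sq_nonneg z),
          div_le_iff₀ (by positivity)]
        nlinarith
      · refine ae_of_all _ fun x => ?_
        refine squeeze_zero_norm' (a := fun z : ℝ => 2 / z ^ 2) ?_ ?_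
        · filter_upwards [eventually_ge_atTop 1] with z hz
          have h4 : |1 - Real.cos (z * x)| ≤ 2 := by
            rw [abs_le]; constructor <;> linarith [Real.neg_one_le_cos (z * x), Real.cos_le_one (z * x)]
          rw [norm_div, Real.norm_eq_abs, Real.norm_eq_abs, abs_of_nonneg (sq_nonneg z)]
          gcongr
        · exact tendsto_const_nhds.div_atTop (tendsto_pow_atTop two_ne_zero)
    simp only [integral_zero] at h
    have h2 := (tendsto_const_nhds (x := -(b ^ 2 / 2))).sub h
    rw [sub_zero] at h2
    refine h2.congr' ?_
    filter_upwards [eventually_ge_atTop 1] with z hz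
    rw [hν.levyExponent_re, integral_div, Real.rpow_ofNat]
    field_simp

end

/-! ### The stable constant -/

/-- Stated with `∫⁻`, like its companions below, so that the order of integration can be exchanged
without checking integrability. -/
lemma lintegral_Ioi_rpow_mul_exp {p c : ℝ} (hp : 0 < p) (hc : 0 < c) :
    ∫⁻ t in Set.Ioi 0, ENNReal.ofReal (t ^ (p - 1) * Real.exp (-(c * t)))
      = ENNReal.ofReal ((1 / c) ^ p * Real.Gamma p) := by
  have h := Real.integral_rpow_mul_exp_neg_mul_Ioi hp hc
  have h0 : (1 / c) ^ p * Real.Gamma p ≠ 0 := by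
    have := Real.Gamma_pos_of_pos hp
    positivity
  rw [← h]
  refine (ofReal_integral_eq_lintegral_ofReal ?_ ?_).symm
  -- A nonzero Bochner integral forces integrability, because the default value is `0`.
  · by_contra hn
    exact h0 (h ▸ integral_undef hn)
  · filter_upwards [ae_restrict_mem measurableSet_Ioi] with t ht
    have : 0 < t := ht
    simp only [Pi.zero_apply]
    positivity

lemma integral_Ioi_cos_mul_exp {s : ℝ} (hs : 0 < s) :
    IntegrableOn (fun u => Real.cos u * Real.exp (-(s * u))) (Set.Ioi 0) ∧
    ∫ u in Set.Ioi (0 : ℝ), Real.cos u * Real.exp (-(s * u)) = s / (1 + s ^ 2) := by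
  have ha : (-(s : ℂ) + Complex.I).re < 0 := by simpa using hs
  have h1 := integral_exp_mul_complex_Ioi ha 0
  have h2 := integrableOn_exp_mul_complex_Ioi ha 0
  have h3 : ∀ u : ℝ, (Complex.exp ((-(s : ℂ) + Complex.I) * u)).re
      = Real.cos u * Real.exp (-(s * u)) := by
    intro u
    rw [show (-(s : ℂ) + Complex.I) * u = ((-(s * u) : ℝ) : ℂ) + u * Complex.I by push_cast; ring,
      Complex.exp_add, ← Complex.ofReal_exp, Complex.re_ofReal_mul, Complex.exp_ofReal_mul_I_re,
      mul_comm]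
  have h4 : IntegrableOn (fun u : ℝ => (Complex.exp ((-(s : ℂ) + Complex.I) * u)).re)
    (Set.Ioi 0) := h2.re
  have h5 : ∫ u in Set.Ioi (0 : ℝ), (Complex.exp ((-(s : ℂ) + Complex.I) * u)).re
      = (∫ u in Set.Ioi (0 : ℝ), Complex.exp ((-(s : ℂ) + Complex.I) * u)).re := integral_re h2
  simp only [h3] at h4 h5
  refine ⟨h4, h5.trans ?_⟩
  rw [h1]
  have h6 : (0 : ℝ) < 1 + s ^ 2 := by positivity
  simp [Complex.div_re, Complex.normSq_apply]
  field_simp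
  ring

lemma lintegral_Ioi_one_sub_cos_mul_exp {s : ℝ} (hs : 0 < s) :
    ∫⁻ u in Set.Ioi 0, ENNReal.ofReal ((1 - Real.cos u) * Real.exp (-(s * u)))
      = ENNReal.ofReal (1 / (s * (1 + s ^ 2))) := by
  obtain ⟨h1, h2⟩ := integral_Ioi_cos_mul_exp hs
  have h3 : IntegrableOn (fun u => Real.exp (-(s * u))) (Set.Ioi 0) := by
    simpa using integrableOn_exp_mul_Ioi (neg_neg_of_pos hs) 0
  have h4 : ∫ u in Set.Ioi (0 : ℝ), Real.exp (-(s * u)) = 1 / s := by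
    have := integral_exp_mul_Ioi (neg_neg_of_pos hs) 0
    simpa [div_eq_mul_inv] using this
  have h5 : ∫ u in Set.Ioi (0 : ℝ), (1 - Real.cos u) * Real.exp (-(s * u))
      = 1 / (s * (1 + s ^ 2)) := by
    simp_rw [sub_mul, one_mul]
    rw [integral_sub h3 h1, h2, h4]
    have : (0 : ℝ) < 1 + s ^ 2 := by positivity
    field_simp
    ring
  rw [← h5]
  refine (ofReal_integral_eq_lintegral_ofReal ?_ ?_).symm
  · simp_rw [sub_mul, one_mul]
    exact h3.sub h1
  · exact ae_of_all _ fun u => mul_nonneg (sub_nonneg.2 (Real.cos_le_one u)) (Real.exp_pos _).le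

/-- Write `1/(1+s²)` as `∫ e^{-(1+s²)v} dv` and exchange. The inner Gaussian-type integral is
`Γ(β/2) v^{-β/2} / 2`, the outer one produces `Γ(1 - β/2)`, and Euler's reflection formula closes
the computation. -/
lemma lintegral_Ioi_rpow_div_one_add_sq {β : ℝ} (h0 : 0 < β) (h2 : β < 2) :
    ∫⁻ s in Set.Ioi (0 : ℝ), ENNReal.ofReal (s ^ (β - 1) / (1 + s ^ 2))
      = ENNReal.ofReal (Real.pi / (2 * Real.sin (Real.pi * β / 2))) := by
  have e1 : ∀ s ∈ Set.Ioi (0 : ℝ), ENNReal.ofReal (s ^ (β - 1) / (1 + s ^ 2))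
      = ∫⁻ v in Set.Ioi (0 : ℝ),
        ENNReal.ofReal (s ^ (β - 1)) * ENNReal.ofReal (Real.exp (-((1 + s ^ 2) * v))) := by
    intro s hs
    have hs0 : 0 < s := hs
    have h := lintegral_Ioi_rpow_mul_exp one_pos (show 0 < 1 + s ^ 2 by positivity)
    simp only [sub_self, Real.rpow_zero, one_mul, Real.rpow_one, Real.Gamma_one, mul_one] at h
    rw [lintegral_const_mul _ (by fun_prop), h, ← ENNReal.ofReal_mul (by positivity)]
    congr 1
    ring
  have e2 : ∀ v ∈ Set.Ioi (0 : ℝ), ∫⁻ s in Set.Ioi (0 : ℝ),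
        ENNReal.ofReal (s ^ (β - 1)) * ENNReal.ofReal (Real.exp (-((1 + s ^ 2) * v)))
      = ENNReal.ofReal (1 / 2 * Real.Gamma (β / 2))
        * ENNReal.ofReal (v ^ (1 - β / 2 - 1) * Real.exp (-(1 * v))) := by
    intro v hv
    have hv0 : 0 < v := hv
    have h := integral_rpow_mul_exp_neg_mul_rpow (p := 2) (q := β - 1) (b := v) two_pos
      (by linarith) hv0
    have hG : 0 < Real.Gamma (β / 2) := Real.Gamma_pos_of_pos (by linarith)
    simp only [Real.rpow_ofNat, sub_add_cancel] at h
    have hi : IntegrableOn (fun s : ℝ => s ^ (β - 1) * Real.exp (-v * s ^ 2)) (Set.Ioi 0) := by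
      by_contra hn
      rw [integral_undef hn] at h
      have : 0 < v ^ (-β / 2) * (1 / 2) * Real.Gamma (β / 2) := by positivity
      exact this.ne h
    have h' : ∫⁻ s in Set.Ioi (0 : ℝ), ENNReal.ofReal (s ^ (β - 1) * Real.exp (-v * s ^ 2))
        = ENNReal.ofReal (v ^ (-β / 2) * (1 / 2) * Real.Gamma (β / 2)) := by
      rw [← h]
      refine (ofReal_integral_eq_lintegral_ofReal hi ?_).symm
      filter_upwards [ae_restrict_mem measurableSet_Ioi] with t ht
      have : 0 < t := ht
      simp only [Pi.zero_apply]
      positivity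
    have e3 : ∀ s ∈ Set.Ioi (0 : ℝ),
        ENNReal.ofReal (s ^ (β - 1)) * ENNReal.ofReal (Real.exp (-((1 + s ^ 2) * v)))
        = ENNReal.ofReal (Real.exp (-v))
          * ENNReal.ofReal (s ^ (β - 1) * Real.exp (-v * s ^ 2)) := by
      intro s hs
      have hs0 : 0 < s := hs
      rw [← ENNReal.ofReal_mul (by positivity), ← ENNReal.ofReal_mul (by positivity),
        show -((1 + s ^ 2) * v) = -v + -v * s ^ 2 by ring, Real.exp_add]
      congr 1
      ring
    rw [setLIntegral_congr_fun measurableSet_Ioi e3, lintegral_const_mul _ (by fun_prop), h',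
      ← ENNReal.ofReal_mul (by positivity), ← ENNReal.ofReal_mul (by positivity)]
    congr 1
    rw [show 1 - β / 2 - 1 = -β / 2 by ring, one_mul]
    ring
  rw [setLIntegral_congr_fun measurableSet_Ioi e1, lintegral_lintegral_swap (by fun_prop),
    setLIntegral_congr_fun measurableSet_Ioi e2, lintegral_const_mul _ (by fun_prop),
    lintegral_Ioi_rpow_mul_exp (by linarith) one_pos, ← ENNReal.ofReal_mul
      (by have := Real.Gamma_pos_of_pos (show 0 < β / 2 by linarith); positivity)]
  congr 1
  have := Real.Gamma_mul_Gamma_one_sub (β / 2)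
  rw [div_one, Real.one_rpow, one_mul, mul_assoc, this, mul_div_assoc]
  rw [← mul_div_assoc, mul_comm (2 : ℝ), ← div_div]
  ring_nf

/-- `∫_0^∞ (1 - cos u) u^{-1-β} du`. -/
lemma lintegral_Ioi_one_sub_cos_mul_rpow {β : ℝ} (h0 : 0 < β) (h2 : β < 2) :
    ∫⁻ u in Set.Ioi (0 : ℝ), ENNReal.ofReal ((1 - Real.cos u) * u ^ (-1 - β))
      = ENNReal.ofReal (Real.pi / (2 * Real.sin (Real.pi * β / 2)) / Real.Gamma (1 + β)) := by
  have hG : 0 < Real.Gamma (1 + β) := Real.Gamma_pos_of_pos (by linarith)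
  -- The power `u^{-1-β}` is a Gamma integral of `s^β e^{-us}`; after exchanging, the inner integral
  -- is the Laplace transform of `1 - cos`.
  have e1 : ∀ u ∈ Set.Ioi (0 : ℝ), ENNReal.ofReal ((1 - Real.cos u) * u ^ (-1 - β))
      = ENNReal.ofReal (Real.Gamma (1 + β))⁻¹ * ∫⁻ s in Set.Ioi (0 : ℝ),
        ENNReal.ofReal (1 - Real.cos u) * ENNReal.ofReal (s ^ β * Real.exp (-(u * s))) := by
    intro u hu
    have hu0 : 0 < u := hu
    have h := lintegral_Ioi_rpow_mul_exp (show 0 < 1 + β by linarith) hu0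
    have hc : 0 ≤ 1 - Real.cos u := sub_nonneg.2 (Real.cos_le_one u)
    simp only [add_sub_cancel_left] at h
    rw [lintegral_const_mul _ (by fun_prop), h, ← ENNReal.ofReal_mul hc,
      ← ENNReal.ofReal_mul (by positivity)]
    congr 1
    rw [one_div, Real.inv_rpow hu0.le, ← Real.rpow_neg hu0.le, neg_add]
    field_simp
    ring_nf
  have e2 : ∀ s ∈ Set.Ioi (0 : ℝ), ∫⁻ u in Set.Ioi (0 : ℝ),
        ENNReal.ofReal (1 - Real.cos u) * ENNReal.ofReal (s ^ β * Real.exp (-(u * s)))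
      = ENNReal.ofReal (s ^ (β - 1) / (1 + s ^ 2)) := by
    intro s hs
    have hs0 : 0 < s := hs
    have e3 : ∀ u : ℝ,
        ENNReal.ofReal (1 - Real.cos u) * ENNReal.ofReal (s ^ β * Real.exp (-(u * s)))
        = ENNReal.ofReal (s ^ β) * ENNReal.ofReal ((1 - Real.cos u) * Real.exp (-(s * u))) := by
      intro u
      have hc : 0 ≤ 1 - Real.cos u := sub_nonneg.2 (Real.cos_le_one u)
      rw [← ENNReal.ofReal_mul hc, ← ENNReal.ofReal_mul (by positivity), mul_comm u s]
      congr 1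
      ring
    simp_rw [e3]
    rw [lintegral_const_mul _ (by fun_prop), lintegral_Ioi_one_sub_cos_mul_exp hs0,
      ← ENNReal.ofReal_mul (by positivity)]
    congr 1
    rw [Real.rpow_sub_one hs0.ne']
    field_simp
  rw [setLIntegral_congr_fun measurableSet_Ioi e1, lintegral_const_mul', lintegral_lintegral_swap,
    setLIntegral_congr_fun measurableSet_Ioi e2, lintegral_Ioi_rpow_div_one_add_sq h0 h2,
    ← ENNReal.ofReal_mul (by positivity)]
  · congr 1
    ring
  · fun_prop
  · exact ENNReal.ofReal_ne_top

/-! ### Regularly varying tails -/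

/-- The layer cake formula for Bochner integrals. The integrability in the conclusion allows two
instances of it to be subtracted. -/
lemma integral_comp_eq_integral_measureReal_lt_mul {α : Type*} [MeasurableSpace α] {μ : Measure α}
    {f : α → ℝ} {g : ℝ → ℝ} (hf : Measurable f) (hf0 : ∀ x, 0 ≤ f x) (hg : Continuous g)
    (hg0 : ∀ t, 0 < t → 0 ≤ g t) (hint : Integrable (fun x => ∫ t in (0 : ℝ)..f x, g t) μ)
    (hfin : ∀ t, 0 < t → μ {x | t < f x} ≠ ∞) :
    IntegrableOn (fun t => μ.real {x | t < f x} * g t) (Set.Ioi 0) ∧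
      ∫ x, (∫ t in (0 : ℝ)..f x, g t) ∂μ = ∫ t in Set.Ioi 0, μ.real {x | t < f x} * g t := by
  have hg0' : ∀ᵐ t ∂volume.restrict (Set.Ioi (0 : ℝ)), 0 ≤ g t := by
    filter_upwards [ae_restrict_mem measurableSet_Ioi] with t ht using hg0 t ht
  have h := lintegral_comp_eq_lintegral_meas_lt_mul μ (ae_of_all _ hf0) hf.aemeasurable
    (fun t _ => hg.intervalIntegrable 0 t) hg0'
  have hnn : 0 ≤ᵐ[μ] fun x => ∫ t in (0 : ℝ)..f x, g t := by
    refine ae_of_all _ fun x => ?_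
    simp only [Pi.zero_apply]
    rw [intervalIntegral.integral_of_le (hf0 x)]
    exact setIntegral_nonneg measurableSet_Ioc fun t ht => hg0 t ht.1
  have hm : Measurable fun t : ℝ => μ {x | t < f x} :=
    Antitone.measurable fun s t hst => measure_mono fun x hx => lt_of_le_of_lt hst hx
  have e : ∀ t ∈ Set.Ioi (0 : ℝ), (μ {x | t < f x} * ENNReal.ofReal (g t)).toReal
      = μ.real {x | t < f x} * g t := fun t ht => by
    rw [ENNReal.toReal_mul, ENNReal.toReal_ofReal (hg0 t ht)]; rfl
  have hne : ∫⁻ t in Set.Ioi (0 : ℝ), μ {x | t < f x} * ENNReal.ofReal (g t) ≠ ∞ := by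
    rw [← h]
    exact hint.lintegral_lt_top.ne
  have hm2 : Measurable fun t : ℝ => μ {x | t < f x} * ENNReal.ofReal (g t) :=
    hm.mul hg.measurable.ennreal_ofReal
  have i := integrable_toReal_of_lintegral_ne_top hm2.aemeasurable hne
  refine ⟨(integrableOn_congr_fun e measurableSet_Ioi).1 i, ?_⟩
  rw [integral_eq_lintegral_of_nonneg_ae hnn hint.aestronglyMeasurable, h,
    ← setIntegral_congr_fun measurableSet_Ioi e, integral_toReal hm2.aemeasurable]
  filter_upwards [ae_restrict_mem measurableSet_Ioi] with t ht
  exact ENNReal.mul_lt_top (hfin t ht).lt_top ENNReal.ofReal_lt_top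

section

variable {ν : Measure ℝ}

lemma IsLevyMeasure.measure_abs_gt_ne_top (hν : IsLevyMeasure ν) {r : ℝ} (hr : 0 < r) :
    ν {x | r < |x|} ≠ ∞ := by
  have h := hν.integrable.measure_ge_lt_top (show 0 < min 1 (r ^ 2) by positivity)
  refine (lt_of_le_of_lt (measure_mono fun x hx => ?_) h).ne
  have hx : r < |x| := hx
  simp only [Set.mem_ofPred_eq]
  rw [← sq_abs x]
  gcongr

lemma measurableSet_abs_gt (r : ℝ) : MeasurableSet {x : ℝ | r < |x|} :=
  measurableSet_lt measurable_const (by fun_prop)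

lemma IsLevyMeasure.integrable_of_le (hν : IsLevyMeasure ν) {f : ℝ → ℝ} (hf : Measurable f)
    {C : ℝ} (h : ∀ x, |f x| ≤ C * min 1 (x ^ 2)) : Integrable f ν :=
  (hν.integrable.const_mul C).mono' hf.aestronglyMeasurable (ae_of_all _ h)

/-- The truncated moments of a measure with tails of order `r ^ (-β)`. -/
lemma lintegral_min_abs_rpow_le {C β p ε : ℝ} (hC : 0 ≤ C) (hβp : β < p) (hp : 0 < p)
    (hε : 0 < ε) (hε1 : ε ≤ 1)
    (hC' : ∀ r, 0 < r → r ≤ 1 → ν {x | r < |x|} ≤ ENNReal.ofReal (C * r ^ (-β))) :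
    ∫⁻ x, ENNReal.ofReal (min |x| ε ^ p) ∂ν
      ≤ ENNReal.ofReal (C * p / (p - β) * ε ^ (p - β)) := by
  have h0 : ∀ u, 0 ≤ u → ∫ t in (0 : ℝ)..u, p * t ^ (p - 1) = u ^ p := fun u hu => by
    rw [intervalIntegral.integral_const_mul, integral_rpow (Or.inl (by linarith))]
    rw [sub_add_cancel, Real.zero_rpow hp.ne']
    field_simp
    ring
  have h := lintegral_comp_eq_lintegral_meas_lt_mul (f := fun x : ℝ => min |x| ε)
    (g := fun t => p * t ^ (p - 1)) ν
    (ae_of_all _ fun x => le_min (abs_nonneg x) hε.le) (by fun_prop)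
    (fun t _ => (intervalIntegral.intervalIntegrable_rpow' (by linarith)).const_mul _)
    (by
      filter_upwards [ae_restrict_mem measurableSet_Ioi] with t ht
      have : 0 < t := ht
      positivity)
  have h1 : ∀ x : ℝ, ∫ t in (0 : ℝ)..min |x| ε, p * t ^ (p - 1) = min |x| ε ^ p :=
    fun x => h0 _ (le_min (abs_nonneg x) hε.le)
  simp only [h1] at h
  rw [h]
  -- Levels above `ε` contribute nothing, so the tail bound is only used for `t ≤ ε ≤ 1`, and `p >
  -- β` makes the remaining power integrable at `0`.
  have h2 : ∫⁻ t in Set.Ioi (0 : ℝ), ν {x | t < min |x| ε} * ENNReal.ofReal (p * t ^ (p - 1))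
      ≤ ∫⁻ t in Set.Ioi (0 : ℝ), (Set.Ioc 0 ε).indicator
        (fun t => ENNReal.ofReal (C * p * t ^ (p - β - 1))) t := by
    refine setLIntegral_mono' measurableSet_Ioi fun t ht => ?_
    have ht0 : 0 < t := ht
    by_cases hte : t ≤ ε
    · rw [Set.indicator_of_mem (show t ∈ Set.Ioc 0 ε from ⟨ht0, hte⟩)]
      have h3 : ν {x | t < min |x| ε} ≤ ENNReal.ofReal (C * t ^ (-β)) :=
        (measure_mono fun x (hx : t < min |x| ε) => (lt_min_iff.1 hx).1).trans
          (hC' t ht0 (hte.trans hε1))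
      refine (mul_le_mul_left h3 _).trans_eq ?_
      rw [← ENNReal.ofReal_mul (by positivity)]
      congr 1
      rw [show p - β - 1 = -β + (p - 1) by ring, Real.rpow_add ht0]
      ring
    · have : {x : ℝ | t < min |x| ε} = ∅ := by
        ext x
        simp only [Set.mem_ofPred_eq, lt_min_iff, Set.mem_empty_iff_false, iff_false, not_and]
        intro _
        linarith
      rw [this]
      simp
  refine h2.trans_eq ?_
  rw [lintegral_indicator measurableSet_Ioc, Measure.restrict_restrict measurableSet_Ioc,
    Set.inter_eq_left.2 Set.Ioc_subset_Ioi_self, ← ofReal_integral_eq_lintegral_ofReal,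
    ← intervalIntegral.integral_of_le hε.le, intervalIntegral.integral_const_mul,
    integral_rpow (Or.inl (by linarith))]
  · congr 1
    rw [sub_add_cancel, Real.zero_rpow (by linarith)]
    have : p - β ≠ 0 := by linarith
    field_simp
    ring
  · exact ((intervalIntegrable_iff_integrableOn_Ioc_of_le hε.le).1
      (intervalIntegral.intervalIntegrable_rpow' (by linarith))).const_mul _
  · filter_upwards [ae_restrict_mem measurableSet_Ioc] with t ht
    have : 0 < t := ht.1
    simp only [Pi.zero_apply]
    positivity

/-- Layer cake again: levels up to `ε` contribute at most `ε · Cε^{-β}`, and those above it at most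
`∫_ε^∞ C t^{-β} dt`. These are the two summands of the constant. -/
lemma lintegral_abs_Ioc_le {C β ε : ℝ} (hC : 0 ≤ C) (hβ : 1 < β)
    (hε : 0 < ε) (hε1 : ε ≤ 1)
    (hC' : ∀ r, 0 < r → r ≤ 1 → ν {x | r < |x|} ≤ ENNReal.ofReal (C * r ^ (-β))) :
    ∫⁻ x in {x : ℝ | ε < |x| ∧ |x| ≤ 1}, ENNReal.ofReal |x| ∂ν
      ≤ ENNReal.ofReal ((C + C / (β - 1)) * ε ^ (1 - β)) := by
  have hβ1 : 0 < β - 1 := by linarith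
  set μ := ν.restrict {x : ℝ | ε < |x| ∧ |x| ≤ 1} with hμ
  have hms : MeasurableSet {x : ℝ | ε < |x| ∧ |x| ≤ 1} :=
    (measurableSet_abs_gt ε).inter (measurableSet_le measurable_id.abs measurable_const)
  have h := lintegral_comp_eq_lintegral_meas_lt_mul (f := fun x : ℝ => |x|)
    (g := fun _ => 1) μ (ae_of_all _ fun x => abs_nonneg x) (by fun_prop)
    (fun t _ => intervalIntegrable_const) (ae_of_all _ fun _ => zero_le_one)
  simp only [intervalIntegral.integral_const, smul_eq_mul, mul_one, sub_zero,
    ENNReal.ofReal_one] at h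
  rw [h, ← Set.Ioc_union_Ioi_eq_Ioi hε.le, lintegral_union measurableSet_Ioi
    (Set.Ioc_disjoint_Ioi le_rfl)]
  have hle : ∀ r, 0 < r → r ≤ 1 → ∀ t, r ≤ max t ε →
      μ {x | t < |x|} ≤ ENNReal.ofReal (C * r ^ (-β)) := by
    intro r hr hr1 t hrt
    rw [hμ, Measure.restrict_apply (measurableSet_abs_gt t)]
    refine (measure_mono fun x hx => ?_).trans (hC' r hr hr1)
    exact lt_of_le_of_lt hrt (max_lt hx.1 hx.2.1)
  have a1 : ∫⁻ t in Set.Ioc 0 ε, μ {x | t < |x|} ≤ ENNReal.ofReal (C * ε ^ (1 - β)) := by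
    refine (setLIntegral_mono' measurableSet_Ioc fun t _ => hle ε hε hε1 t (le_max_right _ _)).trans
      ?_
    rw [setLIntegral_const, Real.volume_Ioc, ← ENNReal.ofReal_mul (by positivity), sub_zero,
      show 1 - β = -β + 1 by ring, Real.rpow_add hε, Real.rpow_one, mul_assoc]
  have a2 : ∫⁻ t in Set.Ioi ε, μ {x | t < |x|}
      ≤ ENNReal.ofReal (C / (β - 1) * ε ^ (1 - β)) := by
    have : ∫⁻ t in Set.Ioi ε, μ {x | t < |x|} ≤ ∫⁻ t in Set.Ioi ε, ENNReal.ofReal (C * t ^ (-β)) := by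
      refine setLIntegral_mono' measurableSet_Ioi fun t ht => ?_
      have ht0 : 0 < t := hε.trans ht
      by_cases ht1 : t ≤ 1
      · exact hle t ht0 ht1 t (le_max_left _ _)
      · rw [hμ, Measure.restrict_apply (measurableSet_abs_gt t)]
        have : {x : ℝ | t < |x|} ∩ {x : ℝ | ε < |x| ∧ |x| ≤ 1} = ∅ := by
          ext x
          simp only [Set.mem_inter_iff, Set.mem_ofPred_eq, Set.mem_empty_iff_false, iff_false]
          intro hx
          linarith [hx.2.2, hx.1]
        rw [this]
        simp
    refine this.trans_eq ?_
    rw [← ofReal_integral_eq_lintegral_ofReal, integral_const_mul,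
      integral_Ioi_rpow_of_lt (by linarith) hε]
    · congr 1
      rw [show -β + 1 = 1 - β by ring, show (1 - β) = -(β - 1) by ring]
      field_simp
    · exact (integrableOn_Ioi_rpow_of_lt (by linarith) hε).const_mul _
    · filter_upwards [ae_restrict_mem measurableSet_Ioi] with t ht
      have : 0 < t := hε.trans ht
      simp only [Pi.zero_apply]
      positivity
  refine (add_le_add a1 a2).trans_eq ?_
  rw [← ENNReal.ofReal_add (by positivity) (by positivity)]
  congr 1
  ring

/-- The layer cake formula needs a nonnegative density, while `sin` changes sign. It is therefore
applied to `t` and to `t + sin t ≥ 0`, and the results are subtracted; the cutoff at `R` makes the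
quadratic primitive integrable. -/
lemma integral_one_sub_cos_truncated (hν : IsLevyMeasure ν) {z R : ℝ} (hz : 0 < z) :
    ∫ x in {x : ℝ | z * |x| ≤ R}, (1 - Real.cos (z * x)) ∂ν
      = ∫ v in Set.Ioi (0 : ℝ), ν.real {x | v < z * |x| ∧ z * |x| ≤ R} * Real.sin v := by
  set μ := ν.restrict {x : ℝ | z * |x| ≤ R} with hμ
  have hms : MeasurableSet {x : ℝ | z * |x| ≤ R} :=
    measurableSet_le (by fun_prop) measurable_const
  have hfin : ∀ t, 0 < t → μ {x | t < z * |x|} ≠ ∞ := by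
    intro t ht
    refine (lt_of_le_of_lt ((Measure.restrict_apply_le _ _).trans (measure_mono fun x hx => ?_))
      (hν.measure_abs_gt_ne_top (div_pos ht hz)).lt_top).ne
    have hx : t < z * |x| := hx
    simp only [Set.mem_ofPred_eq]
    rwa [div_lt_iff₀' hz]
  have hsq : IntegrableOn (fun x : ℝ => (z * |x|) ^ 2 / 2) {x : ℝ | z * |x| ≤ R} ν := by
    refine ((hν.integrable.const_mul (z ^ 2 + R ^ 2)).integrableOn).mono' (by fun_prop) ?_
    filter_upwards [ae_restrict_mem hms] with x hx
    have hx : z * |x| ≤ R := hx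
    have h1 : 0 ≤ z * |x| := by positivity
    rw [Real.norm_eq_abs, abs_of_nonneg (by positivity)]
    rcases le_total 1 (x ^ 2) with h | h
    · rw [min_eq_left h]
      nlinarith [sq_nonneg z]
    · rw [min_eq_right h, mul_pow, sq_abs]
      nlinarith [sq_nonneg z, sq_nonneg R, sq_nonneg x, mul_nonneg (sq_nonneg R) (sq_nonneg x),
        mul_nonneg (sq_nonneg z) (sq_nonneg x)]
  have hcos : IntegrableOn (fun x : ℝ => 1 - Real.cos (z * |x|)) {x : ℝ | z * |x| ≤ R} ν := by
    refine (hν.integrable_of_le (C := 2 + 3 * z ^ 2) (by fun_prop) fun x => ?_).integrableOn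
    have := (Complex.abs_re_le_norm _).trans (norm_levyKernel_le z |x|)
    rwa [levyKernel_re, abs_sub_comm, sq_abs] at this
  have i1 : ∀ u : ℝ, ∫ t in (0 : ℝ)..u, t = u ^ 2 / 2 := fun u => by rw [integral_id]; ring
  have i2 : ∀ u : ℝ, ∫ t in (0 : ℝ)..u, (t + Real.sin t) = u ^ 2 / 2 + (1 - Real.cos u) :=
    fun u => by
      rw [intervalIntegral.integral_add (f := fun t => t) (continuous_id.intervalIntegrable _ _)
        (Real.continuous_sin.intervalIntegrable _ _), integral_id, integral_sin]
      simp
  obtain ⟨a1, b1⟩ := integral_comp_eq_integral_measureReal_lt_mul (μ := μ)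
    (f := fun x : ℝ => z * |x|) (g := fun t => t) (by fun_prop) (fun x => by positivity)
    continuous_id (fun t ht => ht.le) (by simp only [i1]; exact hsq) hfin
  obtain ⟨a2, b2⟩ := integral_comp_eq_integral_measureReal_lt_mul (μ := μ)
    (f := fun x : ℝ => z * |x|) (g := fun t => t + Real.sin t) (by fun_prop)
    (fun x => by positivity) (by fun_prop)
    (fun t ht => by linarith [(abs_le.1 ((Real.abs_sin_le_abs (x := t)))).1, abs_of_pos ht])
    (by simp only [i2]; exact hsq.add hcos) hfin
  simp only [i1, i2] at b1 b2
  rw [integral_add hsq hcos, b1] at b2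
  have e1 : ∀ x : ℝ, Real.cos (z * |x|) = Real.cos (z * x) := fun x => by
    rcases abs_cases x with ⟨h, _⟩ | ⟨h, _⟩ <;> simp [h]
  have e2 : ∀ v : ℝ, μ.real {x | v < z * |x|} = ν.real {x | v < z * |x| ∧ z * |x| ≤ R} := fun v => by
    rw [hμ, measureReal_restrict_apply (measurableSet_lt measurable_const (by fun_prop))]
    rfl
  simp only [e1, e2] at b2 a1 a2
  have b3 := integral_sub a2 a1
  simp only [← mul_sub, add_sub_cancel_left] at b3
  rw [b3]
  linarith

/-- Integration by parts with primitive `(1 - cos v)(v^{-β} - R^{-β})`. It vanishes at `R` because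
of the subtracted constant, and at `0` because it is `O(v^{2-β})`. -/
lemma integral_sin_mul_rpow_sub {β R : ℝ} (h0 : 0 < β) (h2 : β < 2) (hR : 0 < R) :
    ∫ v in Set.Ioc 0 R, (v ^ (-β) - R ^ (-β)) * Real.sin v
      = β * ∫ u in Set.Ioc 0 R, (1 - Real.cos u) * u ^ (-1 - β) := by
  have hi : IntegrableOn (fun v : ℝ => v ^ (1 - β)) (Set.Ioc 0 R) :=
    (intervalIntegrable_iff_integrableOn_Ioc_of_le hR.le).1
      (intervalIntegral.intervalIntegrable_rpow' (by linarith))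
  have j1 : IntegrableOn (fun v : ℝ => (v ^ (-β) - R ^ (-β)) * Real.sin v) (Set.Ioc 0 R) := by
    refine Integrable.mono' hi (by fun_prop) ?_
    filter_upwards [ae_restrict_mem measurableSet_Ioc] with v hv
    have hv0 : 0 < v := hv.1
    have h3 : R ^ (-β) ≤ v ^ (-β) := Real.rpow_le_rpow_of_nonpos hv0 hv.2 (by linarith)
    have h4 : 0 < R ^ (-β) := by positivity
    have h5 := Real.abs_sin_le_abs (x := v)
    rw [abs_of_pos hv0] at h5
    rw [norm_mul, Real.norm_eq_abs, Real.norm_eq_abs, abs_of_nonneg (by linarith),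
      show 1 - β = -β + 1 by ring, Real.rpow_add hv0, Real.rpow_one]
    exact mul_le_mul (by linarith) h5 (abs_nonneg _) (by positivity)
  have j2 : IntegrableOn (fun v : ℝ => (1 - Real.cos v) * v ^ (-1 - β)) (Set.Ioc 0 R) := by
    refine Integrable.mono' hi (by fun_prop) ?_
    filter_upwards [ae_restrict_mem measurableSet_Ioc] with v hv
    have hv0 : 0 < v := hv.1
    have h4 := Real.one_sub_sq_div_two_le_cos (x := v)
    have h5 := Real.cos_le_one v
    rw [norm_mul, Real.norm_eq_abs, Real.norm_eq_abs, abs_of_nonneg (by linarith),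
      abs_of_nonneg (by positivity), show 1 - β = 2 + (-1 - β) by ring, Real.rpow_add hv0,
      Real.rpow_ofNat]
    gcongr
    nlinarith
  have hd : ∀ v ∈ Set.Ioo 0 R, HasDerivAt (fun v : ℝ => (1 - Real.cos v) * (v ^ (-β) - R ^ (-β)))
      ((v ^ (-β) - R ^ (-β)) * Real.sin v - β * ((1 - Real.cos v) * v ^ (-1 - β))) v := by
    intro v hv
    have d1 := ((Real.hasDerivAt_cos v).const_sub 1).mul
      ((Real.hasDerivAt_rpow_const (p := -β) (Or.inl hv.1.ne')).sub_const (R ^ (-β)))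
    refine d1.congr_deriv ?_
    rw [show -β - 1 = -1 - β by ring]
    ring
  have t0 : Tendsto (fun v : ℝ => (1 - Real.cos v) * (v ^ (-β) - R ^ (-β))) (𝓝[>] 0) (𝓝 0) := by
    have t1 : Tendsto (fun v : ℝ => v ^ (2 - β)) (𝓝[>] 0) (𝓝 0) := by
      have := (Real.continuousAt_rpow_const 0 (2 - β) (Or.inr (by linarith))).tendsto
      rw [Real.zero_rpow (by linarith)] at this
      exact this.mono_left nhdsWithin_le_nhds
    refine squeeze_zero_norm' ?_ t1
    filter_upwards [Ioc_mem_nhdsGT hR] with v hv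
    have hv0 : 0 < v := hv.1
    have h3 : R ^ (-β) ≤ v ^ (-β) := Real.rpow_le_rpow_of_nonpos hv0 hv.2 (by linarith)
    have h6 : 0 < R ^ (-β) := by positivity
    have h4 := Real.one_sub_sq_div_two_le_cos (x := v)
    have h5 := Real.cos_le_one v
    rw [norm_mul, Real.norm_eq_abs, Real.norm_eq_abs, abs_of_nonneg (by linarith),
      abs_of_nonneg (by linarith), show 2 - β = 2 + -β by ring, Real.rpow_add hv0,
      Real.rpow_ofNat]
    exact mul_le_mul (by nlinarith) (by linarith) (by linarith) (by positivity)
  have tR : Tendsto (fun v : ℝ => (1 - Real.cos v) * (v ^ (-β) - R ^ (-β))) (𝓝[<] R) (𝓝 0) := by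
    have : ContinuousAt (fun v : ℝ => (1 - Real.cos v) * (v ^ (-β) - R ^ (-β))) R :=
      (by fun_prop : ContinuousAt (fun v : ℝ => 1 - Real.cos v) R).mul
        ((Real.continuousAt_rpow_const R (-β) (Or.inl hR.ne')).sub continuousAt_const)
    have h := this.tendsto
    simp only [sub_self, mul_zero] at h
    exact h.mono_left nhdsWithin_le_nhds
  have h := intervalIntegral.integral_eq_sub_of_hasDerivAt_of_tendsto hR hd
    ((intervalIntegrable_iff_integrableOn_Ioc_of_le hR.le).2 (j1.sub (j2.const_mul β))) t0 tR
  rw [intervalIntegral.integral_of_le hR.le, integral_sub j1 (j2.const_mul β),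
    integral_const_mul] at h
  linarith

end

/-- The constant `∫_0^∞ (1 - cos u) u^{-1-β} du`. -/
def stableConst (β : ℝ) : ℝ :=
  Real.pi / (2 * Real.sin (Real.pi * β / 2)) / Real.Gamma (1 + β)

lemma sin_pi_mul_half_pos {β : ℝ} (h0 : 0 < β) (h2 : β < 2) : 0 < Real.sin (Real.pi * β / 2) :=
  Real.sin_pos_of_pos_of_lt_pi (by positivity) (by nlinarith [Real.pi_pos])

lemma one_sub_cos_mul_rpow_nonneg {u : ℝ} (hu : 0 < u) (p : ℝ) : 0 ≤ (1 - Real.cos u) * u ^ p :=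
  mul_nonneg (sub_nonneg.2 (Real.cos_le_one u)) (by positivity)

lemma integral_Ioi_one_sub_cos_mul_rpow {β : ℝ} (h0 : 0 < β) (h2 : β < 2) :
    IntegrableOn (fun u : ℝ => (1 - Real.cos u) * u ^ (-1 - β)) (Set.Ioi 0) ∧
      ∫ u in Set.Ioi (0 : ℝ), (1 - Real.cos u) * u ^ (-1 - β) = stableConst β := by
  have h := lintegral_Ioi_one_sub_cos_mul_rpow h0 h2
  have hnn : 0 ≤ᵐ[volume.restrict (Set.Ioi (0 : ℝ))] fun u : ℝ => (1 - Real.cos u) * u ^ (-1 - β) := by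
    filter_upwards [ae_restrict_mem measurableSet_Ioi] with u hu
    exact one_sub_cos_mul_rpow_nonneg hu _
  have hm : AEStronglyMeasurable (fun u : ℝ => (1 - Real.cos u) * u ^ (-1 - β))
    (volume.restrict (Set.Ioi (0 : ℝ))) := by fun_prop
  have hs := sin_pi_mul_half_pos h0 h2
  have hG : 0 < Real.Gamma (1 + β) := Real.Gamma_pos_of_pos (by linarith)
  refine ⟨?_, ?_⟩
  · refine (lintegral_ofReal_ne_top_iff_integrable hm hnn).1 ?_
    rw [h]
    exact ENNReal.ofReal_ne_top
  · rw [integral_eq_lintegral_of_nonneg_ae hnn hm, h, ENNReal.toReal_ofReal (by positivity)]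
    rfl

/-! ### From the tails of the Lévy measure to the real part of the exponent. -/

section

variable {ν : Measure ℝ} {β K γ : ℝ}

/-- Near `0` the limit gives the bound; between `r₀` and `1` the tail is at most its value at `r₀`,
and `r^{-β} ≥ 1`. -/
lemma IsLevyMeasure.tail_le (hν : IsLevyMeasure ν) (hβ : 0 < β)
    (hN : Tendsto (fun r : ℝ => r ^ β * ν.real {x | r < |x|}) (𝓝[>] 0) (𝓝 K)) :
    ∃ C, 0 ≤ C ∧ ∀ r, 0 < r → r ≤ 1 → ν.real {x | r < |x|} ≤ C * r ^ (-β) := by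
  have h1 : ∀ᶠ r in 𝓝[>] (0 : ℝ), r ^ β * ν.real {x | r < |x|} < |K| + 1 :=
    hN.eventually_lt_const (by linarith [le_abs_self K])
  obtain ⟨r₀, hr₀, h⟩ := mem_nhdsGT_iff_exists_Ioc_subset.1 h1
  have hr₀ : 0 < r₀ := hr₀
  refine ⟨|K| + 1 + ν.real {x | r₀ < |x|}, by positivity, fun r hr hr1 => ?_⟩
  have h0 : 0 ≤ ν.real {x | r₀ < |x|} := measureReal_nonneg
  rcases le_or_gt r r₀ with hle | hlt
  · have : r ^ β * ν.real {x | r < |x|} < |K| + 1 := h ⟨hr, hle⟩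
    have hp : 0 < r ^ β := by positivity
    rw [Real.rpow_neg hr.le, ← div_eq_mul_inv, le_div_iff₀ hp, mul_comm]
    linarith
  · have h3 : ν.real {x | r < |x|} ≤ ν.real {x | r₀ < |x|} :=
      measureReal_mono (fun x (hx : r < |x|) => hlt.trans hx) (hν.measure_abs_gt_ne_top hr₀)
    have h4 : 1 ≤ r ^ (-β) := Real.one_le_rpow_of_pos_of_le_one_of_nonpos hr hr1 (by linarith)
    have h5 := abs_nonneg K
    nlinarith

lemma tendsto_tail_scaled
    (hN : Tendsto (fun r : ℝ => r ^ β * ν.real {x | r < |x|}) (𝓝[>] 0) (𝓝 K)) {v : ℝ}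
    (hv : 0 < v) :
    Tendsto (fun z : ℝ => ν.real {x | v / z < |x|} / z ^ β) atTop (𝓝 (K * v ^ (-β))) := by
  have h1 : Tendsto (fun z : ℝ => v / z) atTop (𝓝[>] 0) := by
    refine tendsto_nhdsWithin_iff.2 ⟨tendsto_const_nhds.div_atTop tendsto_id, ?_⟩
    filter_upwards [eventually_gt_atTop 0] with z hz using div_pos hv hz
  refine ((hN.comp h1).mul_const (v ^ (-β))).congr' ?_
  filter_upwards [eventually_gt_atTop 0] with z hz
  simp only [Function.comp_apply]
  rw [Real.div_rpow hv.le hz.le, Real.rpow_neg hv.le]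
  have : 0 < v ^ β := by positivity
  field_simp

lemma IsLevyMeasure.integrable_one_sub_cos (hν : IsLevyMeasure ν) (z : ℝ) :
    Integrable (fun x => 1 - Real.cos (z * x)) ν := by
  refine hν.integrable_of_le (C := 2 + 3 * z ^ 2) (by fun_prop) fun x => ?_
  have := (Complex.abs_re_le_norm _).trans (norm_levyKernel_le z x)
  rwa [levyKernel_re, abs_sub_comm] at this

/-- The truncated integral is an integral of `sin v` against the difference of the tails at `v/z`
and `R/z`. Divided by `z^β`, that difference tends to `K (v^{-β} - R^{-β})`; since `|sin v| ≤ v`,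
the integrand is dominated by `C v^{1-β}`, which is integrable at `0` because `β < 2`. -/
lemma IsLevyMeasure.tendsto_one_sub_cos_truncated (hν : IsLevyMeasure ν) (h0 : 0 < β)
    (h2 : β < 2)
    (hN : Tendsto (fun r : ℝ => r ^ β * ν.real {x | r < |x|}) (𝓝[>] 0) (𝓝 K)) {R : ℝ}
    (hR : 0 < R) :
    Tendsto (fun z : ℝ => (∫ x in {x : ℝ | z * |x| ≤ R}, (1 - Real.cos (z * x)) ∂ν) / z ^ β)
      atTop (𝓝 (K * (β * ∫ u in Set.Ioc 0 R, (1 - Real.cos u) * u ^ (-1 - β)))) := by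
  obtain ⟨C, hC0, hC⟩ := hν.tail_le h0 hN
  have hlim : Tendsto (fun z : ℝ => ∫ v in Set.Ioc 0 R,
      (ν.real {x | v / z < |x|} / z ^ β - ν.real {x | R / z < |x|} / z ^ β) * Real.sin v) atTop
      (𝓝 (∫ v in Set.Ioc 0 R, (K * v ^ (-β) - K * R ^ (-β)) * Real.sin v)) := by
    refine tendsto_integral_filter_of_dominated_convergence (fun v => C * v ^ (1 - β)) ?_ ?_ ?_ ?_
    · filter_upwards [eventually_gt_atTop 0] with z hz
      have hm : Measurable fun v : ℝ => ν {x | v / z < |x|} := by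
        refine Antitone.measurable fun s t hst => measure_mono fun x hx => ?_
        have hx : t / z < |x| := hx
        exact lt_of_le_of_lt (by gcongr) hx
      have hm' : Measurable fun v : ℝ => ν.real {x | v / z < |x|} := hm.ennreal_toReal
      fun_prop
    · filter_upwards [eventually_ge_atTop R, eventually_gt_atTop 0] with z hz hz0
      filter_upwards [ae_restrict_mem measurableSet_Ioc] with v hv
      have hv0 : 0 < v := hv.1
      have hz' : 0 < z ^ β := by positivity
      have h3 := hC (v / z) (by positivity) ((div_le_one hz0).2 (hv.2.trans hz))
      have h4 : ν.real {x | R / z < |x|} ≤ ν.real {x | v / z < |x|} := by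
        refine measureReal_mono (fun x (hx : R / z < |x|) => ?_)
          (hν.measure_abs_gt_ne_top (div_pos hv0 hz0))
        exact lt_of_le_of_lt (div_le_div_of_nonneg_right hv.2 hz0.le) hx
      have h5 : 0 ≤ ν.real {x | R / z < |x|} := measureReal_nonneg
      have h6 := Real.abs_sin_le_abs (x := v)
      rw [abs_of_pos hv0] at h6
      rw [← sub_div, norm_mul, norm_div, Real.norm_eq_abs, Real.norm_eq_abs, Real.norm_eq_abs,
        abs_of_pos hz', abs_of_nonneg (sub_nonneg.2 h4)]
      have h7 : (ν.real {x | v / z < |x|} - ν.real {x | R / z < |x|}) / z ^ β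
          ≤ C * v ^ (-β) := by
        rw [div_le_iff₀ hz']
        calc _ ≤ C * (v / z) ^ (-β) := by linarith
          _ = _ := by
            rw [Real.div_rpow hv0.le hz0.le, Real.rpow_neg hz0.le]
            field_simp
      calc _ ≤ (C * v ^ (-β)) * v := mul_le_mul h7 h6 (abs_nonneg _) (by positivity)
        _ = _ := by rw [show 1 - β = -β + 1 by ring, Real.rpow_add hv0, Real.rpow_one]; ring
    · exact ((intervalIntegrable_iff_integrableOn_Ioc_of_le hR.le).1
        (intervalIntegral.intervalIntegrable_rpow' (by linarith))).const_mul _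
    · filter_upwards [ae_restrict_mem measurableSet_Ioc] with v hv
      exact ((tendsto_tail_scaled hN hv.1).sub (tendsto_tail_scaled hN hR)).mul_const _
  have e1 : ∫ v in Set.Ioc 0 R, (K * v ^ (-β) - K * R ^ (-β)) * Real.sin v
      = K * (β * ∫ u in Set.Ioc 0 R, (1 - Real.cos u) * u ^ (-1 - β)) := by
    rw [← integral_sin_mul_rpow_sub h0 h2 hR, ← integral_const_mul]
    congr 1
    ext v
    ring
  rw [← e1]
  refine hlim.congr' ?_
  filter_upwards [eventually_gt_atTop 0] with z hz
  rw [integral_one_sub_cos_truncated hν hz, ← integral_div, ← Set.Ioc_union_Ioi_eq_Ioi hR.le]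
  rw [← integral_indicator measurableSet_Ioc,
    ← integral_indicator (measurableSet_Ioc.union measurableSet_Ioi)]
  congr 1
  ext v
  by_cases hv : v ∈ Set.Ioc 0 R
  · rw [Set.indicator_of_mem hv, Set.indicator_of_mem (Set.mem_union_left _ hv)]
    have : {x : ℝ | v < z * |x| ∧ z * |x| ≤ R} = {x | v / z < |x|} \ {x | R / z < |x|} := by
      ext x
      simp only [Set.mem_ofPred_eq, Set.mem_sdiff, not_lt, div_lt_iff₀' hz]
    rw [this, measureReal_sdiff _ (measurableSet_abs_gt _)
      (h₁ := hν.measure_abs_gt_ne_top (div_pos hv.1 hz))]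
    · ring
    · exact fun x (hx : R / z < |x|) => lt_of_le_of_lt (div_le_div_of_nonneg_right hv.2 hz.le) hx
  · rw [Set.indicator_of_notMem hv]
    by_cases hv2 : v ∈ Set.Ioi R
    · rw [Set.indicator_of_mem (Set.mem_union_right _ hv2)]
      have : {x : ℝ | v < z * |x| ∧ z * |x| ≤ R} = ∅ := by
        ext x
        simp only [Set.mem_ofPred_eq, Set.mem_empty_iff_false, iff_false, not_and, not_le]
        exact fun h => lt_trans hv2 h
      rw [this]
      simp
    · rw [Set.indicator_of_notMem]
      rintro (h | h)
      · exact hv h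
      · exact hv2 h

/-- The cutoff can be removed because the jumps with `z|x| > R` contribute `O(R^{-β})` uniformly in
large `z`. -/
lemma IsLevyMeasure.tendsto_one_sub_cos (hν : IsLevyMeasure ν) (h0 : 0 < β) (h2 : β < 2)
    (hN : Tendsto (fun r : ℝ => r ^ β * ν.real {x | r < |x|}) (𝓝[>] 0) (𝓝 K)) :
    Tendsto (fun z : ℝ => (∫ x, (1 - Real.cos (z * x)) ∂ν) / z ^ β) atTop
      (𝓝 (K * (β * stableConst β))) := by
  obtain ⟨C, hC0, hC⟩ := hν.tail_le h0 hN
  obtain ⟨iD, eD⟩ := integral_Ioi_one_sub_cos_mul_rpow h0 h2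
  rw [Metric.tendsto_atTop']
  intro ε hε
  -- `2C` accounts for the discarded jumps and `2|K|` for the part of the limiting integral beyond
  -- `R`.
  have hRlim : Tendsto (fun R : ℝ => (2 * C + 2 * |K|) * R ^ (-β)) atTop (𝓝 0) := by
    simpa using (tendsto_rpow_neg_atTop h0).const_mul (2 * C + 2 * |K|)
  obtain ⟨R, hRε, hR⟩ := ((hRlim.eventually_lt_const (half_pos hε)).and
    (eventually_gt_atTop 0)).exists
  obtain ⟨z₀, hz₀⟩ := Metric.tendsto_atTop'.1
    (hν.tendsto_one_sub_cos_truncated h0 h2 hN hR) (ε / 2) (half_pos hε)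
  refine ⟨max z₀ R, fun z hz => ?_⟩
  have hzR : R < z := lt_of_le_of_lt (le_max_right _ _) hz
  have hz0 : 0 < z := hR.trans hzR
  have hzβ : 0 < z ^ β := by positivity
  have h1 := hz₀ z (lt_of_le_of_lt (le_max_left _ _) hz)
  have hi := hν.integrable_one_sub_cos z
  have hms : MeasurableSet {x : ℝ | z * |x| ≤ R} :=
    measurableSet_le (by fun_prop) measurable_const
  have h3 : |(∫ x, (1 - Real.cos (z * x)) ∂ν) / z ^ β
      - (∫ x in {x : ℝ | z * |x| ≤ R}, (1 - Real.cos (z * x)) ∂ν) / z ^ β|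
      ≤ 2 * C * R ^ (-β) := by
    rw [← sub_div, ← integral_add_compl hms hi, add_sub_cancel_left, abs_div, abs_of_pos hzβ,
      div_le_iff₀ hzβ]
    have ec : {x : ℝ | z * |x| ≤ R}ᶜ = {x | R / z < |x|} := by
      ext x
      simp only [Set.mem_compl_iff, Set.mem_ofPred_eq, not_le, div_lt_iff₀' hz0]
    rw [ec]
    have h4 := norm_setIntegral_le_of_norm_le_const (μ := ν) (s := {x | R / z < |x|})
      (f := fun x => 1 - Real.cos (z * x)) (C := 2)
      (hν.measure_abs_gt_ne_top (div_pos hR hz0)).lt_top (fun x _ => by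
        rw [Real.norm_eq_abs, abs_le]
        constructor <;> linarith [Real.neg_one_le_cos (z * x), Real.cos_le_one (z * x)])
    have h5 := hC (R / z) (div_pos hR hz0) ((div_le_one hz0).2 hzR.le)
    rw [Real.div_rpow hR.le hz0.le, Real.rpow_neg hz0.le] at h5
    refine h4.trans ?_
    calc 2 * ν.real {x | R / z < |x|} ≤ 2 * (C * (R ^ (-β) / (z ^ β)⁻¹)) := by gcongr
      _ = _ := by field_simp
  have h6 : |K * (β * ∫ u in Set.Ioc 0 R, (1 - Real.cos u) * u ^ (-1 - β))
      - K * (β * stableConst β)| ≤ 2 * |K| * R ^ (-β) := by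
    rw [← eD, ← Set.Ioc_union_Ioi_eq_Ioi hR.le, setIntegral_union (Set.Ioc_disjoint_Ioi le_rfl)
      measurableSet_Ioi (iD.mono_set Set.Ioc_subset_Ioi_self)
      (iD.mono_set (Set.Ioi_subset_Ioi hR.le)), ← mul_sub, ← mul_sub, sub_add_cancel_left,
      abs_mul, abs_mul, abs_neg, abs_of_pos h0, mul_comm 2, mul_assoc |K|]
    refine mul_le_mul_of_nonneg_left ?_ (abs_nonneg _)
    have h7 : ∫ u in Set.Ioi R, (2 : ℝ) * u ^ (-1 - β) = 2 * (R ^ (-β) / β) := by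
      rw [integral_const_mul, integral_Ioi_rpow_of_lt (by linarith) hR,
        show -1 - β + 1 = -β by ring, neg_div_neg_eq]
    have h8 : |∫ u in Set.Ioi R, (1 - Real.cos u) * u ^ (-1 - β)| ≤ 2 * (R ^ (-β) / β) := by
      rw [← h7, ← Real.norm_eq_abs]
      refine norm_integral_le_of_norm_le
        ((integrableOn_Ioi_rpow_of_lt (by linarith) hR).const_mul 2) ?_
      filter_upwards [ae_restrict_mem measurableSet_Ioi] with u hu
      have hu0 : 0 < u := hR.trans hu
      rw [Real.norm_eq_abs, abs_of_nonneg (one_sub_cos_mul_rpow_nonneg hu0 _)]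
      gcongr
      linarith [Real.neg_one_le_cos u]
    calc β * |∫ u in Set.Ioi R, (1 - Real.cos u) * u ^ (-1 - β)| ≤ β * (2 * (R ^ (-β) / β)) := by
          gcongr
      _ = _ := by field_simp
  rw [Real.dist_eq] at h1 ⊢
  rw [abs_le] at h3 h6
  rw [abs_lt] at h1 ⊢
  constructor <;> linarith [h1.1, h1.2, h3.1, h3.2, h6.1, h6.2]

/-- A Lévy measure with regularly varying tails at `0` and no Gaussian part has an exponent which
is asymptotically stable, provided that the truncated means are controlled. -/
lemma IsLevyMeasure.isStableLike_of_tail (hν : IsLevyMeasure ν) (h0 : 0 < β) (h2 : β < 2)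
    (hN : Tendsto (fun r : ℝ => r ^ β * ν.real {x | r < |x|}) (𝓝[>] 0) (𝓝 K)) {c D : ℝ}
    (hM : ∀ ε, 0 < ε → ε ≤ 1 →
      |(∫ x in {x : ℝ | ε < |x| ∧ |x| ≤ 1}, x ∂ν) - c| ≤ D * ε ^ (1 - β)) :
    IsStableLike (levyExponent γ 0 ν) β (γ - c) (K * (β * stableConst β)) := by
  obtain ⟨C, hC0, hC⟩ := hν.tail_le h0 hN
  have hC' : ∀ r, 0 < r → r ≤ 1 → ν {x | r < |x|} ≤ ENNReal.ofReal (C * r ^ (-β)) := by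
    intro r hr hr1
    rw [ENNReal.le_ofReal_iff_toReal_le (hν.measure_abs_gt_ne_top hr) (by positivity)]
    exact hC r hr hr1
  refine IsStableLike.of_tendsto (C := 5 * (C * 2 / (2 - β)) + D) hν.continuous_levyExponent
    hν.levyExponent_neg h0 ?_ ?_
  · intro z hz
    have hz0 : 0 < z := by linarith
    -- Compensating at `|x| ≤ 1/z` instead of `|x| ≤ 1` turns the kernel into `levyKernel 1 (z *
    -- x)`, whose integral is a truncated second moment of order `z^β`. The price is a drift: the
    -- mean over `1/z < |x| ≤ 1`.
    set ε := z⁻¹ with hε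
    have hε0 : 0 < ε := inv_pos.2 hz0
    have hε1 : ε ≤ 1 := inv_le_one_of_one_le₀ hz
    have hms : MeasurableSet {x : ℝ | ε < |x| ∧ |x| ≤ 1} :=
      (measurableSet_abs_gt ε).inter (measurableSet_le measurable_id.abs measurable_const)
    have hint : IntegrableOn (fun x : ℝ => x) {x : ℝ | ε < |x| ∧ |x| ≤ 1} ν := by
      refine Measure.integrableOn_of_bounded (M := 1) ?_ (by fun_prop) ?_
      · exact ne_top_of_le_ne_top (hν.measure_abs_gt_ne_top hε0) (measure_mono fun x hx => hx.1)
      · filter_upwards [ae_restrict_mem hms] with x hx using hx.2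
    have e1 : ∀ x : ℝ, levyKernel z x = levyKernel 1 (z * x)
        - Complex.I * z * ((({x : ℝ | ε < |x| ∧ |x| ≤ 1}.indicator (fun x => x) x : ℝ)) : ℂ) := by
      intro x
      have a1 : |z| * |x| ≤ 1 ↔ |x| ≤ ε := by
        rw [abs_of_pos hz0, hε, ← one_div, le_div_iff₀' hz0]
      by_cases b1 : ε < |x|
      · by_cases b2 : |x| ≤ 1
        · rw [Set.indicator_of_mem (show x ∈ {x : ℝ | ε < |x| ∧ |x| ≤ 1} from ⟨b1, b2⟩)]
          simp [levyKernel, a1, b1.not_ge, b2, ← mul_assoc]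
        · rw [Set.indicator_of_notMem (fun h => b2 h.2)]
          simp [levyKernel, a1, b1.not_ge, b2, ← mul_assoc]
      · have b2 : |x| ≤ 1 := by linarith
        rw [Set.indicator_of_notMem (fun h => b1 h.1)]
        simp [levyKernel, a1, not_lt.1 b1, b2, ← mul_assoc]
    have i2 : Integrable (fun x : ℝ => Complex.I * z *
        ((({x : ℝ | ε < |x| ∧ |x| ≤ 1}.indicator (fun x => x) x : ℝ)) : ℂ)) ν :=
      ((integrable_indicator_iff hms).2 hint).ofReal.const_mul _
    have i1 : Integrable (fun x => levyKernel 1 (z * x)) ν := by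
      refine ((hν.integrable_levyKernel z).add i2).congr (ae_of_all _ fun x => ?_)
      simp only [Pi.add_apply, e1 x, sub_add_cancel]
    have e2 : ∫ x, levyKernel z x ∂ν = (∫ x, levyKernel 1 (z * x) ∂ν)
        - Complex.I * z * ((∫ x in {x : ℝ | ε < |x| ∧ |x| ≤ 1}, x ∂ν : ℝ) : ℂ) := by
      simp_rw [e1]
      rw [integral_sub i1 i2, integral_const_mul, integral_complex_ofReal,
        integral_indicator hms]
    have h3 : ‖∫ x, levyKernel 1 (z * x) ∂ν‖ ≤ 5 * (C * 2 / (2 - β)) * z ^ β := by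
      have h4 := lintegral_min_abs_rpow_le (p := 2) hC0 h2 two_pos hε0 hε1 hC'
      have h2β : 0 < 2 - β := by linarith
      have hnn : 0 ≤ᵐ[ν] fun x => min |x| ε ^ (2 : ℝ) :=
        ae_of_all _ fun x => by simp only [Pi.zero_apply]; positivity
      have hmm : AEStronglyMeasurable (fun x : ℝ => min |x| ε ^ (2 : ℝ)) ν := by
        have : Measurable fun x : ℝ => min |x| ε := measurable_id.abs.min measurable_const
        exact (this.pow_const 2).aestronglyMeasurable
      have i3 : Integrable (fun x => min |x| ε ^ (2 : ℝ)) ν :=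
        (lintegral_ofReal_ne_top_iff_integrable hmm hnn).1
          (ne_top_of_le_ne_top ENNReal.ofReal_ne_top h4)
      have h5 : ∫ x, min |x| ε ^ (2 : ℝ) ∂ν ≤ C * 2 / (2 - β) * ε ^ (2 - β) := by
        rw [integral_eq_lintegral_of_nonneg_ae hnn hmm]
        exact ENNReal.toReal_le_of_le_ofReal (by positivity) h4
      have h6 : ‖∫ x, levyKernel 1 (z * x) ∂ν‖
          ≤ ∫ x, 5 * z ^ 2 * min |x| ε ^ (2 : ℝ) ∂ν := by
        refine norm_integral_le_of_norm_le (i3.const_mul _) (ae_of_all _ fun x => ?_)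
        refine (norm_levyKernel_le 1 (z * x)).trans_eq ?_
        have : min 1 ((z * x) ^ 2) = z ^ 2 * min |x| ε ^ 2 := by
          rw [← mul_pow, mul_min_of_nonneg _ _ hz0.le, hε, mul_inv_cancel₀ hz0.ne',
            ← sq_abs (z * x), abs_mul, abs_of_pos hz0]
          rcases le_total (z * |x|) 1 with h | h
          · rw [min_eq_left h, min_eq_right]
            have : 0 ≤ z * |x| := by positivity
            nlinarith
          · rw [min_eq_right h, min_eq_left]
            · norm_num
            · nlinarith
        rw [this, Real.rpow_ofNat]
        ring
      rw [integral_const_mul] at h6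
      have h7 : z ^ 2 * ε ^ (2 - β) = z ^ β := by
        rw [hε, Real.inv_rpow hz0.le, ← Real.rpow_neg hz0.le, ← Real.rpow_ofNat,
          ← Real.rpow_add hz0]
        congr 1
        ring
      calc _ ≤ 5 * z ^ 2 * (C * 2 / (2 - β) * ε ^ (2 - β)) := h6.trans (by gcongr)
        _ = 5 * (C * 2 / (2 - β)) * (z ^ 2 * ε ^ (2 - β)) := by ring
        _ = _ := by rw [h7]
    have h8 : z * (D * ε ^ (1 - β)) = D * z ^ β := by
      have : z * ε ^ (1 - β) = z ^ β := by
        rw [hε, Real.inv_rpow hz0.le, ← Real.rpow_neg hz0.le]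
        nth_rw 1 [← Real.rpow_one z]
        rw [← Real.rpow_add hz0]
        congr 1
        ring
      rw [← this]
      ring
    have h9 := hM ε hε0 hε1
    set M := ∫ x in {x : ℝ | ε < |x| ∧ |x| ≤ 1}, x ∂ν
    have e3 : levyExponent γ 0 ν z - Complex.I * ((γ - c : ℝ) : ℂ) * z
        = (∫ x, levyKernel 1 (z * x) ∂ν) - Complex.I * z * ((M - c : ℝ) : ℂ) := by
      rw [hν.levyExponent_eq, e2]
      push_cast
      ring
    rw [e3]
    refine (norm_sub_le _ _).trans ?_
    rw [norm_mul, norm_mul, Complex.norm_I, one_mul, Complex.norm_real, Complex.norm_real,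
      Real.norm_eq_abs, Real.norm_eq_abs, abs_of_pos hz0, add_mul]
    refine add_le_add h3 ?_
    rw [← h8]
    gcongr
  · refine (hν.tendsto_one_sub_cos h0 h2 hN).neg.congr fun z => ?_
    rw [hν.levyExponent_re, ← neg_div]
    congr 1
    ring

end

/-! ### Truncated means of the Lévy measure. -/

section

variable {ν : Measure ℝ} {β γ : ℝ}

lemma measurableSet_abs_Ioc (ε : ℝ) : MeasurableSet {x : ℝ | ε < |x| ∧ |x| ≤ 1} :=
  (measurableSet_abs_gt ε).inter (measurableSet_le measurable_id.abs measurable_const)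

lemma IsLevyMeasure.integrableOn_id_abs_Ioc (hν : IsLevyMeasure ν) {ε : ℝ} (hε : 0 < ε) :
    IntegrableOn (fun x : ℝ => x) {x : ℝ | ε < |x| ∧ |x| ≤ 1} ν := by
  refine Measure.integrableOn_of_bounded (M := 1) ?_ (by fun_prop) ?_
  · exact ne_top_of_le_ne_top (hν.measure_abs_gt_ne_top hε) (measure_mono fun x hx => hx.1)
  · filter_upwards [ae_restrict_mem (measurableSet_abs_Ioc ε)] with x hx using hx.2

lemma IsLevyMeasure.norm_integral_abs_Ioc_le (hν : IsLevyMeasure ν) {ε₀ ε : ℝ} (hε₀ : 0 < ε₀)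
    (h : ε₀ ≤ ε) : |∫ x in {x : ℝ | ε < |x| ∧ |x| ≤ 1}, x ∂ν| ≤ ν.real {x | ε₀ < |x|} := by
  have hfin : ν {x : ℝ | ε < |x| ∧ |x| ≤ 1} < ∞ :=
    lt_of_le_of_lt (measure_mono fun x hx => hx.1)
      (hν.measure_abs_gt_ne_top (hε₀.trans_le h)).lt_top
  have h1 := norm_setIntegral_le_of_norm_le_const (f := fun x : ℝ => x) (C := 1) hfin
    (fun x hx => hx.2)
  rw [one_mul] at h1
  exact h1.trans (measureReal_mono (fun x hx => h.trans_lt hx.1) (hν.measure_abs_gt_ne_top hε₀))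

lemma integrable_min_abs {C : ℝ} (hC : 0 ≤ C) (hβ : β < 1) {ε : ℝ} (hε : 0 < ε) (hε1 : ε ≤ 1)
    (hC' : ∀ r, 0 < r → r ≤ 1 → ν {x | r < |x|} ≤ ENNReal.ofReal (C * r ^ (-β))) :
    Integrable (fun x => min |x| ε) ν ∧ ∫ x, min |x| ε ∂ν ≤ C / (1 - β) * ε ^ (1 - β) := by
  have h := lintegral_min_abs_rpow_le (p := 1) hC hβ one_pos hε hε1 hC'
  have h1β : 0 < 1 - β := by linarith
  simp only [Real.rpow_one, mul_one] at h
  have hnn : 0 ≤ᵐ[ν] fun x => min |x| ε := ae_of_all _ fun x => le_min (abs_nonneg x) hε.le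
  have hmm : AEStronglyMeasurable (fun x : ℝ => min |x| ε) ν :=
    (measurable_id.abs.min measurable_const).aestronglyMeasurable
  refine ⟨(lintegral_ofReal_ne_top_iff_integrable hmm hnn).1
    (ne_top_of_le_ne_top ENNReal.ofReal_ne_top h), ?_⟩
  rw [integral_eq_lintegral_of_nonneg_ae hnn hmm]
  exact ENNReal.toReal_le_of_le_ofReal (by positivity) h

/-- Control of the truncated means of a Lévy measure with tails of order `r ^ (-β)`. -/
lemma IsLevyMeasure.exists_truncated_mean_le (hν : IsLevyMeasure ν) {C pv : ℝ} (hC : 0 ≤ C)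
    (hC' : ∀ r, 0 < r → r ≤ 1 → ν {x | r < |x|} ≤ ENNReal.ofReal (C * r ^ (-β)))
    (h1 : β = 1 →
      Tendsto (fun ε : ℝ => ∫ x in {x : ℝ | ε < |x| ∧ |x| ≤ 1}, x ∂ν) (𝓝[>] 0) (𝓝 pv)) :
    ∃ c D : ℝ, ∀ ε, 0 < ε → ε ≤ 1 →
      |(∫ x in {x : ℝ | ε < |x| ∧ |x| ≤ 1}, x ∂ν) - c| ≤ D * ε ^ (1 - β) := by
  rcases lt_trichotomy β 1 with hβ | hβ | hβ
  -- For `β < 1` the small jumps have a finite mean, and the error is the mean over `|x| ≤ ε`.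
  · refine ⟨∫ x in {x : ℝ | |x| ≤ 1}, x ∂ν, C / (1 - β), fun ε hε hε1 => ?_⟩
    have hms : ∀ r : ℝ, MeasurableSet {x : ℝ | |x| ≤ r} := fun r =>
      measurableSet_le measurable_id.abs measurable_const
    have hint : ∀ r, 0 < r → r ≤ 1 → IntegrableOn (fun x : ℝ => x) {x : ℝ | |x| ≤ r} ν := by
      intro r hr hr1
      refine (integrable_min_abs hC hβ hr hr1 hC').1.integrableOn.mono' (by fun_prop) ?_
      filter_upwards [ae_restrict_mem (hms r)] with x hx
      rw [min_eq_left hx, Real.norm_eq_abs]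
    have e : {x : ℝ | |x| ≤ 1} = {x : ℝ | ε < |x| ∧ |x| ≤ 1} ∪ {x : ℝ | |x| ≤ ε} := by
      ext x
      simp only [Set.mem_ofPred_eq, Set.mem_union]
      constructor
      · intro h
        rcases lt_or_ge ε |x| with h' | h'
        · exact Or.inl ⟨h', h⟩
        · exact Or.inr h'
      · rintro (h | h)
        · exact h.2
        · exact h.trans hε1
    rw [e, setIntegral_union _ (hms ε) (hν.integrableOn_id_abs_Ioc hε) (hint ε hε hε1),
      sub_add_cancel_left, abs_neg]
    · obtain ⟨i1, i2⟩ := integrable_min_abs hC hβ hε hε1 hC'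
      have hle : |∫ x in {x : ℝ | |x| ≤ ε}, x ∂ν| ≤ ∫ x in {x : ℝ | |x| ≤ ε}, min |x| ε ∂ν := by
        rw [← Real.norm_eq_abs]
        refine norm_integral_le_of_norm_le i1.integrableOn ?_
        filter_upwards [ae_restrict_mem (hms ε)] with x hx
        rw [min_eq_left hx, Real.norm_eq_abs]
      refine hle.trans ((setIntegral_le_integral i1 (ae_of_all _ fun x => ?_)).trans i2)
      exact le_min (abs_nonneg x) hε.le
    · refine Set.disjoint_left.2 fun x hx hx' => ?_
      have : |x| ≤ ε := hx'
      linarith [hx.1]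
  · obtain ⟨ε₀, hε₀, h⟩ := mem_nhdsGT_iff_exists_Ioc_subset.1
      ((h1 hβ).eventually (Metric.ball_mem_nhds pv one_pos))
    have hε₀ : 0 < ε₀ := hε₀
    -- For `β = 1` the required rate is constant, so boundedness suffices: by convergence below
    -- `ε₀`, and by the mass of the larger jumps above it.
    refine ⟨pv, 1 + (ν.real {x | ε₀ < |x|} + |pv|), fun ε hε hε1 => ?_⟩
    rw [hβ, sub_self, Real.rpow_zero, mul_one]
    have h3 : 0 ≤ ν.real {x | ε₀ < |x|} := measureReal_nonneg
    have h4 := abs_nonneg pv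
    rcases le_or_gt ε ε₀ with hle | hlt
    · have h2 : dist (∫ x in {x : ℝ | ε < |x| ∧ |x| ≤ 1}, x ∂ν) pv < 1 := h ⟨hε, hle⟩
      rw [Real.dist_eq] at h2
      linarith
    · have h2 := hν.norm_integral_abs_Ioc_le hε₀ hlt.le
      have := abs_sub (∫ x in {x : ℝ | ε < |x| ∧ |x| ≤ 1}, x ∂ν) pv
      linarith
  -- For `β > 1` the truncated mean may diverge, but at most at the permitted rate, so no centring
  -- is needed.
  · refine ⟨0, C + C / (β - 1), fun ε hε hε1 => ?_⟩
    have hβ1 : 0 < β - 1 := by linarith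
    have h := lintegral_abs_Ioc_le hC hβ hε hε1 hC'
    rw [sub_zero, ← Real.norm_eq_abs]
    refine (norm_integral_le_integral_norm _).trans ?_
    rw [integral_eq_lintegral_of_nonneg_ae (ae_of_all _ fun x => norm_nonneg _) (by fun_prop)]
    exact ENNReal.toReal_le_of_le_ofReal (by positivity) h

/-- A Lévy measure without Gaussian part whose tails are regularly varying at `0` has a
stable-like exponent. -/
lemma IsLevyMeasure.exists_isStableLike (hν : IsLevyMeasure ν) (h0 : 0 < β) (h2 : β < 2)
    {Kp Km pv : ℝ}
    (hp : Tendsto (fun x : ℝ => x ^ β * ν.real (Set.Ioi x)) (𝓝[>] 0) (𝓝 Kp))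
    (hm : Tendsto (fun x : ℝ => x ^ β * ν.real (Set.Iio (-x))) (𝓝[>] 0) (𝓝 Km))
    (h1 : β = 1 →
      Tendsto (fun ε : ℝ => ∫ x in {x : ℝ | ε < |x| ∧ |x| ≤ 1}, x ∂ν) (𝓝[>] 0) (𝓝 pv)) :
    ∃ c, IsStableLike (levyExponent γ 0 ν) β c ((Kp + Km) * (β * stableConst β)) := by
  have hN : Tendsto (fun r : ℝ => r ^ β * ν.real {x | r < |x|}) (𝓝[>] 0) (𝓝 (Kp + Km)) := by
    refine (hp.add hm).congr' ?_
    filter_upwards [self_mem_nhdsWithin] with r hr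
    have hr : 0 < r := hr
    have hfin := hν.measure_abs_gt_ne_top hr
    have e : {x : ℝ | r < |x|} = Set.Ioi r ∪ Set.Iio (-r) := by
      ext x
      simp only [Set.mem_ofPred_eq, Set.mem_union, Set.mem_Ioi, Set.mem_Iio, lt_abs]
      rw [lt_neg]
    rw [e] at hfin ⊢
    rw [measureReal_union _ measurableSet_Iio
      (h₁ := ne_top_of_le_ne_top hfin (measure_mono Set.subset_union_left))
      (h₂ := ne_top_of_le_ne_top hfin (measure_mono Set.subset_union_right)), mul_add]
    refine Set.disjoint_left.2 fun x hx hx' => ?_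
    have h3 : r < x := hx
    have h4 : x < -r := hx'
    linarith
  obtain ⟨C, hC0, hC⟩ := hν.tail_le h0 hN
  have hC' : ∀ r, 0 < r → r ≤ 1 → ν {x | r < |x|} ≤ ENNReal.ofReal (C * r ^ (-β)) := by
    intro r hr hr1
    rw [ENNReal.le_ofReal_iff_toReal_le (hν.measure_abs_gt_ne_top hr) (by positivity)]
    exact hC r hr hr1
  obtain ⟨c, D, hM⟩ := hν.exists_truncated_mean_le hC0 hC' h1
  exact ⟨γ - c, hν.isStableLike_of_tail h0 h2 hN hM⟩

end

/-! ### Integrals of simple functions with respect to a Lévy basis -/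

/-- The character `x ↦ e^{ix}`. -/
def expI (x : ℝ) : ℂ := Complex.exp (x * Complex.I)

lemma norm_expI (x : ℝ) : ‖expI x‖ = 1 := Complex.norm_exp_ofReal_mul_I x

@[fun_prop]
lemma continuous_expI : Continuous expI := by
  unfold expI
  fun_prop

@[fun_prop]
lemma measurable_expI : Measurable expI := continuous_expI.measurable

lemma expI_add (x y : ℝ) : expI (x + y) = expI x * expI y := by
  simp [expI, add_mul, Complex.exp_add]

lemma expI_neg (x : ℝ) : expI (-x) = starRingEnd ℂ (expI x) := by
  simp [expI, ← Complex.exp_conj]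

lemma expI_zero : expI 0 = 1 := by simp [expI]

lemma expI_sum {κ : Type*} (s : Finset κ) (x : κ → ℝ) : expI (∑ i ∈ s, x i) = ∏ i ∈ s, expI (x i) := by
  simp [expI, Finset.sum_mul, Complex.exp_sum]

lemma charFun_map_eq_integral_expI {Ω : Type*} [MeasurableSpace Ω] {P : Measure Ω} {X : Ω → ℝ}
    (hX : AEMeasurable X P) (z : ℝ) : charFun (P.map X) z = ∫ ω, expI (z * X ω) ∂P := by
  rw [charFun_apply_real, integral_map hX (by fun_prop)]
  simp [expI]

section

variable {Ω : Type*} [MeasurableSpace Ω] {P : Measure Ω} {γ b : ℝ} {ν : Measure ℝ}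
  {L : Set (ℝ × ℝ) → Ω → ℝ}

/-- For the constant sequence `∅` the partial sums `m · L(∅)` converge, so their increments tend to
`0`. -/
lemma IsHomogeneousLevyBasis.empty (hL : IsHomogeneousLevyBasis P γ b ν L) : L ∅ =ᵐ[P] 0 := by
  have h := hL.sigma_additive (fun _ => ∅) (fun _ => MeasurableSet.empty)
    (fun _ _ _ => Set.disjoint_empty _) (by simp)
  filter_upwards [h] with ω hω
  simp only [Set.iUnion_empty, Finset.sum_const, Finset.card_range, nsmul_eq_mul] at hω
  have h1 := ((tendsto_add_atTop_iff_nat 1).2 hω).sub hω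
  simpa [add_mul] using h1

lemma IsHomogeneousLevyBasis.union (hL : IsHomogeneousLevyBasis P γ b ν L) {A B : Set (ℝ × ℝ)}
    (hA : MeasurableSet A) (hB : MeasurableSet B) (hAB : Disjoint A B) (hA' : volume A ≠ ∞)
    (hB' : volume B ≠ ∞) : L (A ∪ B) =ᵐ[P] L A + L B := by
  let S : ℕ → Set (ℝ × ℝ) := fun n => if n = 0 then A else if n = 1 then B else ∅
  have hU : ⋃ n, S n = A ∪ B := by
    ext p
    simp only [Set.mem_iUnion, Set.mem_union]
    constructor
    · rintro ⟨n, hn⟩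
      by_cases h0 : n = 0
      · exact Or.inl (by simpa [S, h0] using hn)
      · by_cases h1 : n = 1
        · exact Or.inr (by simpa [S, h1] using hn)
        · simp [S, h0, h1] at hn
    · rintro (h | h)
      · exact ⟨0, by simpa [S] using h⟩
      · exact ⟨1, by simpa [S] using h⟩
  have hm : ∀ n, MeasurableSet (S n) := fun n => by
    simp only [S]
    split_ifs
    exacts [hA, hB, MeasurableSet.empty]
  have hd : Pairwise fun i j => Disjoint (S i) (S j) := by
    intro i j hij
    simp only [S]
    split_ifs with h1 h2 h3 h4 h5 h6 <;> simp_all [disjoint_comm]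
  have h := hL.sigma_additive S hm hd (by
    rw [hU]
    exact (measure_union_lt_top hA'.lt_top hB'.lt_top).ne)
  filter_upwards [h, hL.empty] with ω hω h0
  have hω2 := (tendsto_add_atTop_iff_nat 2).2 hω
  have : ∀ m : ℕ, ∑ i ∈ Finset.range (m + 2), L (S i) ω = L A ω + L B ω := by
    intro m
    induction m with
    | zero => simp [Finset.sum_range_succ, S]
    | succ m ih =>
      rw [show m + 1 + 2 = m + 2 + 1 by ring, Finset.sum_range_succ, ih]
      have : S (m + 2) = ∅ := by simp [S]
      rw [this, h0]
      simp
  simp only [this, hU] at hω2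
  exact (tendsto_nhds_unique hω2 tendsto_const_nhds)

lemma IsHomogeneousLevyBasis.biUnion (hL : IsHomogeneousLevyBasis P γ b ν L) {κ : Type*}
    {T : κ → Set (ℝ × ℝ)} (hT : ∀ i, MeasurableSet (T i)) (hT' : ∀ i, volume (T i) ≠ ∞)
    (hd : Pairwise fun i j => Disjoint (T i) (T j)) (s : Finset κ) :
    L (⋃ i ∈ s, T i) =ᵐ[P] fun ω => ∑ i ∈ s, L (T i) ω := by
  classical
  induction s using Finset.induction_on with
  | empty =>
    simp only [Finset.notMem_empty, Set.iUnion_of_empty, Set.iUnion_empty, Finset.sum_empty]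
    exact hL.empty
  | insert i s hi ih =>
    rw [Finset.set_biUnion_insert]
    have h1 := hL.union (hT i) (Finset.measurableSet_biUnion s fun j _ => hT j)
      (Set.disjoint_iUnion₂_right.2 fun j hj => hd (by rintro rfl; exact hi hj)) (hT' i)
      ((measure_biUnion_lt_top s.finite_toSet fun j _ => (hT' j).lt_top).ne)
    filter_upwards [h1, ih] with ω h2 h3
    rw [h2, Finset.sum_insert hi, ← h3]
    rfl

/-- The characteristic function of a combination of the values of a Lévy basis on disjoint
sets. -/
lemma IsHomogeneousLevyBasis.integral_expI_of_disjoint (hL : IsHomogeneousLevyBasis P γ b ν L)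
    {κ : Type*} [Fintype κ] {T : κ → Set (ℝ × ℝ)} (hT : ∀ i, MeasurableSet (T i))
    (hT' : ∀ i, volume (T i) ≠ ∞) (hd : Pairwise fun i j => Disjoint (T i) (T j)) (c : κ → ℝ) :
    ∫ ω, expI (∑ i, c i * L (T i) ω) ∂P
      = Complex.exp (∑ i, (volume.real (T i) : ℂ) * levyExponent γ b ν (c i)) := by
  let e : κ → ℕ := fun i => (Fintype.equivFin κ i : ℕ)
  have he : Function.Injective e :=
    Fin.val_injective.comp (Fintype.equivFin κ).injective
  -- Independent scattering is formulated for sequences, so the finite family is padded with empty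
  -- sets.
  let S : ℕ → Set (ℝ × ℝ) := Function.extend e T fun _ => ∅
  have hSe : ∀ i, S (e i) = T i := fun i => he.extend_apply _ _ _
  have hS : ∀ n, (∃ i, n = e i) ∨ S n = ∅ := fun n => by
    by_cases h : ∃ i, e i = n
    · exact Or.inl (h.imp fun i hi => hi.symm)
    · exact Or.inr (Function.extend_apply' _ _ _ h)
  have hi := hL.indep S
    (fun n => by
      rcases hS n with ⟨i, rfl⟩ | h
      · rw [hSe]; exact hT i
      · rw [h]; exact MeasurableSet.empty)
    (fun n => by
      rcases hS n with ⟨i, rfl⟩ | h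
      · rw [hSe]; exact hT' i
      · rw [h]; simp)
    (fun m n hmn => by
      rcases hS m with ⟨i, rfl⟩ | h
      · rcases hS n with ⟨j, rfl⟩ | h'
        · rw [hSe, hSe]
          exact hd (by rintro rfl; exact hmn rfl)
        · rw [h']; exact Set.disjoint_empty _
      · rw [h]; exact Set.empty_disjoint _)
  have hi2 : iIndepFun (fun i => L (T i)) P := by
    simpa only [hSe] using hi.precomp he
  have hm : ∀ i, Measurable (L (T i)) := fun i => hL.measurable _ (hT i) (hT' i)
  have h := hi2.integral_fun_prod_comp (f := fun i x => expI (c i * x))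
    (fun i => (hm i).aemeasurable) (fun i => by fun_prop)
  simp_rw [expI_sum]
  rw [h, Complex.exp_sum]
  refine Finset.prod_congr rfl fun i _ => ?_
  rw [← charFun_map_eq_integral_expI (hm i).aemeasurable, hL.charFun_eq _ (hT i) (hT' i)]

/-- `X` is almost surely the integral of the simple function `h` with respect to `L`. -/
def IsSimpleIntegral (P : Measure Ω) (L : Set (ℝ × ℝ) → Ω → ℝ) (h : ℝ × ℝ → ℝ) (X : Ω → ℝ) :
    Prop :=
  ∃ (κ : Type) (_ : Fintype κ) (S : κ → Set (ℝ × ℝ)) (c : κ → ℝ),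
    (∀ i, MeasurableSet (S i)) ∧ (∀ i, volume (S i) ≠ ∞) ∧
    (∀ p, h p = ∑ i, (S i).indicator (fun _ => c i) p) ∧
    X =ᵐ[P] fun ω => ∑ i, c i * L (S i) ω

variable {h h' : ℝ × ℝ → ℝ} {X X' : Ω → ℝ}

lemma IsSimpleIntegral.add (hX : IsSimpleIntegral P L h X) (hX' : IsSimpleIntegral P L h' X') :
    IsSimpleIntegral P L (fun p => h p + h' p) (fun ω => X ω + X' ω) := by
  obtain ⟨κ, _, S, c, h1, h2, h3, h4⟩ := hX
  obtain ⟨κ', _, S', c', h1', h2', h3', h4'⟩ := hX'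
  refine ⟨κ ⊕ κ', inferInstance, Sum.elim S S', Sum.elim c c', ?_, ?_, ?_, ?_⟩
  · rintro (i | i)
    exacts [h1 i, h1' i]
  · rintro (i | i)
    exacts [h2 i, h2' i]
  · intro p
    simp [h3, h3']
  · filter_upwards [h4, h4'] with ω e1 e2
    simp [e1, e2]

lemma IsSimpleIntegral.const_mul (hX : IsSimpleIntegral P L h X) (a : ℝ) :
    IsSimpleIntegral P L (fun p => a * h p) (fun ω => a * X ω) := by
  obtain ⟨κ, _, S, c, h1, h2, h3, h4⟩ := hX
  refine ⟨κ, inferInstance, S, fun i => a * c i, h1, h2, fun p => ?_, ?_⟩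
  · simp only
    rw [h3, Finset.mul_sum]
    refine Finset.sum_congr rfl fun i _ => ?_
    by_cases hp : p ∈ S i <;> simp [hp]
  · filter_upwards [h4] with ω e1
    simp only [e1, Finset.mul_sum, mul_assoc]

lemma IsSimpleIntegral.congr (hX : IsSimpleIntegral P L h X) (hXX' : X' =ᵐ[P] X)
    (hh : ∀ p, h' p = h p) : IsSimpleIntegral P L h' X' := by
  obtain ⟨κ, _, S, c, h1, h2, h3, h4⟩ := hX
  exact ⟨κ, inferInstance, S, c, h1, h2, fun p => (hh p).trans (h3 p), hXX'.trans h4⟩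

lemma isSimpleIntegral_zero : IsSimpleIntegral P L (fun _ => 0) (fun _ => 0) :=
  ⟨Empty, inferInstance, fun i => i.elim, fun i => i.elim, fun i => i.elim, fun i => i.elim,
    fun p => by simp, by simp⟩

lemma isSimpleIntegral_indicator {A : Set (ℝ × ℝ)} (hA : MeasurableSet A) (hA' : volume A ≠ ∞) :
    IsSimpleIntegral P L (A.indicator fun _ => 1) (L A) :=
  ⟨Unit, inferInstance, fun _ => A, fun _ => 1, fun _ => hA, fun _ => hA', fun p => by simp,
    ae_of_all _ fun ω => by simp⟩

lemma IsSimpleIntegral.sum {κ : Type*} {f : κ → ℝ × ℝ → ℝ} {Y : κ → Ω → ℝ} (s : Finset κ)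
    (hY : ∀ i ∈ s, IsSimpleIntegral P L (f i) (Y i)) :
    IsSimpleIntegral P L (fun p => ∑ i ∈ s, f i p) (fun ω => ∑ i ∈ s, Y i ω) := by
  classical
  induction s using Finset.induction_on with
  | empty => simpa using isSimpleIntegral_zero
  | insert i s hi ih =>
    simp only [Finset.sum_insert hi]
    exact (hY i (Finset.mem_insert_self i s)).add
      (ih fun j hj => hY j (Finset.mem_insert_of_mem hj))

/-- The disjoint sets are the atoms of the algebra generated by the `S i`, indexed by the set `I` of
those `i` whose `S i` contains the atom; the coefficient on an atom is the sum of the `c i` over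
`I`. -/
lemma IsSimpleIntegral.exists_disjoint (hL : IsHomogeneousLevyBasis P γ b ν L)
    (hX : IsSimpleIntegral P L h X) :
    ∃ (κ : Type) (_ : Fintype κ) (S : κ → Set (ℝ × ℝ)) (c : κ → ℝ),
      (∀ i, MeasurableSet (S i)) ∧ (∀ i, volume (S i) ≠ ∞) ∧
      (Pairwise fun i j => Disjoint (S i) (S j)) ∧
      (∀ p, h p = ∑ i, (S i).indicator (fun _ => c i) p) ∧
      X =ᵐ[P] fun ω => ∑ i, c i * L (S i) ω := by
  classical
  obtain ⟨κ, _, S, c, h1, h2, h3, h4⟩ := hX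
  -- Nonemptiness removes the complement of the union, whose area is infinite.
  let T : Finset κ → Set (ℝ × ℝ) := fun I => {p | I.Nonempty ∧ ∀ i, p ∈ S i ↔ i ∈ I}
  have hTS : ∀ i, S i = ⋃ I ∈ Finset.univ.filter (fun I : Finset κ => i ∈ I), T I := by
    intro i
    ext p
    simp only [Finset.mem_filter, Finset.mem_univ, true_and, Set.mem_iUnion, exists_prop]
    constructor
    · intro hp
      refine ⟨Finset.univ.filter fun j => p ∈ S j, by simpa using hp, ⟨i, by simpa using hp⟩,
        fun j => by simp⟩
    · rintro ⟨I, hi, -, hI⟩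
      exact (hI i).2 hi
  have hTm : ∀ I, MeasurableSet (T I) := by
    intro I
    have : T I = {p | I.Nonempty} ∩ ⋂ i, {p | p ∈ S i ↔ i ∈ I} := by
      ext p
      simp [T]
    rw [this]
    refine (MeasurableSet.const _).inter (MeasurableSet.iInter fun i => ?_)
    by_cases hi : i ∈ I
    · simpa [hi] using h1 i
    · have : {p | p ∈ S i ↔ i ∈ I} = (S i)ᶜ := by
        ext p
        simp [hi]
      rw [this]
      exact (h1 i).compl
  have hTf : ∀ I, volume (T I) ≠ ∞ := by
    intro I
    rcases I.eq_empty_or_nonempty with rfl | ⟨i, hi⟩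
    · simp [T]
    · exact ne_top_of_le_ne_top (h2 i) (measure_mono fun p hp => (hp.2 i).2 hi)
  have hTd : Pairwise fun I J => Disjoint (T I) (T J) := by
    intro I J hIJ
    refine Set.disjoint_left.2 fun p hp hp' => hIJ ?_
    ext i
    rw [← hp.2 i, ← hp'.2 i]
  refine ⟨Finset κ, inferInstance, T, fun I => ∑ i ∈ I, c i, hTm, hTf, hTd, fun p => ?_, ?_⟩
  · rw [h3]
    let I₀ : Finset κ := Finset.univ.filter fun j => p ∈ S j
    have e1 : ∑ i, (S i).indicator (fun _ => c i) p = ∑ i ∈ I₀, c i := by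
      rw [Finset.sum_filter]
      rfl
    rw [e1, Finset.sum_eq_single I₀]
    · rcases I₀.eq_empty_or_nonempty with h | h
      · simp [h]
      · rw [Set.indicator_of_mem]
        exact ⟨h, fun i => by simp [I₀]⟩
    · intro J _ hJ
      refine Set.indicator_of_notMem (fun hp => hJ ?_) _
      ext i
      rw [← hp.2 i]
      simp [I₀]
    · simp
  · have hall : ∀ᵐ ω ∂P, ∀ i, L (S i) ω
        = ∑ I ∈ Finset.univ.filter (fun I : Finset κ => i ∈ I), L (T I) ω := by
      rw [ae_all_iff]
      intro i
      conv in L (S i) _ => rw [hTS i]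
      exact hL.biUnion hTm hTf hTd _
    filter_upwards [h4, hall] with ω e1 e2
    rw [e1]
    simp_rw [e2, Finset.mul_sum, Finset.sum_mul, Finset.sum_filter]
    rw [Finset.sum_comm]
    refine Finset.sum_congr rfl fun I _ => ?_
    rw [← Finset.sum_filter]
    simp

/-- A function vanishing at `0` acts termwise on simple functions over disjoint sets. -/
lemma comp_sum_indicator {κ E : Type*} [Fintype κ] [AddCommMonoid E] {S : κ → Set (ℝ × ℝ)}
    (hd : Pairwise fun i j => Disjoint (S i) (S j)) (c : κ → ℝ) {Φ : ℝ → E} (h0 : Φ 0 = 0)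
    (p : ℝ × ℝ) :
    Φ (∑ i, (S i).indicator (fun _ => c i) p) = ∑ i, (S i).indicator (fun _ => Φ (c i)) p := by
  by_cases hp : ∃ i, p ∈ S i
  · obtain ⟨i, hi⟩ := hp
    have hj : ∀ j, j ≠ i → p ∉ S j := fun j hj hp => Set.disjoint_left.1 (hd hj) hp hi
    rw [Finset.sum_eq_single i (fun j _ hji => Set.indicator_of_notMem (hj j hji) _) (by simp),
      Finset.sum_eq_single i (fun j _ hji => Set.indicator_of_notMem (hj j hji) _) (by simp),
      Set.indicator_of_mem hi, Set.indicator_of_mem hi]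
  · have hp : ∀ i, p ∉ S i := fun i hi => hp ⟨i, hi⟩
    simp [hp, h0]

lemma IsSimpleIntegral.integrable_comp (hL : IsHomogeneousLevyBasis P γ b ν L)
    (hX : IsSimpleIntegral P L h X) {E : Type*} [NormedAddCommGroup E] {Φ : ℝ → E}
    (h0 : Φ 0 = 0) : Integrable (fun p => Φ (h p)) := by
  obtain ⟨κ, _, S, c, h1, h2, hd, h3, h4⟩ := hX.exists_disjoint hL
  simp_rw [h3, comp_sum_indicator hd c h0]
  refine integrable_finsetSum _ fun i _ => ?_
  exact (integrable_indicator_iff (h1 i)).2 (integrableOn_const (h2 i))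

lemma IsSimpleIntegral.measurable (hX : IsSimpleIntegral P L h X) : Measurable h := by
  obtain ⟨κ, _, S, c, h1, h2, h3, h4⟩ := hX
  rw [funext h3]
  exact Finset.measurable_fun_sum _ fun i _ => measurable_const.indicator (h1 i)

lemma IsSimpleIntegral.exists_bound (hX : IsSimpleIntegral P L h X) : ∃ C, ∀ p, |h p| ≤ C := by
  obtain ⟨κ, _, S, c, h1, h2, h3, h4⟩ := hX
  refine ⟨∑ i, |c i|, fun p => ?_⟩
  rw [h3]
  refine (Finset.abs_sum_le_sum_abs _ _).trans (Finset.sum_le_sum fun i _ => ?_)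
  by_cases hp : p ∈ S i <;> simp [hp]

lemma IsSimpleIntegral.aemeasurable (hL : IsHomogeneousLevyBasis P γ b ν L)
    (hX : IsSimpleIntegral P L h X) : AEMeasurable X P := by
  obtain ⟨κ, _, S, c, h1, h2, h3, h4⟩ := hX
  exact ⟨_, Finset.measurable_fun_sum _ fun i _ => (hL.measurable _ (h1 i) (h2 i)).const_mul _, h4⟩

/-- The characteristic function of the integral of a simple function. -/
lemma IsSimpleIntegral.integral_expI (hL : IsHomogeneousLevyBasis P γ b ν L)
    (hν : IsLevyMeasure ν) (hX : IsSimpleIntegral P L h X) :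
    ∫ ω, expI (X ω) ∂P = Complex.exp (∫ p, levyExponent γ b ν (h p)) := by
  obtain ⟨κ, _, S, c, h1, h2, hd, h3, h4⟩ := hX.exists_disjoint hL
  have e : ∫ ω, expI (X ω) ∂P = ∫ ω, expI (∑ i, c i * L (S i) ω) ∂P :=
    integral_congr_ae (h4.fun_comp expI)
  rw [e]
  simp_rw [h3, comp_sum_indicator hd c hν.levyExponent_zero]
  rw [hL.integral_expI_of_disjoint h1 h2 hd, integral_finsetSum]
  · congr 1
    refine Finset.sum_congr rfl fun i _ => ?_
    rw [integral_indicator (h1 i), setIntegral_const]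
    simp
  · exact fun i _ => (integrable_indicator_iff (h1 i)).2 (integrableOn_const (h2 i))

end

/-! ### The trawl sets -/

section

variable {a : ℝ → ℝ}

/-- The trawl function, extended to the left of `0` by its value at `0`. -/
def trawlExt (a : ℝ → ℝ) (s : ℝ) : ℝ := a (max s 0)

lemma IsTrawlFunction.continuous_ext (ha : IsTrawlFunction a) : Continuous (trawlExt a) :=
  ha.continuous.comp_continuous (by fun_prop) fun s => le_max_right s 0

lemma IsTrawlFunction.antitone_ext (ha : IsTrawlFunction a) : Antitone (trawlExt a) :=
  fun _ _ h => ha.antitone (Set.mem_Ici.2 (le_max_right _ _)) (Set.mem_Ici.2 (le_max_right _ _))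
    (max_le_max_right 0 h)

lemma IsTrawlFunction.ext_nonneg (ha : IsTrawlFunction a) (s : ℝ) : 0 ≤ trawlExt a s :=
  ha.nonneg _ (le_max_right _ _)

lemma IsTrawlFunction.ext_le (ha : IsTrawlFunction a) (s : ℝ) : trawlExt a s ≤ a 0 :=
  ha.antitone (Set.mem_Ici.2 le_rfl) (le_max_right s 0) (le_max_right s 0)

lemma mem_trawlSetAt {t : ℝ} {p : ℝ × ℝ} :
    p ∈ trawlSetAt a t ↔ p.1 ≤ t ∧ 0 ≤ p.2 ∧ p.2 ≤ trawlExt a (t - p.1) := by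
  simp only [trawlSetAt, trawlSet, Set.mem_ofPred_eq, sub_nonpos, neg_sub, trawlExt]
  refine and_congr_right fun h => ?_
  rw [max_eq_left (sub_nonneg.2 h)]

lemma IsTrawlFunction.measurableSet_region (ha : IsTrawlFunction a) (t : ℝ) {I : Set ℝ}
    (hI : MeasurableSet I) :
    MeasurableSet {p : ℝ × ℝ | p.1 ∈ I ∧ 0 ≤ p.2 ∧ p.2 ≤ trawlExt a (t - p.1)} := by
  have := ha.continuous_ext.measurable
  exact (measurable_fst hI).inter ((measurableSet_le measurable_const measurable_snd).inter
    (measurableSet_le measurable_snd (by fun_prop)))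

lemma IsTrawlFunction.measurableSet_trawlSetAt (ha : IsTrawlFunction a) (t : ℝ) :
    MeasurableSet (trawlSetAt a t) := by
  have : trawlSetAt a t = {p | p.1 ∈ Set.Iic t ∧ 0 ≤ p.2 ∧ p.2 ≤ trawlExt a (t - p.1)} := by
    ext p
    exact mem_trawlSetAt
  rw [this]
  exact ha.measurableSet_region t measurableSet_Iic

lemma IsTrawlFunction.volume_region (ha : IsTrawlFunction a) (t : ℝ) {I : Set ℝ}
    (hI : MeasurableSet I) :
    volume {p : ℝ × ℝ | p.1 ∈ I ∧ 0 ≤ p.2 ∧ p.2 ≤ trawlExt a (t - p.1)}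
      = ∫⁻ r in I, ENNReal.ofReal (trawlExt a (t - r)) := by
  rw [Measure.volume_eq_prod, Measure.prod_apply (ha.measurableSet_region t hI),
    ← lintegral_indicator hI]
  congr 1
  ext r
  by_cases hr : r ∈ I
  · have : Prod.mk r ⁻¹' {p : ℝ × ℝ | p.1 ∈ I ∧ 0 ≤ p.2 ∧ p.2 ≤ trawlExt a (t - p.1)}
        = Set.Icc 0 (trawlExt a (t - r)) := by
      ext y
      simp [hr]
    rw [this, Set.indicator_of_mem hr, Real.volume_Icc, sub_zero]
  · have : Prod.mk r ⁻¹' {p : ℝ × ℝ | p.1 ∈ I ∧ 0 ≤ p.2 ∧ p.2 ≤ trawlExt a (t - p.1)} = ∅ := by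
      ext y
      simp [hr]
    rw [this, Set.indicator_of_notMem hr, measure_empty]

lemma volume_trawlSetAt (t : ℝ) :
    volume (trawlSetAt a t) = volume (trawlSetAt a 0) := by
  have : trawlSetAt a t = (fun p : ℝ × ℝ => p + (-t, 0)) ⁻¹' trawlSetAt a 0 := by
    ext p
    simp [mem_trawlSetAt]
    intro _ _
    rw [sub_eq_add_neg]
  rw [this, measure_preimage_add_right]

lemma IsTrawlFunction.volume_trawlSetAt_ne_top (ha : IsTrawlFunction a) (t : ℝ) :
    volume (trawlSetAt a t) ≠ ∞ := by
  have e : trawlSetAt a 0 = {p | p.1 ∈ Set.Iic 0 ∧ 0 ≤ p.2 ∧ p.2 ≤ trawlExt a (0 - p.1)} := by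
    ext p
    exact mem_trawlSetAt
  have hi : IntegrableOn (fun r => a (-r)) (Set.Iic 0) := by
    have h := ((Measure.measurePreserving_neg (volume : Measure ℝ)).integrableOn_comp_preimage
      (MeasurableEquiv.neg ℝ).measurableEmbedding (f := a) (s := Set.Ici 0)).2 ha.integrable
    have : (Neg.neg ⁻¹' Set.Ici 0 : Set ℝ) = Set.Iic 0 := by
      ext r
      simp
    rwa [this] at h
  rw [volume_trawlSetAt, e, ha.volume_region 0 measurableSet_Iic]
  have : ∫⁻ r in Set.Iic (0 : ℝ), ENNReal.ofReal (trawlExt a (0 - r))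
      = ∫⁻ r in Set.Iic (0 : ℝ), ENNReal.ofReal (a (-r)) := by
    refine setLIntegral_congr_fun measurableSet_Iic fun r hr => ?_
    have hr : r ≤ 0 := hr
    simp only [trawlExt, zero_sub]
    rw [max_eq_left (by linarith)]
  rw [this]
  exact hi.lintegral_lt_top.ne

/-- Over `r ≤ 0` the moved set lies inside the original by monotonicity of `a`, so the difference is
the part of the moved set over `(0, t]`. -/
lemma IsTrawlFunction.measureReal_trawlSetAt_diff (ha : IsTrawlFunction a) {t : ℝ} (ht : 0 ≤ t) :
    volume.real (trawlSetAt a t \ trawlSetAt a 0) = ∫ s in (0 : ℝ)..t, trawlExt a s := by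
  have e : trawlSetAt a t \ trawlSetAt a 0
      = {p | p.1 ∈ Set.Ioc 0 t ∧ 0 ≤ p.2 ∧ p.2 ≤ trawlExt a (t - p.1)} := by
    ext p
    simp only [Set.mem_sdiff, mem_trawlSetAt, Set.mem_ofPred_eq, Set.mem_Ioc]
    constructor
    · rintro ⟨⟨h1, h2, h3⟩, h4⟩
      refine ⟨⟨lt_of_not_ge fun h => h4 ⟨h, h2, h3.trans (ha.antitone_ext (by linarith))⟩, h1⟩,
        h2, h3⟩
    · rintro ⟨⟨h1, h2⟩, h3, h4⟩
      exact ⟨⟨h2, h3, h4⟩, fun h => by linarith [h.1]⟩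
  have hc : Continuous fun r => trawlExt a (t - r) := ha.continuous_ext.comp (by fun_prop)
  rw [e, measureReal_def, ha.volume_region t measurableSet_Ioc,
    ← ofReal_integral_eq_lintegral_ofReal, ENNReal.toReal_ofReal,
    ← intervalIntegral.integral_of_le ht, intervalIntegral.integral_comp_sub_left (trawlExt a) t]
  · simp
  · exact integral_nonneg fun r => ha.ext_nonneg _
  · exact (hc.integrableOn_Icc).mono_set Set.Ioc_subset_Icc_self
  · exact ae_of_all _ fun r => ha.ext_nonneg _

/-- Two sets of equal finite area lose the same area on removing their intersection. -/
lemma IsTrawlFunction.measureReal_trawlSetAt_zero_diff (ha : IsTrawlFunction a) {t : ℝ}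
    (ht : 0 ≤ t) :
    volume.real (trawlSetAt a 0 \ trawlSetAt a t) = ∫ s in (0 : ℝ)..t, trawlExt a s := by
  have h1 := measureReal_sdiff_add_inter (μ := volume) (s := trawlSetAt a 0)
    (ha.measurableSet_trawlSetAt t) (ha.volume_trawlSetAt_ne_top 0)
  have h2 := measureReal_sdiff_add_inter (μ := volume) (s := trawlSetAt a t)
    (ha.measurableSet_trawlSetAt 0) (ha.volume_trawlSetAt_ne_top t)
  have h3 : volume.real (trawlSetAt a t) = volume.real (trawlSetAt a 0) := by
    rw [measureReal_def, measureReal_def, volume_trawlSetAt]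
  rw [Set.inter_comm, ha.measureReal_trawlSetAt_diff ht] at h2
  linarith

lemma IsTrawlFunction.trawlSetAt_zero_diff_mono (ha : IsTrawlFunction a) {s t : ℝ} (hs : 0 ≤ s)
    (hst : s ≤ t) :
    trawlSetAt a 0 \ trawlSetAt a s ⊆ trawlSetAt a 0 \ trawlSetAt a t := by
  rintro p ⟨h1, h2⟩
  refine ⟨h1, fun h3 => h2 ?_⟩
  rw [mem_trawlSetAt] at h1 h3 ⊢
  exact ⟨h1.1.trans hs, h1.2.1, h3.2.2.trans (ha.antitone_ext (by linarith))⟩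

/-! ### The kernel of the partial sums -/

/-- The simple function `∑_{k<M} v_k (1_{A_0} - 1_{A_{Δk}})`. -/
def trawlKernel (a : ℝ → ℝ) (Δ : ℝ) (M : ℕ) (v : ℕ → ℝ) (p : ℝ × ℝ) : ℝ :=
  ∑ k ∈ Finset.range M, v k * ((trawlSetAt a 0).indicator (fun _ => 1) p
    + -1 * (trawlSetAt a (Δ * k)).indicator (fun _ => 1) p)

variable {Δ : ℝ} {M : ℕ} {v : ℕ → ℝ}

lemma IsTrawlFunction.measurable_trawlKernel (ha : IsTrawlFunction a) :
    Measurable (trawlKernel a Δ M v) := by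
  refine Finset.measurable_fun_sum _ fun k _ => Measurable.const_mul ?_ _
  exact (measurable_const.indicator (ha.measurableSet_trawlSetAt _)).add
    ((measurable_const.indicator (ha.measurableSet_trawlSetAt _)).const_mul _)

lemma abs_trawlKernel_le (p : ℝ × ℝ) :
    |trawlKernel a Δ M v p| ≤ ∑ k ∈ Finset.range M, |v k| := by
  refine (Finset.abs_sum_le_sum_abs _ _).trans (Finset.sum_le_sum fun k _ => ?_)
  rw [abs_mul]
  refine mul_le_of_le_one_right (abs_nonneg _) ?_
  by_cases h1 : p ∈ trawlSetAt a 0 <;> by_cases h2 : p ∈ trawlSetAt a (Δ * k) <;> simp [h1, h2]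

/-- All translates have the same area. This is why a linear term in the exponent can be subtracted
at no cost. -/
lemma IsTrawlFunction.integral_trawlKernel (ha : IsTrawlFunction a) :
    ∫ p, trawlKernel a Δ M v p = 0 := by
  have hi : ∀ t, Integrable ((trawlSetAt a t).indicator fun _ => (1 : ℝ)) := fun t =>
    (integrable_indicator_iff (ha.measurableSet_trawlSetAt t)).2
      (integrableOn_const (ha.volume_trawlSetAt_ne_top t))
  have hk : ∀ k : ℕ, Integrable (fun p => v k * ((trawlSetAt a 0).indicator (fun _ => 1) p
      + -1 * (trawlSetAt a (Δ * k)).indicator (fun _ => 1) p)) :=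
    fun k => ((hi 0).add ((hi _).const_mul _)).const_mul _
  unfold trawlKernel
  rw [integral_finsetSum _ fun k _ => hk k]
  refine Finset.sum_eq_zero fun k _ => ?_
  rw [integral_const_mul, integral_add (hi 0) ((hi _).const_mul _), integral_const_mul,
    integral_indicator (ha.measurableSet_trawlSetAt _),
    integral_indicator (ha.measurableSet_trawlSetAt _), setIntegral_const, setIntegral_const,
    measureReal_def, measureReal_def, volume_trawlSetAt (Δ * k)]
  simp

lemma IsTrawlFunction.trawlKernel_of_nonpos (ha : IsTrawlFunction a) (hΔ : 0 ≤ Δ) {p : ℝ × ℝ}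
    (hp : p.1 ≤ 0) :
    trawlKernel a Δ M v p = ∑ k ∈ Finset.range M,
      (trawlSetAt a 0 \ trawlSetAt a (Δ * k)).indicator (fun _ => v k) p := by
  refine Finset.sum_congr rfl fun k _ => ?_
  have h0 : p ∈ trawlSetAt a (Δ * k) → p ∈ trawlSetAt a 0 := by
    rw [mem_trawlSetAt, mem_trawlSetAt]
    rintro ⟨_, h2, h3⟩
    exact ⟨hp, h2, h3.trans (ha.antitone_ext (by have : 0 ≤ Δ * k := by positivity
                                                 linarith))⟩
  by_cases h1 : p ∈ trawlSetAt a 0 <;> by_cases h2 : p ∈ trawlSetAt a (Δ * k)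
  · simp [h1, h2]
  · simp [h1, h2]
  · exact absurd (h0 h2) h1
  · simp [h1, h2]

lemma trawlKernel_of_pos {p : ℝ × ℝ} (hp : 0 < p.1) :
    trawlKernel a Δ M v p
      = -∑ k ∈ Finset.range M, (trawlSetAt a (Δ * k)).indicator (fun _ => v k) p := by
  rw [← Finset.sum_neg_distrib]
  refine Finset.sum_congr rfl fun k _ => ?_
  have h1 : p ∉ trawlSetAt a 0 := fun h => by linarith [(mem_trawlSetAt.1 h).1]
  by_cases h2 : p ∈ trawlSetAt a (Δ * k) <;> simp [h1, h2]

/-- A function of a weighted count of an increasing sequence of sets. -/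
lemma comp_sum_indicator_of_monotone {α : Type*} {S : ℕ → Set α} (hS : Monotone S)
    (hS0 : S 0 = ∅) {Φ : ℝ → ℂ} (h0 : Φ 0 = 0) (M : ℕ) (v : ℕ → ℝ) (p : α) :
    Φ (∑ k ∈ Finset.range M, (S k).indicator (fun _ => v k) p)
      = ∑ j ∈ Finset.range M,
        (S (j + 1) \ S j).indicator (fun _ => Φ (∑ k ∈ Finset.Ico (j + 1) M, v k)) p := by
  classical
  by_cases h : ∃ k, k ≤ M ∧ p ∈ S k
  -- `j₀` is the first index whose set contains `p`; by monotonicity the sum then runs over all `k ≥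
  -- j₀`, and `j₀ ≥ 1` because `S 0` is empty.
  · set j₀ := Nat.find h with hj₀
    obtain ⟨h1, h2⟩ := Nat.find_spec h
    have h3 : ∀ k, k < j₀ → p ∉ S k := fun k hk hp =>
      Nat.find_min h hk ⟨hk.le.trans h1, hp⟩
    have hne : j₀ ≠ 0 := fun h0 => by
      rw [← hj₀, h0, hS0] at h2
      exact h2
    obtain ⟨j, hj⟩ := Nat.exists_eq_succ_of_ne_zero hne
    rw [← hj₀, hj] at h1 h2
    rw [hj] at h3
    have e1 : ∑ k ∈ Finset.range M, (S k).indicator (fun _ => v k) p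
        = ∑ k ∈ Finset.Ico (j + 1) M, v k := by
      rw [← Finset.sum_subset (s₁ := Finset.Ico (j + 1) M)]
      · refine Finset.sum_congr rfl fun k hk => Set.indicator_of_mem ?_ _
        exact hS (Finset.mem_Ico.1 hk).1 h2
      · intro k hk
        exact Finset.mem_range.2 (Finset.mem_Ico.1 hk).2
      · intro k hk hk'
        refine Set.indicator_of_notMem (h3 k ?_) _
        by_contra hlt
        exact hk' (Finset.mem_Ico.2 ⟨not_lt.1 hlt, Finset.mem_range.1 hk⟩)
    rw [e1]
    symm
    refine (Finset.sum_eq_single j ?_ ?_).trans ?_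
    · intro i _ hij
      refine Set.indicator_of_notMem (fun hp => ?_) _
      rcases lt_or_gt_of_ne hij with hlt | hlt
      · exact h3 (i + 1) (Nat.succ_lt_succ hlt) hp.1
      · exact hp.2 (hS hlt h2)
    · intro hj'
      exact absurd (Finset.mem_range.2 h1) hj'
    · have hm : p ∈ S (j + 1) \ S j := ⟨h2, h3 j (Nat.lt_succ_self j)⟩
      exact Set.indicator_of_mem hm _
  · have h' : ∀ k, k ≤ M → p ∉ S k := fun k hk hp => h ⟨k, hk, hp⟩
    rw [Finset.sum_eq_zero fun k hk =>
      Set.indicator_of_notMem (h' k (Finset.mem_range.1 hk).le) _, h0, Finset.sum_eq_zero]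
    exact fun j hj => Set.indicator_of_notMem
      (fun hp => h' (j + 1) (Finset.mem_range.1 hj) hp.1) _

end

/-! ### Integrals of functions of the kernel. -/

section

variable {a : ℝ → ℝ} {Δ : ℝ} {M : ℕ} {v : ℕ → ℝ} {Φ : ℝ → ℂ}

/-- The kernel is constant on each shell `S (j+1) \ S j`, equal to the sum of the weights from `j +
1` on. The area of the shell is `∫ a` over `(Δj, Δ(j+1)]`, where `⌈s/Δ⌉ = j + 1`. -/
lemma IsTrawlFunction.integral_trawlKernel_nonpos (ha : IsTrawlFunction a) (hΔ : 0 < Δ)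
    (h0 : Φ 0 = 0) :
    ∫ p in {p : ℝ × ℝ | p.1 ≤ 0}, Φ (trawlKernel a Δ M v p)
      = ∫ s in (0 : ℝ)..Δ * M, (trawlExt a s : ℂ) * Φ (∑ k ∈ Finset.Ico ⌈s / Δ⌉₊ M, v k) := by
  set S : ℕ → Set (ℝ × ℝ) := fun k => trawlSetAt a 0 \ trawlSetAt a (Δ * k) with hS
  have hmono : Monotone S := fun i j hij =>
    ha.trawlSetAt_zero_diff_mono (by positivity) (by gcongr)
  have hS0 : S 0 = ∅ := by simp [S]
  have hSm : ∀ k, MeasurableSet (S k) := fun k =>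
    (ha.measurableSet_trawlSetAt _).diff (ha.measurableSet_trawlSetAt _)
  have hSf : ∀ k, volume (S k) ≠ ∞ := fun k =>
    ne_top_of_le_ne_top (ha.volume_trawlSetAt_ne_top 0) (measure_mono Set.sdiff_subset)
  have hms : MeasurableSet {p : ℝ × ℝ | p.1 ≤ 0} := measurableSet_le measurable_fst measurable_const
  have hint : ∀ x y, IntervalIntegrable (trawlExt a) volume x y :=
    fun x y => ha.continuous_ext.intervalIntegrable x y
  have hvol : ∀ j : ℕ, volume.real (S (j + 1) \ S j)
      = ∫ s in Δ * j..Δ * (j + 1 : ℕ), trawlExt a s := fun j => by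
    rw [measureReal_sdiff (hmono (Nat.le_succ j)) (hSm j) (h₁ := hSf _),
      ha.measureReal_trawlSetAt_zero_diff (by positivity),
      ha.measureReal_trawlSetAt_zero_diff (by positivity),
      intervalIntegral.integral_interval_sub_left (hint _ _) (hint _ _)]
  have e1 : ∀ p ∈ {p : ℝ × ℝ | p.1 ≤ 0}, Φ (trawlKernel a Δ M v p)
      = ∑ j ∈ Finset.range M,
        (S (j + 1) \ S j).indicator (fun _ => Φ (∑ k ∈ Finset.Ico (j + 1) M, v k)) p := by
    intro p hp
    rw [ha.trawlKernel_of_nonpos hΔ.le hp, comp_sum_indicator_of_monotone hmono hS0 h0]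
  rw [setIntegral_congr_fun hms e1, integral_finsetSum]
  · have e2 : ∀ j ∈ Finset.range M,
        ∫ p in {p : ℝ × ℝ | p.1 ≤ 0},
          (S (j + 1) \ S j).indicator (fun _ => Φ (∑ k ∈ Finset.Ico (j + 1) M, v k)) p
        = ∫ s in Δ * j..Δ * (j + 1 : ℕ),
          (trawlExt a s : ℂ) * Φ (∑ k ∈ Finset.Ico ⌈s / Δ⌉₊ M, v k) := by
      intro j _
      rw [setIntegral_indicator ((hSm _).diff (hSm _)), Set.inter_eq_right.2, setIntegral_const,
        hvol, Complex.real_smul, ← intervalIntegral.integral_ofReal,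
        ← intervalIntegral.integral_mul_const]
      · refine intervalIntegral.integral_congr_ae (ae_of_all _ fun s hs => ?_)
        rw [Set.uIoc_of_le (by gcongr; simp)] at hs
        have : ⌈s / Δ⌉₊ = j + 1 := by
          rw [Nat.ceil_eq_iff (Nat.succ_ne_zero j), lt_div_iff₀' hΔ, div_le_iff₀' hΔ]
          simpa using hs
        rw [this]
      · exact fun p hp => (mem_trawlSetAt.1 hp.1.1).1
    rw [Finset.sum_congr rfl e2, intervalIntegral.sum_integral_adjacent_intervals
      (a := fun j : ℕ => Δ * j)]
    · simp
    · intro j _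
      have h1 : IntervalIntegrable
          (fun s => (trawlExt a s : ℂ) * Φ (∑ k ∈ Finset.Ico (j + 1) M, v k)) volume
          (Δ * j) (Δ * (j + 1 : ℕ)) := by
        have := Complex.continuous_ofReal.comp ha.continuous_ext
        exact (this.mul continuous_const).intervalIntegrable _ _
      refine h1.congr_ae ?_
      filter_upwards [ae_restrict_mem measurableSet_uIoc] with s hs
      rw [Set.uIoc_of_le (by gcongr; simp)] at hs
      have : ⌈s / Δ⌉₊ = j + 1 := by
        rw [Nat.ceil_eq_iff (Nat.succ_ne_zero j), lt_div_iff₀' hΔ, div_le_iff₀' hΔ]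
        simpa using hs
      rw [this]
  · intro j _
    exact ((integrable_indicator_iff ((hSm _).diff (hSm _))).2
      (integrableOn_const (ne_top_of_le_ne_top (hSf _) (measure_mono Set.sdiff_subset)))).integrableOn

lemma IsTrawlFunction.trawlKernel_eq_zero_of_pos (ha : IsTrawlFunction a) (hΔ : 0 < Δ)
    {p : ℝ × ℝ} (hp : 0 < p.1) (h : Δ * M < p.1 ∨ p.2 ∉ Set.Icc 0 (a 0)) :
    trawlKernel a Δ M v p = 0 := by
  rw [trawlKernel_of_pos hp, neg_eq_zero]
  refine Finset.sum_eq_zero fun k hk => Set.indicator_of_notMem (fun hpk => ?_) _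
  rw [mem_trawlSetAt] at hpk
  rcases h with h | h
  · have : Δ * k ≤ Δ * M := by
      gcongr
      exact (Finset.mem_range.1 hk).le
    linarith [hpk.1]
  · exact h ⟨hpk.2.1, hpk.2.2.trans (ha.ext_le _)⟩

lemma IsTrawlFunction.integral_trawlKernel_pos (ha : IsTrawlFunction a) (hΔ : 0 < Δ)
    (h0 : Φ 0 = 0) (hint : Integrable (fun p => Φ (trawlKernel a Δ M v p))) :
    ∫ p in {p : ℝ × ℝ | p.1 ≤ 0}ᶜ, Φ (trawlKernel a Δ M v p)
      = ∫ r in (0 : ℝ)..Δ * M, ∫ y in Set.Icc 0 (a 0), Φ (trawlKernel a Δ M v (r, y)) := by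
  have e1 : {p : ℝ × ℝ | p.1 ≤ 0}ᶜ = Set.Ioi 0 ×ˢ Set.univ := by
    ext p
    simp
  rw [e1, Measure.volume_eq_prod, setIntegral_prod _ (by
    rw [← Measure.volume_eq_prod]; exact hint.integrableOn),
    intervalIntegral.integral_of_le (by positivity)]
  simp only [Measure.restrict_univ]
  have hinner : ∀ r ∈ Set.Ioi (0 : ℝ), ∫ y, Φ (trawlKernel a Δ M v (r, y))
      = (Set.Ioc 0 (Δ * M)).indicator
        (fun r => ∫ y in Set.Icc 0 (a 0), Φ (trawlKernel a Δ M v (r, y))) r := by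
    intro r hr
    by_cases hr' : r ∈ Set.Ioc 0 (Δ * M)
    · rw [Set.indicator_of_mem hr']
      refine (setIntegral_eq_integral_of_forall_compl_eq_zero fun y hy => ?_).symm
      rw [ha.trawlKernel_eq_zero_of_pos hΔ (p := (r, y)) hr (Or.inr hy), h0]
    · rw [Set.indicator_of_notMem hr']
      refine integral_eq_zero_of_ae (ae_of_all _ fun y => ?_)
      have : Δ * M < r := lt_of_not_ge fun h => hr' ⟨hr, h⟩
      simp only [Pi.zero_apply]
      rw [ha.trawlKernel_eq_zero_of_pos hΔ (p := (r, y)) hr (Or.inl this), h0]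
  rw [setIntegral_congr_fun measurableSet_Ioi hinner, setIntegral_indicator measurableSet_Ioc,
    Set.inter_eq_right.2 Set.Ioc_subset_Ioi_self]

lemma exists_bound_of_abs_le (hΦ : Continuous Φ) (B : ℝ) : ∃ C, ∀ z, |z| ≤ B → ‖Φ z‖ ≤ C := by
  obtain ⟨C, hC⟩ := (isCompact_Icc (a := -B) (b := B)).exists_bound_of_continuousOn
    hΦ.continuousOn
  exact ⟨C, fun z hz => hC z (abs_le.1 hz)⟩

lemma abs_sum_Ico_le (j : ℕ) : |∑ k ∈ Finset.Ico j M, v k| ≤ ∑ k ∈ Finset.range M, |v k| :=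
  (Finset.abs_sum_le_sum_abs _ _).trans (Finset.sum_le_sum_of_subset_of_nonneg
    (fun _ hk => Finset.mem_range.2 (Finset.mem_Ico.1 hk).2) fun _ _ _ => abs_nonneg _)

/-- The slice at the rescaled time `x` of the integral of `Φ` along the kernel. -/
def trawlSlice (a : ℝ → ℝ) (Δ : ℝ) (M : ℕ) (v : ℕ → ℝ) (Φ : ℝ → ℂ) (ε x : ℝ) : ℂ :=
  (trawlExt a (ε * x) : ℂ) * Φ (∑ k ∈ Finset.Ico ⌈ε * x / Δ⌉₊ M, v k)
    + ∫ y in Set.Icc 0 (a 0), Φ (trawlKernel a Δ M v (ε * x, y))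

lemma IsTrawlFunction.measurable_left (ha : IsTrawlFunction a) :
    Measurable fun s => (trawlExt a s : ℂ) * Φ (∑ k ∈ Finset.Ico ⌈s / Δ⌉₊ M, v k) := by
  have h1 := ha.continuous_ext.measurable
  have h2 : Measurable fun j : ℕ => Φ (∑ k ∈ Finset.Ico j M, v k) := measurable_of_countable _
  have h3 : Measurable fun s : ℝ => ⌈s / Δ⌉₊ := Nat.measurable_ceil.comp (by fun_prop)
  exact (Complex.measurable_ofReal.comp h1).mul (h2.comp h3)

lemma IsTrawlFunction.measurable_right (ha : IsTrawlFunction a) (hΦ : Continuous Φ) :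
    Measurable fun r => ∫ y in Set.Icc 0 (a 0), Φ (trawlKernel a Δ M v (r, y)) := by
  have : StronglyMeasurable (fun p => Φ (trawlKernel a Δ M v p)) :=
    (hΦ.measurable.comp ha.measurable_trawlKernel).stronglyMeasurable
  exact (this.integral_prod_right (ν := volume.restrict (Set.Icc 0 (a 0)))).measurable

lemma IsTrawlFunction.measurable_trawlSlice (ha : IsTrawlFunction a) (hΦ : Continuous Φ) (ε : ℝ) :
    Measurable (trawlSlice a Δ M v Φ ε) :=
  (ha.measurable_left.add (ha.measurable_right hΦ)).comp (measurable_const_mul ε)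

lemma IsTrawlFunction.norm_left_le (ha : IsTrawlFunction a) {C : ℝ}
    (hC : ∀ z, |z| ≤ ∑ k ∈ Finset.range M, |v k| → ‖Φ z‖ ≤ C) (s : ℝ) :
    ‖(trawlExt a s : ℂ) * Φ (∑ k ∈ Finset.Ico ⌈s / Δ⌉₊ M, v k)‖ ≤ a 0 * C := by
  rw [norm_mul, Complex.norm_real, Real.norm_eq_abs, abs_of_nonneg (ha.ext_nonneg s)]
  exact mul_le_mul (ha.ext_le s) (hC _ (abs_sum_Ico_le _)) (norm_nonneg _) (ha.nonneg 0 le_rfl)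

lemma IsTrawlFunction.norm_right_le (ha : IsTrawlFunction a) {C : ℝ}
    (hC : ∀ z, |z| ≤ ∑ k ∈ Finset.range M, |v k| → ‖Φ z‖ ≤ C) (r : ℝ) :
    ‖∫ y in Set.Icc 0 (a 0), Φ (trawlKernel a Δ M v (r, y))‖ ≤ a 0 * C := by
  refine (norm_setIntegral_le_of_norm_le_const (by simp)
    fun y _ => hC _ (abs_trawlKernel_le _)).trans_eq ?_
  rw [measureReal_def, Real.volume_Icc, sub_zero, ENNReal.toReal_ofReal (ha.nonneg 0 le_rfl),
    mul_comm]

/-- Both halves of the plane are parametrised by the same variable `s = εx`, so that the imaginary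
parts can cancel slice by slice before any limit is taken. -/
lemma IsTrawlFunction.integral_comp_trawlKernel (ha : IsTrawlFunction a) (hΔ : 0 < Δ)
    (hΦ : Continuous Φ) (h0 : Φ 0 = 0) (hint : Integrable (fun p => Φ (trawlKernel a Δ M v p)))
    {ε T : ℝ} (hε : Δ * M = ε * T) :
    ∫ p, Φ (trawlKernel a Δ M v p) = ∫ x in (0 : ℝ)..T, ε * trawlSlice a Δ M v Φ ε x := by
  have hms : MeasurableSet {p : ℝ × ℝ | p.1 ≤ 0} := measurableSet_le measurable_fst measurable_const
  obtain ⟨C, hC⟩ := exists_bound_of_abs_le hΦ (∑ k ∈ Finset.range M, |v k|)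
  have i1 : IntervalIntegrable
      (fun s => (trawlExt a s : ℂ) * Φ (∑ k ∈ Finset.Ico ⌈s / Δ⌉₊ M, v k)) volume 0 (ε * T) :=
    (intervalIntegrable_const (c := a 0 * C)).mono_fun ha.measurable_left.aestronglyMeasurable
      (ae_of_all _ fun s => (ha.norm_left_le hC s).trans (le_abs_self _))
  have i2 : IntervalIntegrable
      (fun r => ∫ y in Set.Icc 0 (a 0), Φ (trawlKernel a Δ M v (r, y))) volume 0 (ε * T) :=
    (intervalIntegrable_const (c := a 0 * C)).mono_fun
      (ha.measurable_right hΦ).aestronglyMeasurable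
      (ae_of_all _ fun s => (ha.norm_right_le hC s).trans (le_abs_self _))
  rw [← integral_add_compl hms hint, ha.integral_trawlKernel_nonpos hΔ h0,
    ha.integral_trawlKernel_pos hΔ h0 hint, hε, ← intervalIntegral.integral_add i1 i2,
    intervalIntegral.integral_const_mul]
  have := intervalIntegral.smul_integral_comp_mul_left (a := 0) (b := T)
    (fun s => (trawlExt a s : ℂ) * Φ (∑ k ∈ Finset.Ico ⌈s / Δ⌉₊ M, v k)
      + ∫ y in Set.Icc 0 (a 0), Φ (trawlKernel a Δ M v (s, y))) ε
  rw [mul_zero] at this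
  rw [← this, Complex.real_smul]
  rfl

/-- Each side of the axis contributes at most `a(0) · ΔM`. With `M = nT` this tends to `0`, which is
the source of the mixing. -/
lemma IsTrawlFunction.measure_support_trawlKernel_le (ha : IsTrawlFunction a) (hΔ : 0 < Δ) :
    volume {p | trawlKernel a Δ M v p ≠ 0} ≤ ENNReal.ofReal (2 * a 0 * (Δ * M)) := by
  have hsub : {p | trawlKernel a Δ M v p ≠ 0}
      ⊆ (trawlSetAt a 0 \ trawlSetAt a (Δ * M)) ∪ Set.Ioc 0 (Δ * M) ×ˢ Set.Icc 0 (a 0) := by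
    intro p hp
    rcases le_or_gt p.1 0 with h | h
    · left
      by_contra hn
      refine hp ?_
      rw [ha.trawlKernel_of_nonpos hΔ.le h]
      refine Finset.sum_eq_zero fun k hk => Set.indicator_of_notMem (fun hpk => hn ?_) _
      refine ha.trawlSetAt_zero_diff_mono (by positivity) ?_ hpk
      gcongr
      exact (Finset.mem_range.1 hk).le
    · right
      by_contra hn
      refine hp (ha.trawlKernel_eq_zero_of_pos hΔ h ?_)
      by_contra hcon
      rw [not_or, not_lt, not_not] at hcon
      exact hn ⟨⟨h, hcon.1⟩, hcon.2⟩
  refine (measure_mono hsub).trans ((measure_union_le _ _).trans ?_)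
  have hM : 0 ≤ Δ * M := by positivity
  have h1 : volume (trawlSetAt a 0 \ trawlSetAt a (Δ * M)) ≤ ENNReal.ofReal (a 0 * (Δ * M)) := by
    rw [← ofReal_measureReal (ne_top_of_le_ne_top (ha.volume_trawlSetAt_ne_top 0)
      (measure_mono Set.sdiff_subset)), ha.measureReal_trawlSetAt_zero_diff hM]
    refine ENNReal.ofReal_le_ofReal ?_
    refine (intervalIntegral.integral_mono_on hM (ha.continuous_ext.intervalIntegrable _ _)
      (intervalIntegrable_const (c := a 0)) fun s _ => ha.ext_le s).trans_eq ?_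
    simp [mul_comm]
  have h2 : volume (Set.Ioc 0 (Δ * M) ×ˢ Set.Icc 0 (a 0)) = ENNReal.ofReal (a 0 * (Δ * M)) := by
    rw [Measure.volume_eq_prod, Measure.prod_prod, Real.volume_Ioc, Real.volume_Icc, sub_zero,
      sub_zero, ← ENNReal.ofReal_mul hM, mul_comm]
  rw [h2]
  refine (add_le_add_left h1 _).trans_eq ?_
  have := ha.nonneg 0 le_rfl
  rw [← ENNReal.ofReal_add (by positivity) (by positivity)]
  congr 1
  ring

end

/-! ### The limit of the characteristic exponents -/

/-- `x ↦ ∑_l θ_l (u_l - x)⁺`. -/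
def ramp {q : ℕ} (θ : Fin q → ℝ) (u : Fin q → ℝ≥0) (x : ℝ) : ℝ :=
  ∑ l, θ l * max ((u l : ℝ) - x) 0

lemma continuous_ramp {q : ℕ} (θ : Fin q → ℝ) (u : Fin q → ℝ≥0) : Continuous (ramp θ u) := by
  unfold ramp
  fun_prop

/-- The discretisation of `ramp`. -/
def discreteRamp {q : ℕ} (θ : Fin q → ℝ) (u : Fin q → ℝ≥0) (n j : ℕ) : ℝ :=
  -- The truncated subtraction of `ℕ` plays the role of the positive part in `ramp`.
  ∑ l, θ l * (((⌊(n : ℝ) * (u l : ℝ)⌋₊ - j : ℕ) : ℝ) / n)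

/-- The weights of the linear combinations of partial sums, scaled by `s`. -/
def trawlWeight {q : ℕ} (s : ℝ) (θ : Fin q → ℝ) (u : Fin q → ℝ≥0) (n k : ℕ) : ℝ :=
  ∑ l, s * θ l / n * (if k < ⌊(n : ℝ) * (u l : ℝ)⌋₊ then 1 else 0)

section

variable {q : ℕ} {θ : Fin q → ℝ} {u : Fin q → ℝ≥0} {T : ℕ}

lemma floor_mul_le (hT : ∀ l, (u l : ℝ) ≤ T) (n : ℕ) (l : Fin q) :
    ⌊(n : ℝ) * (u l : ℝ)⌋₊ ≤ n * T := by
  refine Nat.floor_le_of_le ?_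
  push_cast
  exact mul_le_mul_of_nonneg_left (hT l) (Nat.cast_nonneg n)

lemma sum_Ico_trawlWeight (hT : ∀ l, (u l : ℝ) ≤ T) (s : ℝ) (n j : ℕ) :
    ∑ k ∈ Finset.Ico j (n * T), trawlWeight s θ u n k = s * discreteRamp θ u n j := by
  unfold trawlWeight discreteRamp
  rw [Finset.sum_comm, Finset.mul_sum]
  refine Finset.sum_congr rfl fun l _ => ?_
  rw [← Finset.mul_sum, Finset.sum_boole]
  have : Finset.filter (fun k => k < ⌊(n : ℝ) * (u l : ℝ)⌋₊) (Finset.Ico j (n * T))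
      = Finset.Ico j ⌊(n : ℝ) * (u l : ℝ)⌋₊ := by
    ext k
    have := floor_mul_le hT n l
    simp only [Finset.mem_filter, Finset.mem_Ico]
    omega
  rw [this, Nat.card_Ico]
  ring

lemma sum_abs_trawlWeight_le (hT : ∀ l, (u l : ℝ) ≤ T) (s : ℝ) (n : ℕ) :
    ∑ k ∈ Finset.range (n * T), |trawlWeight s θ u n k| ≤ |s| * ∑ l, |θ l| * u l := by
  have h1 : ∀ k, |trawlWeight s θ u n k| ≤ trawlWeight |s| (fun l => |θ l|) u n k := by
    intro k
    refine (Finset.abs_sum_le_sum_abs _ _).trans (Finset.sum_le_sum fun l _ => ?_)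
    rw [abs_mul, abs_div, abs_mul, Nat.abs_cast]
    split_ifs <;> simp
  refine (Finset.sum_le_sum fun k _ => h1 k).trans ?_
  have h2 := sum_Ico_trawlWeight (θ := fun l => |θ l|) hT |s| n 0
  rw [Nat.Ico_zero_eq_range] at h2
  rw [h2]
  refine mul_le_mul_of_nonneg_left (Finset.sum_le_sum fun l _ => ?_) (abs_nonneg s)
  refine mul_le_mul_of_nonneg_left ?_ (abs_nonneg _)
  rcases Nat.eq_zero_or_pos n with rfl | hn
  · simp
  · rw [div_le_iff₀ (by positivity), Nat.sub_zero, mul_comm]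
    exact Nat.floor_le (by positivity)

lemma tendsto_discreteRamp {x : ℝ} (hx : 0 ≤ x) :
    Tendsto (fun n : ℕ => discreteRamp θ u n ⌈(n : ℝ) * x⌉₊) atTop (𝓝 (ramp θ u x)) := by
  refine tendsto_finsetSum _ fun l _ => Tendsto.const_mul _ ?_
  have h1 : Tendsto (fun n : ℕ => (⌊(u l : ℝ) * (n : ℝ)⌋₊ : ℝ) / n) atTop (𝓝 (u l : ℝ)) :=
    (tendsto_nat_floor_mul_div_atTop (R := ℝ) (u l).2).comp tendsto_natCast_atTop_atTop
  have h2 : Tendsto (fun n : ℕ => (⌈x * (n : ℝ)⌉₊ : ℝ) / n) atTop (𝓝 x) :=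
    (tendsto_nat_ceil_mul_div_atTop (R := ℝ) hx).comp tendsto_natCast_atTop_atTop
  refine ((h1.sub h2).max tendsto_const_nhds).congr' ?_
  filter_upwards [eventually_gt_atTop 0] with n hn
  have hn' : (0 : ℝ) < n := by exact_mod_cast hn
  rw [mul_comm (u l : ℝ), mul_comm x, ← sub_div]
  rcases le_total ⌈(n : ℝ) * x⌉₊ ⌊(n : ℝ) * (u l : ℝ)⌋₊ with h | h
  · have h' : (⌈(n : ℝ) * x⌉₊ : ℝ) ≤ ⌊(n : ℝ) * (u l : ℝ)⌋₊ := by exact_mod_cast h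
    rw [Nat.cast_sub h, max_eq_left]
    exact div_nonneg (sub_nonneg.2 h') hn'.le
  · have h' : (⌊(n : ℝ) * (u l : ℝ)⌋₊ : ℝ) ≤ ⌈(n : ℝ) * x⌉₊ := by exact_mod_cast h
    rw [Nat.sub_eq_zero_of_le h, max_eq_right]
    · simp
    · exact div_nonpos_of_nonpos_of_nonneg (sub_nonpos.2 h') hn'.le

end

/-! ### Rescaling of stable-like exponents. -/

section

variable {Ψ : ℝ → ℂ} {β c κ : ℝ}

lemma abs_inv_rpow_mul_rpow (hβ : 0 < β) {ε : ℝ} (hε : 0 < ε) (z : ℝ) :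
    |1 / ε ^ (1 / β) * z| ^ β = |z| ^ β / ε := by
  have h1 : 0 < ε ^ (1 / β) := by positivity
  rw [abs_mul, Real.mul_rpow (abs_nonneg _) (abs_nonneg _), abs_of_pos (by positivity),
    Real.div_rpow zero_le_one h1.le, Real.one_rpow, ← Real.rpow_mul hε.le, one_div_mul_cancel hβ.ne',
    Real.rpow_one]
  ring

/-- The factor `ε` offsets `(ε^{-1/β})^β`, so the bound is uniform in `ε`; it supplies the
domination for the passage to the limit. -/
lemma IsStableLike.exists_scaled_bound (hΨ : IsStableLike Ψ β c κ) (hβ : 0 < β) (G : ℝ) :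
    ∃ C, ∀ ε : ℝ, 0 < ε → ε ≤ 1 → ∀ z, |z| ≤ |1 / ε ^ (1 / β)| * G →
      ‖(ε : ℂ) * (Ψ z - Complex.I * c * z)‖ ≤ C := by
  obtain ⟨C, hC⟩ := hΨ.bound
  have hC0 : 0 ≤ C := by
    have h := (norm_nonneg _).trans (hC 0)
    rw [abs_zero, Real.zero_rpow hβ.ne'] at h
    linarith
  refine ⟨C * (1 + |G| ^ β), fun ε hε hε1 z hz => ?_⟩
  have h1 : |z| ^ β ≤ |G| ^ β / ε := by
    rw [← abs_inv_rpow_mul_rpow hβ hε, abs_mul]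
    refine Real.rpow_le_rpow (abs_nonneg _) (hz.trans ?_) hβ.le
    gcongr
    exact le_abs_self G
  rw [norm_mul, Complex.norm_real, Real.norm_eq_abs, abs_of_pos hε]
  calc ε * ‖Ψ z - Complex.I * c * z‖ ≤ ε * (C * (1 + |G| ^ β / ε)) := by
        gcongr
        exact (hC z).trans (by gcongr)
    _ = C * (ε + |G| ^ β) := by field_simp
    _ ≤ _ := by gcongr

lemma IsStableLike.tendsto_scaled_re (hΨ : IsStableLike Ψ β c κ) (hβ : 0 < β) {ε z : ℕ → ℝ}
    {z₀ : ℝ} (hε : ∀ᶠ n in atTop, 0 < ε n) (hε0 : Tendsto ε atTop (𝓝 0))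
    (hz : Tendsto z atTop (𝓝 z₀)) :
    Tendsto (fun n => ε n * (Ψ (1 / ε n ^ (1 / β) * z n)).re) atTop (𝓝 (-(κ * |z₀| ^ β))) := by
  have hz' : Tendsto (fun n => |z n| ^ β) atTop (𝓝 (|z₀| ^ β)) :=
    hz.abs.rpow_const (Or.inr hβ.le)
  have h1 : Tendsto (fun n => ε n * (Ψ (1 / ε n ^ (1 / β) * z n)).re + κ * |z n| ^ β) atTop
      (𝓝 0) := by
    rw [Metric.tendsto_atTop']
    intro η hη
    -- After multiplication by `ε` the relative error becomes `η/2` times `|z n|^β / (|z₀|^β + 1)`,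
    -- eventually at most `η/2`, while the additive constant becomes `εC`.
    obtain ⟨C, hC⟩ := hΨ.re_asymp (η / (2 * (|z₀| ^ β + 1))) (by positivity)
    have h2 : ∀ᶠ n in atTop, |z n| ^ β < |z₀| ^ β + 1 := hz'.eventually_lt_const (by linarith)
    have h3 : ∀ᶠ n in atTop, ε n * C < η / 2 := by
      have : Tendsto (fun n => ε n * C) atTop (𝓝 0) := by simpa using hε0.mul_const C
      exact this.eventually_lt_const (half_pos hη)
    obtain ⟨N, hN⟩ := eventually_atTop.1 (hε.and (h2.and h3))
    refine ⟨N, fun n hn => ?_⟩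
    obtain ⟨a1, a2, a3⟩ := hN n hn.le
    have a4 := hC (1 / ε n ^ (1 / β) * z n)
    rw [abs_inv_rpow_mul_rpow hβ a1] at a4
    rw [Real.dist_eq, sub_zero]
    have e : ε n * (Ψ (1 / ε n ^ (1 / β) * z n)).re + κ * |z n| ^ β
        = ε n * ((Ψ (1 / ε n ^ (1 / β) * z n)).re + κ * (|z n| ^ β / ε n)) := by
      field_simp
    rw [e, abs_mul, abs_of_pos a1]
    calc _ ≤ ε n * (η / (2 * (|z₀| ^ β + 1)) * (|z n| ^ β / ε n) + C) := by gcongr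
      _ = η / 2 * (|z n| ^ β / (|z₀| ^ β + 1)) + ε n * C := by field_simp
      _ < η / 2 * 1 + η / 2 := by
        refine add_lt_add_of_le_of_lt ?_ a3
        gcongr
        exact (div_le_one (by positivity)).2 a2.le
      _ = η := by ring
  have h2 := h1.sub (hz'.const_mul κ)
  rw [zero_sub] at h2
  exact h2.congr fun n => by ring

end

/-! ### Convergence of the exponents along the scaled kernels. -/

section

variable {a : ℝ → ℝ} {Δ : ℕ → ℝ} {Ψ : ℝ → ℂ} {β c κ : ℝ} {q : ℕ} {θ : Fin q → ℝ}
  {u : Fin q → ℝ≥0} {T : ℕ}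

/-- The scaled kernel of the linear combination `∑_l θ_l Z^n_{u_l}`. -/
def scaledKernel (a : ℝ → ℝ) (Δ : ℕ → ℝ) (β : ℝ) (θ : Fin q → ℝ) (u : Fin q → ℝ≥0) (T n : ℕ) :
    ℝ × ℝ → ℝ :=
  trawlKernel a (Δ n) (n * T) (trawlWeight (1 / ((n : ℝ) * Δ n) ^ (1 / β)) θ u n)

/-- On the strip to the right of `0`, the kernel is eventually the ramp. -/
lemma IsTrawlFunction.eventually_scaledKernel_eq (ha : IsTrawlFunction a)
    (hΔ : ∀ n, 1 ≤ n → 0 < Δ n) (hΔ0 : Tendsto (fun n : ℕ => (n : ℝ) * Δ n) atTop (𝓝 0))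
    (hT : ∀ l, (u l : ℝ) ≤ T) {x y : ℝ} (hx : 0 < x) (hy0 : 0 ≤ y) (hy : y < a 0) :
    ∀ᶠ n : ℕ in atTop, scaledKernel a Δ β θ u T n ((n : ℝ) * Δ n * x, y)
      = -(1 / ((n : ℝ) * Δ n) ^ (1 / β) * discreteRamp θ u n ⌈(n : ℝ) * x⌉₊) := by
  have h1 : Tendsto (fun n : ℕ => trawlExt a ((n : ℝ) * Δ n * T)) atTop (𝓝 (a 0)) := by
    rw [show a 0 = trawlExt a 0 by simp [trawlExt]]
    exact (ha.continuous_ext.tendsto 0).comp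
      (by simpa using hΔ0.mul_const (T : ℝ) : Tendsto (fun n : ℕ => (n : ℝ) * Δ n * T) atTop (𝓝 0))
  filter_upwards [h1.eventually_const_lt hy, eventually_ge_atTop 1] with n h2 hn
  have hn' : (0 : ℝ) < n := by exact_mod_cast hn
  have hΔn := hΔ n hn
  rw [scaledKernel, trawlKernel_of_pos (by positivity), ← sum_Ico_trawlWeight hT]
  congr 1
  -- The point lies in `A_{Δk}` exactly when `k ≥ nx`: the height condition holds automatically,
  -- since `y < a(nΔT)` and `a` is non-increasing.
  rw [← Finset.sum_subset (s₁ := Finset.Ico ⌈(n : ℝ) * x⌉₊ (n * T))]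
  · refine Finset.sum_congr rfl fun k hk => Set.indicator_of_mem ?_ _
    obtain ⟨k1, k2⟩ := Finset.mem_Ico.1 hk
    rw [Nat.ceil_le] at k1
    have k3 : (k : ℝ) ≤ n * T := by exact_mod_cast k2.le
    rw [mem_trawlSetAt]
    refine ⟨by nlinarith, hy0, h2.le.trans (ha.antitone_ext ?_)⟩
    have : 0 < (n : ℝ) * Δ n * x := by positivity
    simp only
    nlinarith
  · intro k hk
    exact Finset.mem_range.2 (Finset.mem_Ico.1 hk).2
  · intro k hk hk'
    refine Set.indicator_of_notMem (fun hp => hk' ?_) _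
    rw [mem_trawlSetAt] at hp
    refine Finset.mem_Ico.2 ⟨Nat.ceil_le.2 ?_, Finset.mem_range.1 hk⟩
    have := hp.1
    simp only at this
    by_contra hlt
    nlinarith

/-- After removal of the drift, which integrates to `0`, the left side contributes `Φ(w)` and the
right side eventually `Φ(-w)` at almost every height. Their sum is `2 Re Ψ(w)`, which has a scaled
limit, whereas the imaginary part of `Φ` is only known to be bounded. -/
lemma IsTrawlFunction.tendsto_integral_scaledKernel (ha : IsTrawlFunction a)
    (hΔ : ∀ n, 1 ≤ n → 0 < Δ n) (hΔ0 : Tendsto (fun n : ℕ => (n : ℝ) * Δ n) atTop (𝓝 0))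
    (hβ : 0 < β) (hΨc : Continuous Ψ) (hΨ0 : Ψ 0 = 0)
    (hneg : ∀ z, Ψ (-z) = starRingEnd ℂ (Ψ z)) (hΨ : IsStableLike Ψ β c κ)
    (hT : ∀ l, (u l : ℝ) ≤ T)
    (hint : ∀ (n : ℕ) (Φ : ℝ → ℂ), Φ 0 = 0 →
      Integrable (fun p => Φ (scaledKernel a Δ β θ u T n p))) :
    Tendsto (fun n => ∫ p, Ψ (scaledKernel a Δ β θ u T n p)) atTop
      (𝓝 ((∫ x in (0 : ℝ)..T, -(2 * κ * a 0 * |ramp θ u x| ^ β) : ℝ) : ℂ)) := by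
  set Φ : ℝ → ℂ := fun z => Ψ z - Complex.I * c * z with hΦ
  have hΦc : Continuous Φ := by fun_prop
  have hΦ0 : Φ 0 = 0 := by simp [Φ, hΨ0]
  have hΦneg : ∀ z, Φ z + Φ (-z) = ((2 * (Ψ z).re : ℝ) : ℂ) := by
    intro z
    simp only [Φ, hneg]
    have := Complex.add_conj (Ψ z)
    push_cast at this ⊢
    rw [← this]
    ring
  set ε : ℕ → ℝ := fun n => (n : ℝ) * Δ n with hε
  have hεpos : ∀ᶠ n in atTop, 0 < ε n := by
    filter_upwards [eventually_ge_atTop 1] with n hn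
    have : (0 : ℝ) < n := by exact_mod_cast hn
    exact mul_pos this (hΔ n hn)
  have hεle : ∀ᶠ n in atTop, ε n ≤ 1 := hΔ0.eventually_le_const zero_lt_one
  set s : ℕ → ℝ := fun n => 1 / ε n ^ (1 / β) with hs
  set v : ℕ → ℕ → ℝ := fun n => trawlWeight (s n) θ u n with hv
  obtain ⟨C, hC⟩ := hΨ.exists_scaled_bound hβ (∑ l, |θ l| * u l)
  have ha0 := ha.nonneg 0 le_rfl
  have hCn : ∀ᶠ n in atTop, ∀ z, |z| ≤ ∑ k ∈ Finset.range (n * T), |v n k| →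
      ‖(ε n : ℂ) * Φ z‖ ≤ C := by
    filter_upwards [hεpos, hεle] with n h1 h2 z hz
    exact hC (ε n) h1 h2 z (hz.trans (sum_abs_trawlWeight_le hT _ n))
  have hW : ∀ᶠ n : ℕ in atTop, ∀ j, ‖(ε n : ℂ) * Φ (s n * discreteRamp θ u n j)‖ ≤ C := by
    filter_upwards [hCn] with n h1 j
    refine h1 _ ?_
    rw [← sum_Ico_trawlWeight hT]
    exact abs_sum_Ico_le j
  have hC0 : 0 ≤ C := by
    obtain ⟨n, hn⟩ := hW.exists
    exact (norm_nonneg _).trans (hn 0)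
  have hE : ∀ᶠ n : ℕ in atTop, ∫ x in (0 : ℝ)..T,
      (ε n : ℂ) * trawlSlice a (Δ n) (n * T) (v n) Φ (ε n) x
      = ∫ p, Ψ (scaledKernel a Δ β θ u T n p) := by
    filter_upwards [eventually_ge_atTop 1] with n hn
    have h1 := ha.integral_comp_trawlKernel (hΔ n hn) hΦc hΦ0 (M := n * T) (v := v n)
      (hint n Φ hΦ0) (ε := ε n) (T := T) (by push_cast; simp only [hε]; ring)
    have i1 := hint n Ψ hΨ0
    have i2 := hint n (fun z => Complex.I * c * z) (by simp)
    have h2 : ∫ p, Φ (scaledKernel a Δ β θ u T n p) = ∫ p, Ψ (scaledKernel a Δ β θ u T n p) := by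
      simp only [Φ]
      rw [integral_sub i1 i2, integral_const_mul, integral_complex_ofReal]
      simp only [scaledKernel]
      rw [ha.integral_trawlKernel]
      simp
    rw [← h1, ← h2]
    rfl
  refine Tendsto.congr' hE ?_
  rw [← intervalIntegral.integral_ofReal]
  refine intervalIntegral.tendsto_integral_filter_of_dominated_convergence
    (fun _ => a 0 * C + a 0 * C) ?_ ?_ intervalIntegrable_const ?_
  · exact Eventually.of_forall fun n =>
      ((ha.measurable_trawlSlice hΦc _).const_mul _).aestronglyMeasurable
  · filter_upwards [hCn] with n h1
    refine ae_of_all _ fun x _ => ?_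
    rw [trawlSlice, mul_add, mul_left_comm, ← integral_const_mul]
    exact (norm_add_le _ _).trans (add_le_add
      (ha.norm_left_le (Φ := fun z => (ε n : ℂ) * Φ z) h1 _)
      (ha.norm_right_le (Φ := fun z => (ε n : ℂ) * Φ z) h1 _))
  · refine ae_of_all _ fun x hx => ?_
    rw [Set.uIoc_of_le (Nat.cast_nonneg T)] at hx
    have hx0 : 0 < x := hx.1
    set W : ℕ → ℂ := fun n => (ε n : ℂ) * Φ (s n * discreteRamp θ u n ⌈(n : ℝ) * x⌉₊) with hWdef
    have hre : Tendsto (fun n : ℕ => (((2 * (ε n * (Ψ (s n *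
        discreteRamp θ u n ⌈(n : ℝ) * x⌉₊)).re) : ℝ)) : ℂ)) atTop
        (𝓝 ((2 * -(κ * |ramp θ u x| ^ β) : ℝ) : ℂ)) :=
      (Complex.continuous_ofReal.tendsto _).comp
        ((hΨ.tendsto_scaled_re hβ hεpos hΔ0 (tendsto_discreteRamp hx0.le)).const_mul 2)
    -- The left contribution `W n` is placed under the integral over heights, because neither of the
    -- two terms need converge alone.
    have hJ : Tendsto (fun n : ℕ => ∫ y in Set.Icc 0 (a 0),
        (W n + ε n * Φ (scaledKernel a Δ β θ u T n (ε n * x, y)))) atTop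
        (𝓝 (∫ _ in Set.Icc 0 (a 0), ((2 * -(κ * |ramp θ u x| ^ β) : ℝ) : ℂ))) := by
      refine tendsto_integral_filter_of_dominated_convergence (fun _ => C + C) ?_ ?_
        (integrableOn_const (by simp)) ?_
      · refine Eventually.of_forall fun n => ?_
        have := hΦc.measurable.comp ((ha.measurable_trawlKernel (Δ := Δ n) (M := n * T)
          (v := v n)).comp (measurable_prodMk_left (x := ε n * x)))
        exact ((this.const_mul (ε n : ℂ)).const_add (W n)).aestronglyMeasurable
      · filter_upwards [hCn, hW] with n h1 h2
        refine ae_of_all _ fun y => (norm_add_le _ _).trans (add_le_add (h2 _) (h1 _ ?_))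
        exact abs_trawlKernel_le _
      · have hne : ∀ᵐ y ∂(volume.restrict (Set.Icc 0 (a 0))), y ≠ a 0 :=
          ae_restrict_of_ae (by rw [ae_iff]; simp)
        filter_upwards [hne, ae_restrict_mem measurableSet_Icc] with y hy hy2
        refine hre.congr' ?_
        filter_upwards [ha.eventually_scaledKernel_eq (β := β) (θ := θ) hΔ hΔ0 hT hx0 hy2.1
          (lt_of_le_of_ne hy2.2 hy)] with n h1
        simp only [W, ε, h1]
        rw [← mul_add, hΦneg]
        push_cast
        ring
    rw [setIntegral_const] at hJ
    -- On the left the slice has weight `a(εx)` instead of `a(0)`; by continuity at `0` and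
    -- boundedness of `W` the discrepancy vanishes.
    have hlim0 : Tendsto (fun n : ℕ => ((trawlExt a (ε n * x) - a 0 : ℝ) : ℂ) * W n) atTop
        (𝓝 0) := by
      have t1 : Tendsto (fun n : ℕ => trawlExt a (ε n * x) - a 0) atTop (𝓝 0) := by
        have := (ha.continuous_ext.tendsto 0).comp
          (by simpa using hΔ0.mul_const x : Tendsto (fun n : ℕ => ε n * x) atTop (𝓝 0))
        have h2 := this.sub_const (a 0)
        simpa [trawlExt] using h2
      have t2 : Tendsto (fun n : ℕ => |trawlExt a (ε n * x) - a 0| * C) atTop (𝓝 0) := by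
        simpa using t1.abs.mul_const C
      refine squeeze_zero_norm' ?_ t2
      filter_upwards [hW] with n h1
      rw [norm_mul, Complex.norm_real, Real.norm_eq_abs]
      exact mul_le_mul_of_nonneg_left (h1 _) (abs_nonneg _)
    have hsum := hlim0.add hJ
    have hfin : (0 : ℂ) + volume.real (Set.Icc 0 (a 0)) • ((2 * -(κ * |ramp θ u x| ^ β) : ℝ) : ℂ)
        = ((-(2 * κ * a 0 * |ramp θ u x| ^ β) : ℝ) : ℂ) := by
      rw [measureReal_def, Real.volume_Icc, sub_zero, ENNReal.toReal_ofReal ha0, zero_add,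
        Complex.real_smul]
      push_cast
      ring
    rw [hfin] at hsum
    refine hsum.congr' ?_
    filter_upwards [eventually_ge_atTop 1] with n hn
    have hn' : (0 : ℝ) < n := by exact_mod_cast hn
    have hm : Measurable fun y => Φ (scaledKernel a Δ β θ u T n (ε n * x, y)) :=
      hΦc.measurable.comp ((ha.measurable_trawlKernel (Δ := Δ n) (M := n * T)
          (v := v n)).comp (measurable_prodMk_left (x := ε n * x)))
    obtain ⟨D, hD⟩ := exists_bound_of_abs_le hΦc (∑ k ∈ Finset.range (n * T), |v n k|)
    have hi : IntegrableOn (fun y => Φ (scaledKernel a Δ β θ u T n (ε n * x, y)))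
        (Set.Icc 0 (a 0)) :=
      Measure.integrableOn_of_bounded (M := D) (by simp) hm.aestronglyMeasurable
        (ae_of_all _ fun y => hD _ (abs_trawlKernel_le _))
    have hiW : Integrable (fun _ => W n) (volume.restrict (Set.Icc 0 (a 0))) :=
      integrableOn_const (by simp)
    rw [integral_add hiW (hi.const_mul _), setIntegral_const,
      integral_const_mul, measureReal_def, Real.volume_Icc, sub_zero, ENNReal.toReal_ofReal ha0,
      Complex.real_smul, trawlSlice, sum_Ico_trawlWeight hT,
      show ε n * x / Δ n = n * x by simp only [hε]; have := (hΔ n hn).ne'; field_simp]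
    simp only [W, scaledKernel, hv, hs]
    push_cast
    ring

end

/-! ### Mixing convergence -/

open scoped InnerProductSpace in
-- Convergence passes from the vectors `x m` to their span by linearity and to its closure by
-- boundedness; on the orthogonal complement all inner products are `0`.
lemma tendsto_inner_of_tendsto_inner_self {E : Type*} [NormedAddCommGroup E] [InnerProductSpace ℂ E]
    [CompleteSpace E] {x : ℕ → E} {C : ℝ} (hC : ∀ n, ‖x n‖ ≤ C)
    (h : ∀ m, Tendsto (fun n => ⟪x m, x n⟫_ℂ) atTop (𝓝 0)) (g : E) :
    Tendsto (fun n => ⟪g, x n⟫_ℂ) atTop (𝓝 0) := by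
  have hspan : ∀ y ∈ Submodule.span ℂ (Set.range x),
      Tendsto (fun n => ⟪y, x n⟫_ℂ) atTop (𝓝 0) := by
    intro y hy
    induction hy using Submodule.span_induction with
    | mem y hy =>
      obtain ⟨m, rfl⟩ := hy
      exact h m
    | zero => simp
    | add y z _ _ hy hz => simpa [inner_add_left] using hy.add hz
    | smul a y _ hy => simpa [inner_smul_left] using hy.mul_const (starRingEnd ℂ a)
  have hC0 : 0 ≤ C := (norm_nonneg _).trans (hC 0)
  have hcl : ∀ y ∈ (Submodule.span ℂ (Set.range x)).topologicalClosure,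
      Tendsto (fun n => ⟪y, x n⟫_ℂ) atTop (𝓝 0) := by
    intro y hy
    rw [← SetLike.mem_coe, Submodule.topologicalClosure_coe, Metric.mem_closure_iff] at hy
    rw [Metric.tendsto_nhds]
    intro ε hε
    obtain ⟨z, hz, hyz⟩ := hy (ε / (2 * (C + 1))) (by positivity)
    rw [dist_eq_norm, lt_div_iff₀ (by positivity)] at hyz
    filter_upwards [(Metric.tendsto_nhds.1 (hspan z hz)) (ε / 2) (by positivity)] with n hn
    rw [dist_zero_right] at hn ⊢
    have e : ⟪y, x n⟫_ℂ = ⟪y - z, x n⟫_ℂ + ⟪z, x n⟫_ℂ := by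
      rw [← inner_add_left, sub_add_cancel]
    have h1 : ‖⟪y - z, x n⟫_ℂ‖ ≤ ‖y - z‖ * C :=
      (norm_inner_le_norm _ _).trans (mul_le_mul_of_nonneg_left (hC n) (norm_nonneg _))
    have h2 := norm_add_le ⟪y - z, x n⟫_ℂ ⟪z, x n⟫_ℂ
    rw [e]
    nlinarith [norm_nonneg (y - z)]
  have : (Submodule.span ℂ (Set.range x)).topologicalClosure.HasOrthogonalProjection := by
    have : CompleteSpace (Submodule.span ℂ (Set.range x)).topologicalClosure :=
      (Submodule.isClosed_topologicalClosure _).completeSpace_coe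
    infer_instance
  obtain ⟨y, hy, z, hz, rfl⟩ :=
    (Submodule.span ℂ (Set.range x)).topologicalClosure.exists_add_mem_mem_orthogonal g
  have hz0 : ∀ n, ⟪z, x n⟫_ℂ = 0 := fun n => by
    rw [← inner_conj_symm, (Submodule.mem_orthogonal _ z).1 hz (x n)
      (Submodule.le_topologicalClosure _ (Submodule.subset_span ⟨n, rfl⟩)), map_zero]
  simpa [inner_add_left, hz0] using hcl y hy

/-- Rényi's criterion for mixing: the hypotheses say that `⟪ξ_m - c, ξ_n - c⟫ → 0` for each `m`, so
`ξ_n - c` tends weakly to `0` in `L²` and can be tested against the indicator of `F`. -/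
lemma tendsto_setIntegral_of_mixing {Ω : Type*} [MeasurableSpace Ω] {P : Measure Ω}
    [IsProbabilityMeasure P] {ξ : ℕ → Ω → ℂ} (hm : ∀ n, AEStronglyMeasurable (ξ n) P)
    (hb : ∀ n ω, ‖ξ n ω‖ ≤ 1) {c : ℂ} (h1 : Tendsto (fun n => ∫ ω, ξ n ω ∂P) atTop (𝓝 c))
    (h2 : ∀ m, Tendsto (fun n => ∫ ω, starRingEnd ℂ (ξ m ω) * ξ n ω ∂P) atTop
      (𝓝 (c * starRingEnd ℂ (∫ ω, ξ m ω ∂P))))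
    {F : Set Ω} (hF : MeasurableSet F) :
    Tendsto (fun n => ∫ ω in F, ξ n ω ∂P) atTop (𝓝 (c * P.real F)) := by
  have hi : ∀ n, Integrable (ξ n) P := fun n =>
    (integrable_const (1 : ℝ)).mono' (hm n) (ae_of_all _ (hb n))
  have hi' : ∀ n, Integrable (fun ω => starRingEnd ℂ (ξ n ω)) P := fun n =>
    (integrable_const (1 : ℝ)).mono' (Complex.continuous_conj.comp_aestronglyMeasurable (hm n))
      (ae_of_all _ fun ω => by simpa using hb n ω)
  have hii : ∀ m n, Integrable (fun ω => starRingEnd ℂ (ξ m ω) * ξ n ω) P := fun m n =>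
    (integrable_const (1 : ℝ)).mono' ((hi' m).aestronglyMeasurable.mul (hm n))
      (ae_of_all _ fun ω => by
        rw [norm_mul, RCLike.norm_conj]
        exact mul_le_one₀ (hb m ω) (norm_nonneg _) (hb n ω))
  have hb' : ∀ n, ∀ᵐ ω ∂P, ‖ξ n ω - c‖ ≤ 1 + ‖c‖ := fun n => ae_of_all _ fun ω =>
    (norm_sub_le _ _).trans (by gcongr; exact hb n ω)
  have hL : ∀ n, MemLp (fun ω => ξ n ω - c) 2 P := fun n =>
    MemLp.of_bound ((hm n).sub aestronglyMeasurable_const) _ (hb' n)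
  set x : ℕ → Lp ℂ 2 P := fun n => (hL n).toLp with hx
  have hinner : ∀ m n, inner ℂ (x m) (x n) = (∫ ω, starRingEnd ℂ (ξ m ω) * ξ n ω ∂P)
      - c * starRingEnd ℂ (∫ ω, ξ m ω ∂P) - starRingEnd ℂ c * (∫ ω, ξ n ω ∂P)
      + starRingEnd ℂ c * c := by
    intro m n
    rw [L2.inner_def]
    have e : (fun ω => inner ℂ (x m ω) (x n ω)) =ᵐ[P] fun ω =>
        starRingEnd ℂ (ξ m ω) * ξ n ω - c * starRingEnd ℂ (ξ m ω) - starRingEnd ℂ c * ξ n ω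
        + starRingEnd ℂ c * c := by
      filter_upwards [(hL m).coeFn_toLp, (hL n).coeFn_toLp] with ω e1 e2
      simp only [hx, e1, e2, RCLike.inner_apply, map_sub]
      ring
    have i1 : Integrable (fun ω => starRingEnd ℂ (ξ m ω) * ξ n ω - c * starRingEnd ℂ (ξ m ω)) P :=
      (hii m n).sub ((hi' m).const_mul c)
    have i2 : Integrable (fun ω => starRingEnd ℂ (ξ m ω) * ξ n ω - c * starRingEnd ℂ (ξ m ω)
      - starRingEnd ℂ c * ξ n ω) P := i1.sub ((hi n).const_mul _)
    rw [integral_congr_ae e, integral_add i2 (integrable_const _),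
      integral_sub i1 ((hi n).const_mul _), integral_sub (hii m n) ((hi' m).const_mul c),
      integral_const_mul, integral_const_mul, integral_conj]
    simp
  have hT := tendsto_inner_of_tendsto_inner_self (x := x) (C := 1 + ‖c‖) (fun n => by
      have := Lp.norm_le_of_ae_bound (f := x n) (C := 1 + ‖c‖) (by positivity) (by
        filter_upwards [(hL n).coeFn_toLp, hb' n] with ω e1 e2
        rw [hx, e1]
        exact e2)
      simpa [measureUnivNNReal] using this)
    (fun m => by
      simp_rw [hinner]
      have := (((h2 m).sub_const (c * starRingEnd ℂ (∫ ω, ξ m ω ∂P))).sub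
        (h1.const_mul (starRingEnd ℂ c))).add_const (starRingEnd ℂ c * c)
      simpa using this)
    (indicatorConstLp 2 hF (measure_ne_top P F) 1)
  have e : ∀ n, inner ℂ (indicatorConstLp 2 hF (measure_ne_top P F) (1 : ℂ)) (x n)
      = (∫ ω in F, ξ n ω ∂P) - c * P.real F := by
    intro n
    rw [L2.inner_indicatorConstLp_one, integral_congr_ae (ae_restrict_of_ae (hL n).coeFn_toLp),
      integral_sub (hi n).integrableOn (integrable_const _), setIntegral_const, Complex.real_smul,
      mul_comm c]
  simp_rw [e] at hT
  simpa using hT.add_const (c * P.real F)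

/-! ### Mixing of integrals against the basis, and the error process. -/

section

variable {Ω : Type*} [MeasurableSpace Ω] {P : Measure Ω} [IsProbabilityMeasure P] {γ b : ℝ}
  {ν : Measure ℝ} {L : Set (ℝ × ℝ) → Ω → ℝ}

/-- Integrals of kernels with vanishing supports converge mixingly as soon as their
characteristic exponents converge. -/
lemma IsSimpleIntegral.tendsto_setIntegral_expI (hL : IsHomogeneousLevyBasis P γ b ν L)
    (hν : IsLevyMeasure ν) {h : ℕ → ℝ × ℝ → ℝ} {Y : ℕ → Ω → ℝ}
    (hY : ∀ n, IsSimpleIntegral P L (h n) (Y n)) {c : ℂ}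
    (hc : Tendsto (fun n => ∫ p, levyExponent γ b ν (h n p)) atTop (𝓝 c))
    (hs : Tendsto (fun n => volume.real {p | h n p ≠ 0}) atTop (𝓝 0))
    {F : Set Ω} (hF : MeasurableSet F) :
    Tendsto (fun n => ∫ ω in F, expI (Y n ω) ∂P) atTop (𝓝 (Complex.exp c * P.real F)) := by
  set ψ := levyExponent γ b ν with hψ
  have hψ0 : ψ 0 = 0 := hν.levyExponent_zero
  have hi : ∀ n, Integrable fun p => ψ (h n p) := fun n => (hY n).integrable_comp hL hψ0
  refine tendsto_setIntegral_of_mixing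
    (fun n => (measurable_expI.comp_aemeasurable ((hY n).aemeasurable hL)).aestronglyMeasurable)
    (fun n ω => (norm_expI _).le) ?_ (fun m => ?_) hF
  · exact ((Complex.continuous_exp.tendsto c).comp hc).congr
      fun n => ((hY n).integral_expI hL hν).symm
  have him : Integrable fun p => ψ (-h m p) :=
    (hY m).integrable_comp hL (Φ := fun z => ψ (-z)) (by simpa using hψ0)
  have hconj : starRingEnd ℂ (∫ p, ψ (h m p)) = ∫ p, ψ (-h m p) := by
    rw [← integral_conj]
    exact integral_congr_ae (ae_of_all _ fun p => (hν.levyExponent_neg _).symm)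
  have hYd : ∀ n, IsSimpleIntegral P L (fun p => h n p + -1 * h m p)
      (fun ω => Y n ω + -1 * Y m ω) := fun n => (hY n).add ((hY m).const_mul (-1))
  have hid : ∀ n, Integrable fun p => ψ (h n p + -1 * h m p) :=
    fun n => (hYd n).integrable_comp hL hψ0
  -- The mixed moment is the characteristic function of `Y n - Y m`, so the task is to split `∫
  -- ψ(h_n - h_m)` asymptotically.
  have e1 : ∀ n, ∫ ω, starRingEnd ℂ (expI (Y m ω)) * expI (Y n ω) ∂P
      = Complex.exp (∫ p, ψ (h n p + -1 * h m p)) := by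
    intro n
    rw [← (hYd n).integral_expI hL hν]
    refine integral_congr_ae (ae_of_all _ fun ω => ?_)
    simp only
    rw [← expI_neg, ← expI_add]
    congr 1
    ring
  refine Tendsto.congr (fun n => (e1 n).symm) ?_
  change Tendsto _ _ (𝓝 (Complex.exp c * starRingEnd ℂ (∫ ω, expI (Y m ω) ∂P)))
  rw [(hY m).integral_expI hL hν, ← Complex.exp_conj, ← Complex.exp_add, hconj]
  refine (Complex.continuous_exp.tendsto _).comp ?_
  suffices hD : Tendsto (fun n => ∫ p, (ψ (h n p + -1 * h m p) - ψ (h n p) - ψ (-h m p))) atTop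
      (𝓝 0) by
    have := hD.add (hc.add_const (∫ p, ψ (-h m p)))
    rw [zero_add] at this
    refine this.congr fun n => ?_
    have i1 : Integrable fun p => ψ (h n p + -1 * h m p) - ψ (h n p) := (hid n).sub (hi n)
    rw [integral_sub i1 him, integral_sub (hid n) (hi n)]
    ring
  obtain ⟨B, hB⟩ := (hY m).exists_bound
  obtain ⟨K, hK⟩ := exists_bound_of_abs_le hν.continuous_levyExponent B (Φ := ψ)
  have hK0 : 0 ≤ K := (norm_nonneg _).trans (hK (h m 0) (hB 0))
  -- Where `h n` vanishes there is no defect. Elsewhere quasi-additivity charges `δ` to the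
  -- convergent integral of `ψ(h n)`, and `δ⁻¹` to the bounded `ψ(-h m)` on a set of vanishing area;
  -- so `n → ∞` is taken before `δ → 0`.
  have key : ∀ δ : ℝ, 0 < δ → ∀ n, ‖∫ p, (ψ (h n p + -1 * h m p) - ψ (h n p) - ψ (-h m p))‖
      ≤ δ * -(∫ p, ψ (h n p)).re + δ⁻¹ * K * volume.real {p | h n p ≠ 0} := by
    intro δ hδ n
    have hms : MeasurableSet {p | h n p ≠ 0} :=
      (hY n).measurable (measurableSet_singleton 0).compl
    have hind : ∀ p, {p | h n p ≠ 0}.indicator (fun _ => δ⁻¹ * K) p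
        = if h n p = 0 then 0 else δ⁻¹ * K := by
      intro p
      by_cases hp : h n p = 0 <;> simp [Set.indicator, hp]
    have hiI : Integrable ({p | h n p ≠ 0}.indicator fun _ => δ⁻¹ * K) := by
      rw [funext hind]
      exact (hY n).integrable_comp hL (Φ := fun z => if z = 0 then (0 : ℝ) else δ⁻¹ * K) (by simp)
    have hiR : Integrable fun p => δ * -(ψ (h n p)).re := (hi n).re.neg.const_mul δ
    refine (norm_integral_le_of_norm_le (hiR.add hiI) (ae_of_all _ fun p => ?_)).trans_eq ?_
    · simp only [Pi.add_apply]
      by_cases hp : h n p = 0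
      · rw [hind, if_pos hp]
        simp [hp, hψ0]
      · rw [hind, if_neg hp]
        have h1 := hν.norm_levyExponent_add_le (γ := γ) (b := b) hδ (h n p) (-h m p)
        rw [neg_one_mul]
        refine h1.trans ?_
        gcongr
        refine (neg_le_abs _).trans ((Complex.abs_re_le_norm _).trans (hK _ ?_))
        rw [abs_neg]
        exact hB p
    · simp only [Pi.add_apply]
      rw [integral_add hiR hiI, integral_const_mul, integral_neg, integral_indicator hms,
        setIntegral_const, smul_eq_mul, mul_comm (volume.real _)]
      congr 3
      exact integral_re (hi n)
  have hre : Tendsto (fun n => -(∫ p, ψ (h n p)).re) atTop (𝓝 (-c.re)) :=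
    ((Complex.continuous_re.tendsto c).comp hc).neg
  rw [Metric.tendsto_nhds]
  intro ε hε
  set δ := ε / (2 * (|c.re| + 1)) with hδ
  have hδ0 : 0 < δ := by positivity
  have h1 : ∀ᶠ n in atTop, -(∫ p, ψ (h n p)).re < |c.re| + 1 :=
    hre.eventually_lt_const (by linarith [neg_le_abs c.re])
  have h2 : Tendsto (fun n => δ⁻¹ * K * volume.real {p | h n p ≠ 0}) atTop (𝓝 0) := by
    simpa using hs.const_mul (δ⁻¹ * K)
  filter_upwards [h1, h2.eventually_lt_const (half_pos hε)] with n a1 a2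
  rw [dist_zero_right]
  have a3 : δ * -(∫ p, ψ (h n p)).re < δ * (|c.re| + 1) := mul_lt_mul_of_pos_left a1 hδ0
  have a4 : δ * (|c.re| + 1) = ε / 2 := by
    rw [hδ]
    field_simp
  linarith [key δ hδ0 n]

variable {a : ℝ → ℝ}

/-- Translates of the trawl set have equal area, hence the values of `L` on them have equal laws;
this makes the centring cancel in `secondOrderError`. -/
lemma IsHomogeneousLevyBasis.integral_trawlProcess (hL : IsHomogeneousLevyBasis P γ b ν L)
    (ha : IsTrawlFunction a) (t : ℝ) :
    ∫ ω, trawlProcess L a t ω ∂P = ∫ ω, trawlProcess L a 0 ω ∂P := by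
  have hm : ∀ t, Measurable (L (trawlSetAt a t)) := fun t =>
    hL.measurable _ (ha.measurableSet_trawlSetAt t) (ha.volume_trawlSetAt_ne_top t)
  have hmap : P.map (L (trawlSetAt a t)) = P.map (L (trawlSetAt a 0)) := by
    have := Measure.isProbabilityMeasure_map (hm t).aemeasurable (μ := P)
    have := Measure.isProbabilityMeasure_map (hm 0).aemeasurable (μ := P)
    refine Measure.ext_of_charFun (funext fun z => ?_)
    rw [hL.charFun_eq _ (ha.measurableSet_trawlSetAt t) (ha.volume_trawlSetAt_ne_top t),
      hL.charFun_eq _ (ha.measurableSet_trawlSetAt 0) (ha.volume_trawlSetAt_ne_top 0),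
      measureReal_def, measureReal_def, volume_trawlSetAt, volume_trawlSetAt 0]
  have h := fun t => integral_map (μ := P) (hm t).aemeasurable (f := fun x : ℝ => x)
    (by fun_prop : AEStronglyMeasurable (fun x : ℝ => x) (P.map (L (trawlSetAt a t))))
  calc ∫ ω, trawlProcess L a t ω ∂P = ∫ x, x ∂(P.map (L (trawlSetAt a t))) := (h t).symm
    _ = ∫ x, x ∂(P.map (L (trawlSetAt a 0))) := by rw [hmap]
    _ = _ := h 0

lemma IsHomogeneousLevyBasis.secondOrderError_eq (hL : IsHomogeneousLevyBasis P γ b ν L)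
    (ha : IsTrawlFunction a) (Δ : ℕ → ℝ) (n : ℕ) (t : ℝ≥0) (ω : Ω) :
    secondOrderError P (trawlProcess L a) Δ n t ω
      = ∑ k ∈ Finset.range ⌊(n : ℝ) * (t : ℝ)⌋₊,
          1 / (n : ℝ) * (L (trawlSetAt a 0) ω + -1 * L (trawlSetAt a (Δ n * k)) ω) := by
  simp only [secondOrderError, centeredSum, hL.integral_trawlProcess ha (Δ n * _)]
  rw [← Finset.mul_sum]
  simp only [trawlProcess, Finset.sum_add_distrib, Finset.sum_sub_distrib, Finset.sum_const,
    ← Finset.mul_sum, Finset.card_range, nsmul_eq_mul]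
  ring

/-- The scaled linear combinations of the error process are integrals of the scaled kernels. -/
lemma IsHomogeneousLevyBasis.isSimpleIntegral_secondOrderError
    (hL : IsHomogeneousLevyBasis P γ b ν L) (ha : IsTrawlFunction a) (Δ : ℕ → ℝ) (β : ℝ) {q : ℕ}
    (θ : Fin q → ℝ) {u : Fin q → ℝ≥0} {T : ℕ} (hT : ∀ l, (u l : ℝ) ≤ T) (n : ℕ) :
    IsSimpleIntegral P L (scaledKernel a Δ β θ u T n)
      (fun ω => ∑ l, θ l * (1 / ((n : ℝ) * Δ n) ^ (1 / β)
        * secondOrderError P (trawlProcess L a) Δ n (u l) ω)) := by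
  have hI : ∀ t, IsSimpleIntegral P L ((trawlSetAt a t).indicator fun _ => 1)
      (L (trawlSetAt a t)) := fun t =>
    isSimpleIntegral_indicator (ha.measurableSet_trawlSetAt t) (ha.volume_trawlSetAt_ne_top t)
  refine (IsSimpleIntegral.sum (Finset.range (n * T)) fun k _ => ((hI 0).add
    ((hI (Δ n * k)).const_mul (-1))).const_mul
      (trawlWeight (1 / ((n : ℝ) * Δ n) ^ (1 / β)) θ u n k)).congr
    (ae_of_all _ fun ω => ?_) fun p => rfl
  simp only [trawlWeight, Finset.sum_mul]
  rw [Finset.sum_comm]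
  refine Finset.sum_congr rfl fun l _ => ?_
  rw [hL.secondOrderError_eq ha, Finset.mul_sum, Finset.mul_sum,
    ← Finset.sum_subset (Finset.range_mono (floor_mul_le hT n l))]
  · refine Finset.sum_congr rfl fun k hk => ?_
    rw [if_pos (Finset.mem_range.1 hk)]
    ring
  · intro k _ hk
    rw [if_neg (by simpa using hk)]
    ring

lemma IsHomogeneousLevyBasis.aemeasurable_secondOrderError
    (hL : IsHomogeneousLevyBasis P γ b ν L) (ha : IsTrawlFunction a) (Δ : ℕ → ℝ) (n : ℕ)
    (t : ℝ≥0) : AEMeasurable (secondOrderError P (trawlProcess L a) Δ n t) P := by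
  have hm : ∀ t, Measurable (L (trawlSetAt a t)) := fun t =>
    hL.measurable _ (ha.measurableSet_trawlSetAt t) (ha.volume_trawlSetAt_ne_top t)
  rw [funext (hL.secondOrderError_eq ha Δ n t)]
  exact (Finset.measurable_fun_sum _ fun k _ =>
    ((hm 0).add ((hm _).const_mul _)).const_mul _).aemeasurable

/-- Mixing convergence of the characteristic functions of the error process. -/
lemma IsHomogeneousLevyBasis.tendsto_setIntegral_expI_secondOrderError
    (hL : IsHomogeneousLevyBasis P γ b ν L) (hν : IsLevyMeasure ν) (ha : IsTrawlFunction a)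
    {Δ : ℕ → ℝ} (hΔ : ∀ n, 1 ≤ n → 0 < Δ n)
    (hΔ0 : Tendsto (fun n : ℕ => (n : ℝ) * Δ n) atTop (𝓝 0)) {β c κ : ℝ} (hβ : 0 < β)
    (hψ : IsStableLike (levyExponent γ b ν) β c κ) {q : ℕ} (θ : Fin q → ℝ) {u : Fin q → ℝ≥0}
    {T : ℕ} (hT : ∀ l, (u l : ℝ) ≤ T) {F : Set Ω} (hF : MeasurableSet F) :
    Tendsto (fun n : ℕ => ∫ ω in F, expI (∑ l, θ l * (1 / ((n : ℝ) * Δ n) ^ (1 / β)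
        * secondOrderError P (trawlProcess L a) Δ n (u l) ω)) ∂P) atTop
      (𝓝 (Complex.exp ((∫ x in (0 : ℝ)..T, -(2 * κ * a 0 * |ramp θ u x| ^ β) : ℝ) : ℂ)
        * P.real F)) := by
  have hY := fun n => hL.isSimpleIntegral_secondOrderError ha Δ β θ hT n
  refine IsSimpleIntegral.tendsto_setIntegral_expI hL hν hY
    (ha.tendsto_integral_scaledKernel hΔ hΔ0 hβ hν.continuous_levyExponent hν.levyExponent_zero
      hν.levyExponent_neg hψ hT fun n Φ hΦ => (hY n).integrable_comp hL hΦ) ?_ hF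
  have ha0 := ha.nonneg 0 le_rfl
  have hlim : Tendsto (fun n : ℕ => 2 * a 0 * ((n : ℝ) * Δ n * T)) atTop (𝓝 0) := by
    simpa using (hΔ0.mul_const (T : ℝ)).const_mul (2 * a 0)
  refine squeeze_zero' (Eventually.of_forall fun n => measureReal_nonneg) ?_ hlim
  filter_upwards [eventually_ge_atTop 1] with n hn
  have hΔn := hΔ n hn
  have h := ENNReal.toReal_mono ENNReal.ofReal_ne_top
    (ha.measure_support_trawlKernel_le hΔn (M := n * T)
      (v := trawlWeight (1 / ((n : ℝ) * Δ n) ^ (1 / β)) θ u n))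
  rw [ENNReal.toReal_ofReal (by positivity)] at h
  refine h.trans_eq ?_
  push_cast
  ring

end

/-! ### The Cramér–Wold device for stable convergence -/

lemma integral_cond {Ω E : Type*} [MeasurableSpace Ω] [NormedAddCommGroup E] [NormedSpace ℝ E]
    (P : Measure Ω) (F : Set Ω) (f : Ω → E) :
    ∫ ω, f ω ∂(P[|F]) = (P.real F)⁻¹ • ∫ ω in F, f ω ∂P := by
  rw [ProbabilityTheory.cond, integral_smul_measure, ENNReal.toReal_inv, measureReal_def]

/-- Conditioning on `F` divides set integrals by `P(F)`, which `π` preserves; Lévy's continuity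
theorem is then applied to the conditional laws, viewed on `EuclideanSpace`. -/
lemma fddStablyTendsto_of_tendsto_expI {Ω Ω' T : Type*} [mΩ : MeasurableSpace Ω]
    [MeasurableSpace Ω'] {P : Measure Ω} [IsProbabilityMeasure P] {P' : Measure Ω'}
    [IsProbabilityMeasure P'] {π : Ω' → Ω} (hπ : MeasurePreserving π P' P)
    {Xn : ℕ → T → Ω → ℝ} {X : T → Ω' → ℝ} (hXn : ∀ n t, AEMeasurable (Xn n t) P)
    (hX : ∀ t, AEMeasurable (X t) P')
    (h : ∀ (q : ℕ) (u : Fin q → T) (θ : Fin q → ℝ) (F : Set Ω), MeasurableSet F →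
      Tendsto (fun n => ∫ ω in F, expI (∑ l, θ l * Xn n (u l) ω) ∂P) atTop
        (𝓝 (∫ ω in π ⁻¹' F, expI (∑ l, θ l * X (u l) ω) ∂P'))) :
    FddStablyTendsto mΩ P P' π Xn X := by
  refine ⟨hXn, hX, fun q u F hF hPF f => ?_⟩
  have hPF' : P' (π ⁻¹' F) ≠ 0 := by rwa [hπ.measure_preimage hF.nullMeasurableSet]
  have hreal : P'.real (π ⁻¹' F) = P.real F := by
    rw [measureReal_def, measureReal_def, hπ.measure_preimage hF.nullMeasurableSet]
  have := cond_isProbabilityMeasure hPF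
  have := cond_isProbabilityMeasure hPF'
  let V : ℕ → Ω → EuclideanSpace ℝ (Fin q) := fun n ω => WithLp.toLp 2 fun i => Xn n (u i) ω
  let W : Ω' → EuclideanSpace ℝ (Fin q) := fun ω => WithLp.toLp 2 fun i => X (u i) ω
  have hV : ∀ n, AEMeasurable (V n) (P[|F]) := fun n =>
    (WithLp.measurable_toLp 2 _).comp_aemeasurable
      ((aemeasurable_pi_lambda _ fun i => hXn n (u i)).mono_ac cond_absolutelyContinuous)
  have hW : AEMeasurable W (P'[|π ⁻¹' F]) :=
    (WithLp.measurable_toLp 2 _).comp_aemeasurable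
      ((aemeasurable_pi_lambda _ fun i => hX (u i)).mono_ac cond_absolutelyContinuous)
  let μ : ℕ → ProbabilityMeasure (EuclideanSpace ℝ (Fin q)) := fun n =>
    ⟨(P[|F]).map (V n), Measure.isProbabilityMeasure_map (hV n)⟩
  let μ' : ProbabilityMeasure (EuclideanSpace ℝ (Fin q)) :=
    ⟨(P'[|π ⁻¹' F]).map W, Measure.isProbabilityMeasure_map hW⟩
  have hμ : Tendsto μ atTop (𝓝 μ') := by
    rw [ProbabilityMeasure.tendsto_iff_tendsto_charFun]
    intro θ
    have e1 : ∀ n, charFun (μ n : Measure _) θ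
        = (P.real F)⁻¹ • ∫ ω in F, expI (∑ l, θ l * Xn n (u l) ω) ∂P := by
      intro n
      rw [charFun_apply, ← integral_cond]
      simp only [μ, ProbabilityMeasure.coe_mk]
      rw [integral_map (hV n) (by fun_prop)]
      simp [expI, V, PiLp.inner_apply, mul_comm]
    have e2 : charFun (μ' : Measure _) θ
        = (P.real F)⁻¹ • ∫ ω in π ⁻¹' F, expI (∑ l, θ l * X (u l) ω) ∂P' := by
      rw [charFun_apply, ← hreal, ← integral_cond]
      simp only [μ', ProbabilityMeasure.coe_mk]
      rw [integral_map hW (by fun_prop)]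
      simp [expI, W, PiLp.inner_apply, mul_comm]
    simp_rw [e1, e2]
    exact (h q u θ F hF).const_smul _
  have hg := ProbabilityMeasure.tendsto_iff_forall_integral_tendsto.1 hμ
    (f.compContinuous ⟨WithLp.ofLp, PiLp.continuous_ofLp 2 _⟩)
  have e1 : ∀ n, ∫ x, f (WithLp.ofLp x) ∂((P[|F]).map (V n))
      = ∫ ω, f (fun i => Xn n (u i) ω) ∂(P[|F]) := fun n =>
    integral_map (hV n) (f.continuous.comp (PiLp.continuous_ofLp 2 _)).aestronglyMeasurable
  have e2 : ∫ x, f (WithLp.ofLp x) ∂((P'[|π ⁻¹' F]).map W)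
      = ∫ ω, f (fun i => X (u i) ω) ∂(P'[|π ⁻¹' F]) :=
    integral_map hW (f.continuous.comp (PiLp.continuous_ofLp 2 _)).aestronglyMeasurable
  rw [← e2]
  exact hg.congr e1

/-! ### Partition sums along càdlàg paths -/

/-- The function `y` is right-continuous with left limits. -/
def IsCadlag (y : ℝ≥0 → ℝ) : Prop :=
  ∀ t : ℝ≥0, ContinuousWithinAt y (Set.Ici t) t ∧ ∃ l : ℝ, Tendsto y (𝓝[<] t) (𝓝 l)

section

variable {y y' : ℝ≥0 → ℝ}

lemma IsCadlag.add (hy : IsCadlag y) (hy' : IsCadlag y') : IsCadlag fun s => y s + y' s :=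
  fun t => ⟨(hy t).1.add (hy' t).1, by
    obtain ⟨l, hl⟩ := (hy t).2
    obtain ⟨l', hl'⟩ := (hy' t).2
    exact ⟨l + l', hl.add hl'⟩⟩

lemma IsCadlag.const_mul (hy : IsCadlag y) (c : ℝ) : IsCadlag fun s => c * y s :=
  fun t => ⟨(hy t).1.const_mul c, by
    obtain ⟨l, hl⟩ := (hy t).2
    exact ⟨c * l, hl.const_mul c⟩⟩

lemma Continuous.isCadlag (hy : Continuous y) : IsCadlag y :=
  fun t => ⟨hy.continuousWithinAt, y t, (hy.tendsto t).mono_left nhdsWithin_le_nhds⟩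

/-- One-sided limits bound the path near each point; compactness glues the local bounds. -/
lemma IsCadlag.exists_bound (hy : IsCadlag y) (T : ℝ≥0) : ∃ C, ∀ s ≤ T, |y s| ≤ C := by
  have h := (isCompact_Icc (a := (0 : ℝ≥0)) (b := T)).induction_on
    (p := fun S => ∃ C, ∀ s ∈ S, |y s| ≤ C) ⟨0, by simp⟩
    (fun S S' hSS' ⟨C, hC⟩ => ⟨C, fun s hs => hC s (hSS' hs)⟩)
    (fun S S' ⟨C, hC⟩ ⟨C', hC'⟩ => ⟨max C C', fun s hs =>
      hs.elim (fun h => (hC s h).trans (le_max_left _ _))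
        fun h => (hC' s h).trans (le_max_right _ _)⟩)
    (fun x _ => by
      obtain ⟨l, hl⟩ := (hy x).2
      have h1 : ∀ᶠ s in 𝓝[≥] x, |y s| ≤ max (|y x| + 1) (|l| + 1) :=
        ((hy x).1.tendsto.abs.eventually_le_const (lt_add_one _)).mono
          fun s hs => hs.trans (le_max_left _ _)
      have h2 : ∀ᶠ s in 𝓝[<] x, |y s| ≤ max (|y x| + 1) (|l| + 1) :=
        (hl.abs.eventually_le_const (lt_add_one _)).mono fun s hs => hs.trans (le_max_right _ _)
      have h3 : ∀ᶠ s in 𝓝 x, |y s| ≤ max (|y x| + 1) (|l| + 1) := by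
        rw [← nhdsLT_sup_nhdsGE]
        exact eventually_sup.2 ⟨h2, h1⟩
      exact ⟨_, nhdsWithin_le_nhds h3, _, fun s hs => hs⟩)
  obtain ⟨C, hC⟩ := h
  exact ⟨C, fun s hs => hC s ⟨zero_le, hs⟩⟩

lemma measureReal_restrict_Ioc_zero {t c d : ℝ} (hc : 0 ≤ c) (hcd : c ≤ d) :
    (volume.restrict (Set.Ioc 0 t)).real (Set.Ioc c d) = max (t - c) 0 - max (t - d) 0 := by
  rw [measureReal_def, Measure.restrict_apply measurableSet_Ioc, Set.Ioc_inter_Ioc,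
    Real.volume_Ioc, ENNReal.toReal_ofReal']
  simp only [sup_of_le_left hc]
  rcases le_total t c with h1 | h1 <;> rcases le_total t d with h2 | h2 <;>
    (simp [h1, h2, hcd]; try linarith)

/-- The coefficient is the length of the cell inside `(0, t]`, so the sum is the integral of the
step function taking on each cell the value of `y` at its right endpoint. These endpoints approach
`s` from the right, so right-continuity and boundedness suffice. -/
lemma IsCadlag.tendsto_sum_right (hy : IsCadlag y) {t T : ℝ≥0} (htT : t ≤ T) {N : ℕ → ℕ}
    {u : ℕ → ℕ → ℝ≥0} (hu : ∀ m, Monotone (u m)) (hu0 : ∀ m, u m 0 = 0)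
    (huN : ∀ m, u m (N m) = T)
    (hmesh : Tendsto (fun m => (Finset.range (N m)).sup fun i => u m (i + 1) - u m i) atTop
      (𝓝 0)) :
    Tendsto (fun m => ∑ i ∈ Finset.range (N m),
      (max ((t : ℝ) - u m i) 0 - max ((t : ℝ) - u m (i + 1)) 0) * y (u m (i + 1))) atTop
      (𝓝 (∫ s in Set.Ioc 0 (t : ℝ), y s.toNNReal)) := by
  let I : ℕ → ℕ → Set ℝ := fun m i => Set.Ioc (u m i : ℝ) (u m (i + 1))
  have hI : ∀ m, Pairwise fun i j => Disjoint (I m i) (I m j) := fun m =>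
    (NNReal.coe_mono.comp (hu m)).pairwise_disjoint_on_Ioc_succ
  let f : ℕ → ℝ → ℝ := fun m s =>
    ∑ i ∈ Finset.range (N m), (I m i).indicator (fun _ => y (u m (i + 1))) s
  have hsum : ∀ m, ∑ i ∈ Finset.range (N m),
      (max ((t : ℝ) - u m i) 0 - max ((t : ℝ) - u m (i + 1)) 0) * y (u m (i + 1))
      = ∫ s in Set.Ioc 0 (t : ℝ), f m s := by
    intro m
    rw [integral_finsetSum]
    · refine Finset.sum_congr rfl fun i _ => ?_
      rw [integral_indicator measurableSet_Ioc, setIntegral_const,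
        measureReal_restrict_Ioc_zero (NNReal.coe_nonneg _)
          (NNReal.coe_le_coe.2 (hu m (Nat.le_succ i))), smul_eq_mul]
    · exact fun i _ => (integrable_const _).indicator measurableSet_Ioc
  have hf : ∀ m, ∀ s ∈ Set.Ioc 0 (t : ℝ), ∃ i < N m, s ∈ I m i ∧ f m s = y (u m (i + 1)) := by
    intro m s hs
    have hex : ∃ i, s ≤ u m (i + 1) ∧ i < N m := by
      have hN : N m ≠ 0 := fun h => by
        have h1 := huN m
        rw [h, hu0] at h1
        have : (t : ℝ) ≤ 0 := by exact_mod_cast htT.trans h1.symm.le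
        linarith [hs.1, hs.2]
      refine ⟨N m - 1, ?_, by omega⟩
      rw [Nat.sub_add_cancel (by omega), huN]
      exact hs.2.trans (NNReal.coe_le_coe.2 htT)
    classical
    obtain ⟨h1, h2⟩ := Nat.find_spec hex
    set i := Nat.find hex with hi
    have hsi : s ∈ I m i := by
      refine ⟨?_, h1⟩
      rcases Nat.eq_zero_or_pos i with h0 | h0
      · rw [h0, hu0]
        exact hs.1
      · by_contra hcon
        refine Nat.find_min hex (m := i - 1) (by omega) ⟨?_, by omega⟩
        rw [Nat.sub_add_cancel h0]
        exact not_lt.1 hcon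
    refine ⟨i, h2, hsi, (Finset.sum_eq_single_of_mem i (Finset.mem_range.2 h2) ?_).trans ?_⟩
    · exact fun j _ hji => Set.indicator_of_notMem
        (fun hj => Set.disjoint_left.1 (hI m hji) hj hsi) _
    · exact Set.indicator_of_mem hsi _
  simp_rw [hsum]
  obtain ⟨C, hC⟩ := hy.exists_bound T
  refine tendsto_integral_of_dominated_convergence (fun _ => C) (fun m => ?_)
    (integrable_const _) (fun m => ?_) ?_
  · exact (Finset.measurable_fun_sum _ fun i _ =>
      measurable_const.indicator measurableSet_Ioc).aestronglyMeasurable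
  · filter_upwards [ae_restrict_mem measurableSet_Ioc] with s hs
    obtain ⟨i, hi, -, e⟩ := hf m s hs
    rw [e]
    exact hC _ ((hu m hi).trans (huN m).le)
  · filter_upwards [ae_restrict_mem measurableSet_Ioc] with s hs
    rw [Metric.tendsto_nhds]
    intro ε hε
    have hrc := (Metric.tendsto_nhds.1 (hy s.toNNReal).1.tendsto) ε hε
    obtain ⟨δ, hδ, hball⟩ := Metric.mem_nhdsWithin_iff.1 hrc
    filter_upwards [hmesh.eventually_lt_const (Real.toNNReal_pos.2 hδ)] with m hm
    obtain ⟨i, hi, hsi, e⟩ := hf m s hs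
    rw [e]
    refine hball ⟨?_, ?_⟩
    · have h1 : u m (i + 1) - u m i < δ.toNNReal :=
        (Finset.le_sup (f := fun i => u m (i + 1) - u m i) (Finset.mem_range.2 hi)).trans_lt hm
      have h2 : (u m (i + 1) : ℝ) - u m i < δ := by
        have := Real.lt_toNNReal_iff_coe_lt.1 h1
        rwa [NNReal.coe_sub (hu m (Nat.le_succ i))] at this
      rw [Metric.mem_ball, NNReal.dist_eq, Real.coe_toNNReal _ hs.1.le, abs_of_nonneg
        (sub_nonneg.2 hsi.2)]
      linarith [hsi.1]
    · exact Real.toNNReal_le_iff_le_coe.2 hsi.2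

/-- Abel summation; the boundary terms vanish as `y 0 = 0` and `(t - T)⁺ = 0`. Allowing `t ≤ T` lets
one grid serve several times at once. -/
lemma IsCadlag.tendsto_sum (hy : IsCadlag y) (hy0 : y 0 = 0) {t T : ℝ≥0} (htT : t ≤ T)
    {N : ℕ → ℕ} {u : ℕ → ℕ → ℝ≥0} (hu : ∀ m, Monotone (u m)) (hu0 : ∀ m, u m 0 = 0)
    (huN : ∀ m, u m (N m) = T)
    (hmesh : Tendsto (fun m => (Finset.range (N m)).sup fun i => u m (i + 1) - u m i) atTop
      (𝓝 0)) :
    Tendsto (fun m => ∑ i ∈ Finset.range (N m),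
      max ((t : ℝ) - u m i) 0 * (y (u m (i + 1)) - y (u m i))) atTop
      (𝓝 (∫ s in Set.Ioc 0 (t : ℝ), y s.toNNReal)) := by
  refine (hy.tendsto_sum_right htT hu hu0 huN hmesh).congr fun m => ?_
  have h : ∀ n, ∑ i ∈ Finset.range n, max ((t : ℝ) - u m i) 0 * (y (u m (i + 1)) - y (u m i))
      = max ((t : ℝ) - u m n) 0 * y (u m n) + ∑ i ∈ Finset.range n,
      (max ((t : ℝ) - u m i) 0 - max ((t : ℝ) - u m (i + 1)) 0) * y (u m (i + 1)) := by
    intro n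
    induction n with
    | zero => simp [hu0, hy0]
    | succ n ih =>
      rw [Finset.sum_range_succ, Finset.sum_range_succ, ih]
      ring
  have htT' : (t : ℝ) - T ≤ 0 := sub_nonpos.2 (NNReal.coe_le_coe.2 htT)
  rw [h, huN, max_eq_right htT']
  ring

end

/-! ### Uniform grids and Riemann sums. -/

/-- The grid of step `1 / (m + 1)`. -/
def grid (m i : ℕ) : ℝ≥0 := i / (m + 1)

lemma coe_grid (m i : ℕ) : (grid m i : ℝ) = i / (m + 1) := by simp [grid]

lemma grid_mono (m : ℕ) : Monotone (grid m) := by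
  intro i j hij
  simp only [grid]
  gcongr

lemma grid_zero (m : ℕ) : grid m 0 = 0 := by simp [grid]

lemma grid_last (T m : ℕ) : grid m ((m + 1) * T) = T := by
  simp only [grid]
  push_cast
  field_simp

lemma tendsto_grid_mesh (T : ℕ) :
    Tendsto (fun m => (Finset.range ((m + 1) * T)).sup fun i => grid m (i + 1) - grid m i) atTop
      (𝓝 0) := by
  have h : Tendsto (fun m : ℕ => 1 / ((m : ℝ≥0) + 1)) atTop (𝓝 0) :=
    tendsto_one_div_add_atTop_nhds_zero_nat
  refine tendsto_of_tendsto_of_tendsto_of_le_of_le tendsto_const_nhds h (fun m => zero_le)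
    fun m => Finset.sup_le fun i _ => ?_
  rw [tsub_le_iff_left]
  simp only [grid]
  push_cast
  rw [add_div]

/-- Left Riemann sums of a continuous function. -/
lemma tendsto_left_riemann_sum {G : ℝ → ℝ} (hG : Continuous G) (T : ℕ) :
    Tendsto (fun m : ℕ => ∑ i ∈ Finset.range ((m + 1) * T), G (grid m i) / ((m : ℝ) + 1)) atTop
      (𝓝 (∫ x in (0 : ℝ)..T, G x)) := by
  have hy : IsCadlag fun s : ℝ≥0 => G s := (hG.comp NNReal.continuous_coe).isCadlag
  have h := hy.tendsto_sum_right (t := T) (T := T) le_rfl grid_mono grid_zero (grid_last T)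
    (tendsto_grid_mesh T)
  -- This is the difference between the left and the right Riemann sums.
  have hlim : Tendsto (fun m : ℕ => (G 0 - G T) * (1 / ((m : ℝ) + 1))) atTop (𝓝 0) := by
    simpa using tendsto_one_div_add_atTop_nhds_zero_nat.const_mul (G 0 - G T)
  have h2 := h.add hlim
  rw [add_zero] at h2
  have e : ∫ s in Set.Ioc 0 ((T : ℝ≥0) : ℝ), G (s.toNNReal) = ∫ x in (0 : ℝ)..T, G x := by
    rw [intervalIntegral.integral_of_le (Nat.cast_nonneg T), NNReal.coe_natCast]
    refine setIntegral_congr_fun measurableSet_Ioc fun s hs => ?_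
    simp only [Real.coe_toNNReal _ hs.1.le]
  rw [e] at h2
  refine h2.congr fun m => ?_
  have hstep : ∀ i ∈ Finset.range ((m + 1) * T),
      (max (((T : ℝ≥0) : ℝ) - grid m i) 0 - max (((T : ℝ≥0) : ℝ) - grid m (i + 1)) 0)
        * G (grid m (i + 1)) = 1 / ((m : ℝ) + 1) * G (grid m (i + 1)) := by
    intro i hi
    have hle : ∀ j ≤ (m + 1) * T, (grid m j : ℝ) ≤ (T : ℝ≥0) := fun j hj =>
      NNReal.coe_le_coe.2 ((grid_mono m hj).trans (grid_last T m).le)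
    have hi' := Finset.mem_range.1 hi
    rw [max_eq_left (sub_nonneg.2 (hle i hi'.le)), max_eq_left (sub_nonneg.2 (hle (i + 1) hi')),
      coe_grid m (i + 1), coe_grid m i]
    push_cast
    ring
  rw [Finset.sum_congr rfl hstep, ← Finset.mul_sum, ← Finset.sum_div]
  have h3 := Finset.sum_range_succ (fun i => G (grid m i)) ((m + 1) * T)
  have h4 := Finset.sum_range_succ' (fun i => G (grid m i)) ((m + 1) * T)
  rw [h3, grid_last, grid_zero] at h4
  simp only [NNReal.coe_natCast, NNReal.coe_zero] at h4
  field_simp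
  linarith

/-! ### The limit process -/

/-- The pathwise integral `∫_0^t Y_s ds = ∫_0^t (t - s) dY_s`. -/
def pathIntegral {Ω : Type*} (Y : ℝ≥0 → Ω → ℝ) (t : ℝ≥0) (ω : Ω) : ℝ :=
  ∫ s in Set.Ioc 0 (t : ℝ), Y s.toNNReal ω

section

variable {Ω : Type*} [MeasurableSpace Ω] {P : Measure Ω} {Y : ℝ≥0 → Ω → ℝ}

lemma tendsto_grid_sum_pathIntegral (hzero : ∀ᵐ ω ∂P, Y 0 ω = 0)
    (hcad : ∀ᵐ ω ∂P, IsCadlag fun s => Y s ω) {t : ℝ≥0} {T : ℕ} (htT : (t : ℝ) ≤ T) :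
    ∀ᵐ ω ∂P, Tendsto (fun m => ∑ i ∈ Finset.range ((m + 1) * T),
      max ((t : ℝ) - grid m i) 0 * (Y (grid m (i + 1)) ω - Y (grid m i) ω)) atTop
      (𝓝 (pathIntegral Y t ω)) := by
  filter_upwards [hzero, hcad] with ω h0 hc
  exact hc.tendsto_sum h0 (T := (T : ℝ≥0)) (by exact_mod_cast htT) grid_mono grid_zero
    (grid_last T) (tendsto_grid_mesh T)

lemma aemeasurable_pathIntegral (hmeas : ∀ t, Measurable (Y t)) (hzero : ∀ᵐ ω ∂P, Y 0 ω = 0)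
    (hcad : ∀ᵐ ω ∂P, IsCadlag fun s => Y s ω) (t : ℝ≥0) : AEMeasurable (pathIntegral Y t) P :=
  aemeasurable_of_tendsto_metrizable_ae atTop
    (fun _ => (Finset.measurable_fun_sum _ fun _ _ =>
      ((hmeas _).sub (hmeas _)).const_mul _).aemeasurable)
    (tendsto_grid_sum_pathIntegral hzero hcad (Nat.le_ceil (t : ℝ)))

lemma isWienerIntegral_pathIntegral [IsFiniteMeasure P] (hmeas : ∀ t, Measurable (Y t))
    (hzero : ∀ᵐ ω ∂P, Y 0 ω = 0) (hcad : ∀ᵐ ω ∂P, IsCadlag fun s => Y s ω) (t : ℝ≥0) :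
    IsWienerIntegral P (fun r => (t : ℝ) - r) Y t (pathIntegral Y t) := by
  refine ⟨aemeasurable_pathIntegral hmeas hzero hcad t, fun N u hu hu0 huN hmesh =>
    tendstoInMeasure_of_tendsto_ae (fun m => (Finset.measurable_fun_sum _ fun _ _ =>
      ((hmeas _).sub (hmeas _)).const_mul _).aestronglyMeasurable) ?_⟩
  filter_upwards [hzero, hcad] with ω h0 hc
  refine (hc.tendsto_sum h0 le_rfl hu hu0 huN hmesh).congr fun m => ?_
  refine Finset.sum_congr rfl fun i hi => ?_
  rw [max_eq_left (sub_nonneg.2 (NNReal.coe_le_coe.2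
    ((hu m (Finset.mem_range.1 hi).le).trans (huN m).le)))]

/-- `Y` is a process with independent increments, started at `0`, with càdlàg paths, whose
increments over the grids have the characteristic exponent `φ`. -/
structure HasExponent (P : Measure Ω) (Y : ℝ≥0 → Ω → ℝ) (φ : ℝ → ℂ) : Prop where
  measurable : ∀ t, Measurable (Y t)
  zero : ∀ᵐ ω ∂P, Y 0 ω = 0
  indep : HasIndepIncrements Y P
  cadlag : ∀ᵐ ω ∂P, IsCadlag fun s => Y s ω
  exponent : ∀ (m i : ℕ) (z : ℝ), ∫ ω, expI (z * (Y (grid m (i + 1)) ω - Y (grid m i) ω)) ∂P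
    = Complex.exp (φ z / (m + 1))

lemma integral_expI_sum_of_hasIndepIncrements (hmeas : ∀ t, Measurable (Y t))
    (hY : HasIndepIncrements Y P) {t : ℕ → ℝ≥0} (ht : Monotone t) (w : ℕ → ℝ) (N : ℕ) :
    ∫ ω, expI (∑ i ∈ Finset.range N, w i * (Y (t (i + 1)) ω - Y (t i) ω)) ∂P
      = ∏ i ∈ Finset.range N, ∫ ω, expI (w i * (Y (t (i + 1)) ω - Y (t i) ω)) ∂P := by
  have hi : iIndepFun (fun (i : Fin N) ω => Y (t (i + 1)) ω - Y (t i) ω) P :=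
    (hY.nat ht).precomp (g := fun i : Fin N => (i : ℕ)) Fin.val_injective
  have h := hi.integral_fun_prod_comp (f := fun (i : Fin N) x => expI (w i * x))
    (fun i => ((hmeas _).sub (hmeas _)).aemeasurable) (fun i => by fun_prop)
  simp_rw [expI_sum]
  rw [← Fin.prod_univ_eq_prod_range
    (fun i => ∫ ω, expI (w i * (Y (t (i + 1)) ω - Y (t i) ω)) ∂P) N, ← h]
  refine integral_congr_ae (ae_of_all _ fun ω => ?_)
  exact (Fin.prod_univ_eq_prod_range (fun i => expI (w i * (Y (t (i + 1)) ω - Y (t i) ω))) N).symm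

lemma HasExponent.integral_expI_sum {φ : ℝ → ℂ} (hY : HasExponent P Y φ) (m : ℕ) (w : ℕ → ℝ)
    (N : ℕ) :
    ∫ ω, expI (∑ i ∈ Finset.range N, w i * (Y (grid m (i + 1)) ω - Y (grid m i) ω)) ∂P
      = Complex.exp (∑ i ∈ Finset.range N, φ (w i) / (m + 1)) := by
  rw [integral_expI_sum_of_hasIndepIncrements hY.measurable hY.indep (grid_mono m), Complex.exp_sum]
  exact Finset.prod_congr rfl fun i _ => hY.exponent m i (w i)

/-- A continuous choice of roots of unity is constant. -/
lemma eq_one_of_pow_eq_one {f : ℝ → ℂ} (hf : Continuous f) {n : ℕ} (hn : n ≠ 0)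
    (h : ∀ z, f z ^ n = 1) (h0 : f 0 = 1) (z : ℝ) : f z = 1 := by
  have hfin : {w : ℂ | w ^ n = 1}.Finite := by
    refine (Polynomial.nthRoots n (1 : ℂ)).toFinset.finite_toSet.subset fun w hw => ?_
    rw [Finset.mem_coe, Multiset.mem_toFinset, Polynomial.mem_nthRoots (Nat.pos_of_ne_zero hn)]
    exact hw
  rw [← h0]
  exact isPreconnected_univ.constant_of_mapsTo (f := f) hfin.isDiscrete hf.continuousOn
    (fun z _ => h z) (Set.mem_univ z) (Set.mem_univ 0)

/-- The law at time `1` determines only the `(m+1)`-st power of the characteristic function at time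
`1/(m+1)`. Dividing by `exp(φ/(m+1))` leaves a continuous root of unity equal to `1` at `0`, hence
`1` everywhere. -/
lemma IsLevyProcess.hasExponent [IsProbabilityMeasure P] (hY : IsLevyProcess P Y) {φ : ℝ → ℂ}
    (hφ : Continuous φ) (hφ0 : φ 0 = 0)
    (h : ∀ z, charFun (P.map (Y 1)) z = Complex.exp (φ z)) : HasExponent P Y φ := by
  refine ⟨hY.measurable, hY.zero, hY.indep_increments, hY.cadlag, fun m i z => ?_⟩
  have hlaw : ∀ i z, ∫ ω, expI (z * (Y (grid m (i + 1)) ω - Y (grid m i) ω)) ∂P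
      = ∫ ω, expI (z * Y (grid m 1) ω) ∂P := by
    intro i z
    have e : grid m (i + 1) = grid m i + grid m 1 := by
      simp only [grid]
      push_cast
      rw [add_div]
    rw [e]
    exact ((hY.stationary (grid m i) (grid m 1)).comp
      (u := fun x => expI (z * x)) (by fun_prop)).integral_eq
  rw [hlaw]
  have hpow : ∀ z, (∫ ω, expI (z * Y (grid m 1) ω) ∂P) ^ (m + 1) = Complex.exp (φ z) := by
    intro z
    have h1 := integral_expI_sum_of_hasIndepIncrements hY.measurable hY.indep_increments (grid_mono m) (fun _ => z)
      (m + 1)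
    simp only [hlaw, Finset.prod_const, Finset.card_range] at h1
    rw [← h1, ← h, charFun_map_eq_integral_expI (hY.measurable 1).aemeasurable]
    refine integral_congr_ae ?_
    filter_upwards [hY.zero] with ω h0
    have hl : grid m (m + 1) = 1 := by simpa using grid_last 1 m
    rw [← Finset.mul_sum, Finset.sum_range_sub (fun i => Y (grid m i) ω), hl, grid_zero, h0,
      sub_zero]
  have hc : Continuous fun z => ∫ ω, expI (z * Y (grid m 1) ω) ∂P := by
    have := Measure.isProbabilityMeasure_map (hY.measurable (grid m 1)).aemeasurable (μ := P)
    refine (continuous_charFun (μ := P.map (Y (grid m 1)))).congr fun z => ?_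
    exact charFun_map_eq_integral_expI (hY.measurable _).aemeasurable z
  have hm : (m : ℂ) + 1 ≠ 0 := by exact_mod_cast Nat.succ_ne_zero m
  have key := eq_one_of_pow_eq_one
    (f := fun z => (∫ ω, expI (z * Y (grid m 1) ω) ∂P) * Complex.exp (-(φ z / (m + 1))))
    (by fun_prop) (Nat.succ_ne_zero m) (fun z => by
      rw [mul_pow, hpow, ← Complex.exp_nat_mul, ← Complex.exp_add, Nat.cast_succ, mul_neg,
        mul_div_cancel₀ _ hm, add_neg_cancel, Complex.exp_zero])
    (by simp [hφ0, expI_zero]) z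
  rw [Complex.exp_neg, mul_inv_eq_one₀ (Complex.exp_ne_zero _)] at key
  exact key

lemma hasExponent_of_isBrownianReal (hY : IsBrownianReal Y P) (hmeas : ∀ t, Measurable (Y t)) :
    HasExponent P Y fun z => ((-(z ^ 2 / 2) : ℝ) : ℂ) := by
  refine ⟨hmeas, hY.eval_zero_ae_eq_zero, hY.hasIndepIncrements,
    hY.cont.mono fun ω h => h.isCadlag, fun m i z => ?_⟩
  have hl := hY.hasLaw_sub (grid m (i + 1)) (grid m i)
  have h := charFun_map_eq_integral_expI hl.aemeasurable z
  rw [hl.map_eq, charFun_gaussianReal] at h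
  simp only [Pi.sub_apply] at h
  rw [← h]
  congr 1
  have hd : nndist (grid m (i + 1) : ℝ) (grid m i : ℝ) = 1 / ((m : ℝ≥0) + 1) := by
    ext
    rw [coe_nndist, Real.dist_eq, coe_grid, coe_grid, ← sub_div]
    push_cast
    rw [add_sub_cancel_left, abs_of_nonneg (by positivity)]
  rw [show (grid m (i + 1)).1 = (grid m (i + 1) : ℝ) from rfl,
    show (grid m i).1 = (grid m i : ℝ) from rfl, hd]
  push_cast
  ring

end

/-! ### Characteristic functions of the limit process. -/

section

variable {Ω Ω' : Type*} [MeasurableSpace Ω] [MeasurableSpace Ω'] {P : Measure Ω} {P' : Measure Ω'}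
  {π : Ω' → Ω} {Y₁ Y₂ : ℝ≥0 → Ω' → ℝ} {φ : ℝ → ℂ} {G : ℝ → ℝ} {σ : ℝ}

/-- The joint characteristic functions of the partition sums. -/
lemma IndepPairOfBase.setIntegral_expI_sum (hπ : MeasurePreserving π P' P)
    (hY : IndepPairOfBase P' π Y₁ Y₂) (h₁ : HasExponent P' Y₁ φ) (h₂ : HasExponent P' Y₂ φ)
    (hG : ∀ z, φ z + φ (σ * z) = G z) (m : ℕ) (w : ℕ → ℝ) (N : ℕ) {F : Set Ω}
    (hF : MeasurableSet F) :
    ∫ ω in π ⁻¹' F, expI (∑ i ∈ Finset.range N, w i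
        * ((Y₁ (grid m (i + 1)) ω + σ * Y₂ (grid m (i + 1)) ω)
          - (Y₁ (grid m i) ω + σ * Y₂ (grid m i) ω))) ∂P'
      = Complex.exp ((∑ i ∈ Finset.range N, G (w i) / (m + 1) : ℝ) : ℂ) * P.real F := by
  let S : (ℕ → ℝ) → (ℝ≥0 → ℝ) → ℝ := fun w y =>
    ∑ i ∈ Finset.range N, w i * (y (grid m (i + 1)) - y (grid m i))
  have hS : ∀ w, Measurable (S w) := fun w => Finset.measurable_fun_sum _ fun i _ =>
    (Measurable.sub (f := fun y : ℝ≥0 → ℝ => y (grid m (i + 1))) (g := fun y => y (grid m i))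
      (measurable_pi_apply _) (measurable_pi_apply _)).const_mul _
  have hm₁ : Measurable fun ω t => Y₁ t ω := measurable_pi_lambda _ hY.measurable_fst
  have hm₂ : Measurable fun ω t => Y₂ t ω := measurable_pi_lambda _ hY.measurable_snd
  have e1 : ∀ ω, expI (∑ i ∈ Finset.range N, w i
        * ((Y₁ (grid m (i + 1)) ω + σ * Y₂ (grid m (i + 1)) ω)
          - (Y₁ (grid m i) ω + σ * Y₂ (grid m i) ω)))
      = expI (S w fun t => Y₁ t ω) * expI (S (fun i => σ * w i) fun t => Y₂ t ω) := by
    intro ω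
    rw [← expI_add, ← Finset.sum_add_distrib]
    congr 1
    exact Finset.sum_congr rfl fun i _ => by ring
  have hprod : ∫ ω, expI (S w fun t => Y₁ t ω) * expI (S (fun i => σ * w i) fun t => Y₂ t ω) ∂P'
      = Complex.exp ((∑ i ∈ Finset.range N, G (w i) / (m + 1) : ℝ) : ℂ) := by
    rw [hY.indep.integral_fun_comp_mul_comp (f := fun y => expI (S w y))
      (g := fun y => expI (S (fun i => σ * w i) y)) hm₁.aemeasurable hm₂.aemeasurable
      (measurable_expI.comp (hS _)).aestronglyMeasurable
      (measurable_expI.comp (hS _)).aestronglyMeasurable]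
    simp only [S]
    rw [h₁.integral_expI_sum, h₂.integral_expI_sum, ← Complex.exp_add, ← Finset.sum_add_distrib]
    congr 1
    push_cast
    exact Finset.sum_congr rfl fun i _ => by rw [← hG, add_div]
  -- The event enters as a function of `π`, so independence of the base factors out its probability.
  have hind := hY.indep_base.integral_fun_comp_mul_comp
    (f := fun y : (ℝ≥0 → ℝ) × (ℝ≥0 → ℝ) => expI (S w y.1) * expI (S (fun i => σ * w i) y.2))
    (g := F.indicator fun _ => (1 : ℂ)) (hm₁.prodMk hm₂).aemeasurable hπ.measurable.aemeasurable
    ((measurable_expI.comp ((hS _).comp _root_.measurable_fst)).mul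
      (measurable_expI.comp ((hS _).comp _root_.measurable_snd))).aestronglyMeasurable
    (measurable_const.indicator hF).aestronglyMeasurable
  rw [hprod] at hind
  have hF' : ∫ ω, F.indicator (fun _ => (1 : ℂ)) (π ω) ∂P' = P.real F := by
    have : (fun ω => F.indicator (fun _ => (1 : ℂ)) (π ω))
        = (π ⁻¹' F).indicator fun _ => (1 : ℂ) := rfl
    rw [this, integral_indicator (hπ.measurable hF), setIntegral_const, measureReal_def,
      hπ.measure_preimage hF.nullMeasurableSet, measureReal_def]
    simp
  rw [hF'] at hind
  rw [← hind, ← integral_indicator (hπ.measurable hF)]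
  refine integral_congr_ae (ae_of_all _ fun ω => ?_)
  simp only
  by_cases hω : π ω ∈ F
  · rw [Set.indicator_of_mem (show ω ∈ π ⁻¹' F from hω), Set.indicator_of_mem hω, e1, mul_one]
  · rw [Set.indicator_of_notMem (show ω ∉ π ⁻¹' F from hω), Set.indicator_of_notMem hω, mul_zero]

/-- The joint characteristic functions of the limit process. -/
lemma IndepPairOfBase.setIntegral_expI_pathIntegral [IsProbabilityMeasure P'] (hπ : MeasurePreserving π P' P)
    (hY : IndepPairOfBase P' π Y₁ Y₂) (h₁ : HasExponent P' Y₁ φ) (h₂ : HasExponent P' Y₂ φ)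
    (hG : ∀ z, φ z + φ (σ * z) = G z) (hGc : Continuous G) {q : ℕ} (θ : Fin q → ℝ)
    {u : Fin q → ℝ≥0} {T : ℕ} (hT : ∀ l, (u l : ℝ) ≤ T) {F : Set Ω} (hF : MeasurableSet F) :
    ∫ ω in π ⁻¹' F, expI (∑ l, θ l * pathIntegral (fun r ω => Y₁ r ω + σ * Y₂ r ω) (u l) ω) ∂P'
      = Complex.exp ((∫ x in (0 : ℝ)..T, G (ramp θ u x) : ℝ) : ℂ) * P.real F := by
  set Y : ℝ≥0 → Ω' → ℝ := fun r ω => Y₁ r ω + σ * Y₂ r ω with hYdef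
  have hmeas : ∀ t, Measurable (Y t) := fun t =>
    (hY.measurable_fst t).add ((hY.measurable_snd t).const_mul σ)
  have hzero : ∀ᵐ ω ∂P', Y 0 ω = 0 := by
    filter_upwards [h₁.zero, h₂.zero] with ω e1 e2
    simp [Y, e1, e2]
  have hcad : ∀ᵐ ω ∂P', IsCadlag fun s => Y s ω := by
    filter_upwards [h₁.cadlag, h₂.cadlag] with ω e1 e2
    exact e1.add (e2.const_mul σ)
  have hall : ∀ᵐ ω ∂P', ∀ l, Tendsto (fun m => ∑ i ∈ Finset.range ((m + 1) * T),
      max ((u l : ℝ) - grid m i) 0 * (Y (grid m (i + 1)) ω - Y (grid m i) ω)) atTop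
      (𝓝 (pathIntegral Y (u l) ω)) :=
    ae_all_iff.2 fun l => tendsto_grid_sum_pathIntegral hzero hcad (hT l)
  have hlim : ∀ᵐ ω ∂P', Tendsto (fun m => expI (∑ i ∈ Finset.range ((m + 1) * T),
      ramp θ u (grid m i) * (Y (grid m (i + 1)) ω - Y (grid m i) ω))) atTop
      (𝓝 (expI (∑ l, θ l * pathIntegral Y (u l) ω))) := by
    filter_upwards [hall] with ω hω
    refine (continuous_expI.tendsto _).comp ?_
    refine (tendsto_finsetSum Finset.univ fun l _ => (hω l).const_mul (θ l)).congr fun m => ?_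
    simp only [ramp, Finset.mul_sum, Finset.sum_mul]
    rw [Finset.sum_comm]
    exact Finset.sum_congr rfl fun i _ => Finset.sum_congr rfl fun l _ => by ring
  have h3 : Tendsto (fun m : ℕ => ∫ ω in π ⁻¹' F, expI (∑ i ∈ Finset.range ((m + 1) * T),
      ramp θ u (grid m i) * (Y (grid m (i + 1)) ω - Y (grid m i) ω)) ∂P') atTop
      (𝓝 (∫ ω in π ⁻¹' F, expI (∑ l, θ l * pathIntegral Y (u l) ω) ∂P')) := by
    refine tendsto_integral_of_dominated_convergence (fun _ => 1) (fun m => ?_)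
      (integrable_const _) (fun m => ae_of_all _ fun ω => (norm_expI _).le)
      (ae_restrict_of_ae hlim)
    exact (measurable_expI.comp (Finset.measurable_fun_sum _ fun i _ =>
      ((hmeas _).sub (hmeas _)).const_mul _)).aestronglyMeasurable
  refine tendsto_nhds_unique h3 ?_
  simp only [hYdef]
  refine Tendsto.congr (fun m => (hY.setIntegral_expI_sum hπ h₁ h₂ hG m
    (fun i => ramp θ u (grid m i)) ((m + 1) * T) hF).symm) ?_
  have h4 := tendsto_left_riemann_sum (hGc.comp (continuous_ramp θ u)) T
  exact (((Complex.continuous_exp.comp Complex.continuous_ofReal).tendsto _).comp h4).mul_const _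

end

/-! ### The stable exponent -/

section

variable {β Kp Km γ : ℝ}

lemma stableExponent_zero (h0 : 0 < β) : stableExponent β Kp Km γ 0 = 0 := by
  simp [stableExponent, Real.zero_rpow h0.ne']

lemma continuous_stableExponent (h0 : 0 < β) : Continuous (stableExponent β Kp Km γ) := by
  by_cases h1 : β = 1
  · have e : stableExponent β Kp Km γ
        = fun z : ℝ => -((Kp * Real.pi * |z| : ℝ) : ℂ) + Complex.I * γ * z :=
      funext fun z => if_pos h1
    rw [e]
    fun_prop
  -- The jump of the sign at `0` is absorbed by `|z|^β`; the right side is visibly continuous.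
  · have hs : ∀ z : ℝ, |z| ^ β * Real.sign z = (max z 0) ^ β - (max (-z) 0) ^ β := by
      intro z
      rcases lt_trichotomy z 0 with hz | rfl | hz
      · rw [Real.sign_of_neg hz, abs_of_neg hz, max_eq_right hz.le, max_eq_left (by linarith),
          Real.zero_rpow h0.ne']
        ring
      · simp
      · rw [Real.sign_of_pos hz, abs_of_pos hz, max_eq_left hz.le, max_eq_right (by linarith),
          Real.zero_rpow h0.ne']
        ring
    set s := Real.Gamma (2 - β) / (β * (1 - β)) * Real.cos (Real.pi * β / 2) * (Kp + Km)
    set r := (Kp - Km) / (Kp + Km)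
    set τ := Real.tan (Real.pi * β / 2)
    have e : stableExponent β Kp Km γ = fun z : ℝ => ((-(s * |z| ^ β) : ℝ) : ℂ)
        + Complex.I * ((s * r * τ * ((max z 0) ^ β - (max (-z) 0) ^ β) : ℝ) : ℂ) := by
      funext z
      rw [← hs, stableExponent, if_neg h1]
      change -((s * |z| ^ β : ℝ) : ℂ) * (1 - Complex.I * ((r * Real.sign z * τ : ℝ) : ℂ)) = _
      clear_value s r τ
      push_cast
      ring
    rw [e]
    have hc : ∀ {f : ℝ → ℝ}, Continuous f → Continuous fun z => f z ^ β :=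
      fun hf => hf.rpow_const fun _ => Or.inr h0.le
    have c1 := hc continuous_abs
    have c2 := hc (continuous_id.max continuous_const : Continuous fun z : ℝ => max z 0)
    have c3 := hc (continuous_neg.max continuous_const : Continuous fun z : ℝ => max (-z) 0)
    fun_prop

/-- The functional equation and the reflection formula for `Γ`, with the double-angle formula for
`sin(πβ)`, match the constant of `stableExponent` with `∫_0^∞ (1 - cos u) u^{-1-β} du`. -/
lemma gamma_mul_cos_eq (h0 : 0 < β) (h2 : β < 2) (h1 : β ≠ 1) :
    Real.Gamma (2 - β) / (β * (1 - β)) * Real.cos (Real.pi * β / 2) = stableConst β := by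
  have hb : (1 : ℝ) - β ≠ 0 := sub_ne_zero.2 h1.symm
  have e1 : Real.Gamma (2 - β) = (1 - β) * Real.Gamma (1 - β) := by
    rw [← Real.Gamma_add_one hb]
    congr 1
    ring
  have e2 : Real.Gamma (1 + β) = β * Real.Gamma β := by
    rw [add_comm, Real.Gamma_add_one h0.ne']
  have e3 := Real.Gamma_mul_Gamma_one_sub β
  have hs := sin_pi_mul_half_pos h0 h2
  have hsin : Real.sin (Real.pi * β)
      = 2 * Real.sin (Real.pi * β / 2) * Real.cos (Real.pi * β / 2) := by
    rw [← Real.sin_two_mul]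
    congr 1
    ring
  have hG := (Real.Gamma_pos_of_pos h0).ne'
  have hG' : Real.Gamma (1 - β) ≠ 0 := by
    refine Real.Gamma_ne_zero fun m hm => ?_
    rcases m with _ | m
    · exact hb (by simpa using hm)
    · push_cast at hm
      have : (0 : ℝ) ≤ m := Nat.cast_nonneg m
      linarith
  have hc : Real.cos (Real.pi * β / 2) ≠ 0 := by
    intro h
    rw [hsin, h, mul_zero, div_zero] at e3
    exact mul_ne_zero hG hG' e3
  rw [hsin] at e3
  rw [stableConst, e1, e2]
  have hs' := hs.ne'
  clear hs hsin
  generalize Real.sin (Real.pi * β / 2) = S at *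
  generalize Real.cos (Real.pi * β / 2) = C at *
  field_simp at e3 ⊢
  linarith

/-- The symmetrisation of the stable exponent. -/
lemma stableExponent_add_neg (h0 : 0 < β) (h2 : β < 2) (h1 : β = 1 → Kp = Km) (a₀ z : ℝ) :
    stableExponent β (β * a₀ * Kp) (β * a₀ * Km) γ z
      + stableExponent β (β * a₀ * Kp) (β * a₀ * Km) γ (-1 * z)
      = ((-(2 * ((Kp + Km) * (β * stableConst β)) * a₀ * |z| ^ β) : ℝ) : ℂ) := by
  rw [neg_one_mul]
  by_cases hβ : β = 1
  · subst hβ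
    -- Here `stableConst 1 = π/2`, and the drift cancels because it is odd; for `β ≠ 1` the odd term
    -- is the skewness.
    rw [stableExponent, stableExponent, if_pos rfl, if_pos rfl, h1 rfl, abs_neg, Real.rpow_one,
      stableConst, mul_one, Real.sin_pi_div_two, show (1 : ℝ) + 1 = 2 by norm_num,
      Real.Gamma_two]
    push_cast
    ring
  · rw [stableExponent, stableExponent, if_neg hβ, if_neg hβ, gamma_mul_cos_eq h0 h2 hβ, abs_neg,
      Real.sign_neg]
    push_cast
    ring

end

/-! ### The limit theorem -/

section

variable {Ω Ω' : Type*} [mΩ : MeasurableSpace Ω] [MeasurableSpace Ω'] {P : Measure Ω}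
  [IsProbabilityMeasure P] {P' : Measure Ω'} [IsProbabilityMeasure P'] {π : Ω' → Ω}
  {Y₁ Y₂ : ℝ≥0 → Ω' → ℝ} {φ : ℝ → ℂ} {σ : ℝ} {γ b : ℝ} {ν : Measure ℝ} {L : Set (ℝ × ℝ) → Ω → ℝ}
  {a : ℝ → ℝ} {Δ : ℕ → ℝ} {β c κ : ℝ}

lemma IndepPairOfBase.isWienerIntegral (hY : IndepPairOfBase P' π Y₁ Y₂)
    (h₁ : HasExponent P' Y₁ φ) (h₂ : HasExponent P' Y₂ φ) (σ : ℝ) (t : ℝ≥0) :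
    IsWienerIntegral P' (fun r => (t : ℝ) - r) (fun r ω => Y₁ r ω + σ * Y₂ r ω) t
      (pathIntegral (fun r ω => Y₁ r ω + σ * Y₂ r ω) t) := by
  refine isWienerIntegral_pathIntegral
    (fun t => (hY.measurable_fst t).add ((hY.measurable_snd t).const_mul σ)) ?_ ?_ t
  · filter_upwards [h₁.zero, h₂.zero] with ω e1 e2
    simp [e1, e2]
  · filter_upwards [h₁.cadlag, h₂.cadlag] with ω e1 e2
    exact e1.add (e2.const_mul σ)

/-- Stable convergence of the scaled error process, for a basis whose characteristic exponent is
of order `κ|z|^β` at infinity. -/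
lemma IsHomogeneousLevyBasis.fddStablyTendsto_secondOrderError
    (hL : IsHomogeneousLevyBasis P γ b ν L) (hν : IsLevyMeasure ν) (ha : IsTrawlFunction a)
    (hΔ : ∀ n, 1 ≤ n → 0 < Δ n) (hΔ0 : Tendsto (fun n : ℕ => (n : ℝ) * Δ n) atTop (𝓝 0))
    (hβ : 0 < β) (hψ : IsStableLike (levyExponent γ b ν) β c κ) (hπ : MeasurePreserving π P' P)
    (hY : IndepPairOfBase P' π Y₁ Y₂) (h₁ : HasExponent P' Y₁ φ) (h₂ : HasExponent P' Y₂ φ)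
    {G : ℝ → ℝ} (hGc : Continuous G) (hG : ∀ z, φ z + φ (σ * z) = G z) {τ : ℝ}
    (hτ : ∀ z, G (τ * z) = -(2 * κ * a 0 * |z| ^ β)) :
    FddStablyTendsto mΩ P P' π
      (fun n t ω => 1 / ((n : ℝ) * Δ n) ^ (1 / β)
        * secondOrderError P (trawlProcess L a) Δ n t ω)
      (fun t ω => τ * pathIntegral (fun r ω => Y₁ r ω + σ * Y₂ r ω) t ω) := by
  refine fddStablyTendsto_of_tendsto_expI hπ
    (fun n t => (hL.aemeasurable_secondOrderError ha Δ n t).const_mul _)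
    (fun t => (hY.isWienerIntegral h₁ h₂ σ t).1.const_mul τ) fun q u θ F hF => ?_
  obtain ⟨T, hT⟩ : ∃ T : ℕ, ∀ l, (u l : ℝ) ≤ T := by
    refine ⟨⌈∑ l, (u l : ℝ)⌉₊, fun l => le_trans ?_ (Nat.le_ceil _)⟩
    exact Finset.single_le_sum (f := fun l => (u l : ℝ)) (fun i _ => NNReal.coe_nonneg _)
      (Finset.mem_univ l)
  -- The scale `τ` of the limit is absorbed into the coefficients `θ`.
  have h := hY.setIntegral_expI_pathIntegral hπ h₁ h₂ hG hGc (fun l => θ l * τ) hT hF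
  simp only [mul_assoc] at h
  rw [h]
  have hramp : ∀ x, ramp (fun l => θ l * τ) u x = τ * ramp θ u x := fun x => by
    simp only [ramp, Finset.mul_sum]
    exact Finset.sum_congr rfl fun l _ => by ring
  simp_rw [hramp, hτ]
  exact hL.tendsto_setIntegral_expI_secondOrderError hν ha hΔ hΔ0 hβ hψ θ hT hF

end

end

theorem mainTheorem5
    {Ω : Type*} [mΩ : MeasurableSpace Ω] (P : Measure Ω) [IsProbabilityMeasure P]
    -- the Lévy basis, with a seed of finite first moment
    (γ b : ℝ) (hb : 0 ≤ b) (ν : Measure ℝ) (hν : IsLevyMeasure ν)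
    (L : Set (ℝ × ℝ) → Ω → ℝ) (hL : IsHomogeneousLevyBasis P γ b ν L)
    (κ : Measure ℝ) (hκ : IsSeedLaw γ b ν κ) (hκ_int : Integrable (fun x : ℝ => x) κ)
    -- the trawl function, continuously differentiable near `0`
    (a : ℝ → ℝ) (ha : IsTrawlFunction a) (ha_C1 : ∃ δ > 0, ContDiffOn ℝ 1 a (Set.Ico 0 δ))
    -- the sampling scheme
    (Δ : ℕ → ℝ) (hΔ_pos : ∀ n, 1 ≤ n → 0 < Δ n)
    (hΔ_lim : Tendsto (fun n : ℕ => (n : ℝ) * Δ n) atTop (𝓝 0))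
    -- an extension of the probability space
    {Ω' : Type*} [mΩ' : MeasurableSpace Ω'] (P' : Measure Ω') [IsProbabilityMeasure P']
    (π : Ω' → Ω) (hπ : MeasurePreserving π P' P) :
    -- (i)
    (0 < b →
      ∀ B₁ B₂ : ℝ≥0 → Ω' → ℝ, IsBrownianReal B₁ P' → IsBrownianReal B₂ P' →
        IndepPairOfBase P' π B₁ B₂ →
        ∃ H : ℝ≥0 → Ω' → ℝ,
          (∀ t : ℝ≥0, IsWienerIntegral P' (fun r => (t : ℝ) - r)
            (fun r ω => B₁ r ω + B₂ r ω) t (H t)) ∧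
          FddStablyTendsto mΩ P P' π
            (fun n t ω => 1 / Real.sqrt ((n : ℝ) * Δ n)
              * secondOrderError P (trawlProcess L a) Δ n t ω)
            (fun t ω => Real.sqrt (b ^ 2 * a 0) * H t ω)) ∧
    -- (ii)
    (b = 0 →
      ∀ β Kp Km pv : ℝ, 0 < β → β < 2 → 0 < Kp + Km →
        Tendsto (fun x : ℝ => x ^ β * ν.real (Set.Ioi x)) (𝓝[>] 0) (𝓝 Kp) →
        Tendsto (fun x : ℝ => x ^ β * ν.real (Set.Iio (-x))) (𝓝[>] 0) (𝓝 Km) →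
        (β = 1 → Kp = Km ∧
          Tendsto (fun ε : ℝ => ∫ x in {x : ℝ | ε < |x| ∧ |x| ≤ 1}, x ∂ν) (𝓝[>] 0) (𝓝 pv)) →
        ∀ Y₁ Y₂ : ℝ≥0 → Ω' → ℝ, IsLevyProcess P' Y₁ → IsLevyProcess P' Y₂ →
          (∀ z : ℝ, charFun (P'.map (Y₁ 1)) z
            = Complex.exp (stableExponent β (β * a 0 * Kp) (β * a 0 * Km) (γ + pv) z)) →
          (∀ z : ℝ, charFun (P'.map (Y₂ 1)) z
            = Complex.exp (stableExponent β (β * a 0 * Kp) (β * a 0 * Km) (γ + pv) z)) →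
          IndepPairOfBase P' π Y₁ Y₂ →
          ∃ H : ℝ≥0 → Ω' → ℝ,
            (∀ t : ℝ≥0, IsWienerIntegral P' (fun s => (t : ℝ) - s)
              (fun s ω => Y₁ s ω - Y₂ s ω) t (H t)) ∧
            FddStablyTendsto mΩ P P' π
              (fun n t ω => 1 / ((n : ℝ) * Δ n) ^ (1 / β)
                * secondOrderError P (trawlProcess L a) Δ n t ω)
              H) := by
  refine ⟨fun _ B₁ B₂ hB₁ hB₂ hB => ?_, fun hb0 β Kp Km pv h0 h2 _ hp hm h1 Y₁ Y₂ hY₁ hY₂ hφ₁ hφ₂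
    hY => ?_⟩
  · have h₁ := hasExponent_of_isBrownianReal hB₁ hB.measurable_fst
    have h₂ := hasExponent_of_isBrownianReal hB₂ hB.measurable_snd
    have hW := hB.isWienerIntegral h₁ h₂ 1
    -- Two Brownian motions have joint exponent `-z²`, and `2κa(0) = b²a(0)` for `κ = b²/2`, whence
    -- `τ = √(b²a(0))`.
    have hH := hL.fddStablyTendsto_secondOrderError hν ha hΔ_pos hΔ_lim two_pos
      hν.isStableLike_gaussian hπ hB h₁ h₂ (σ := 1) (G := fun z => -z ^ 2) (by fun_prop)
      (fun z => by push_cast; ring) (τ := Real.sqrt (b ^ 2 * a 0)) (fun z => by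
        have h := Real.sq_sqrt (mul_nonneg (sq_nonneg b) (ha.nonneg 0 le_rfl))
        rw [mul_pow, h, Real.rpow_two, sq_abs]
        ring)
    simp only [one_mul] at hW hH
    simp only [Real.sqrt_eq_rpow ((_ : ℕ) * Δ _)]
    exact ⟨_, hW, hH⟩
  · subst hb0
    obtain ⟨c, hc⟩ := hν.exists_isStableLike (γ := γ) h0 h2 hp hm fun h => (h1 h).2
    have hψc := continuous_stableExponent (β := β) (Kp := β * a 0 * Kp) (Km := β * a 0 * Km)
      (γ := γ + pv) h0
    have h₁ := hY₁.hasExponent hψc (stableExponent_zero h0) hφ₁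
    have h₂ := hY₂.hasExponent hψc (stableExponent_zero h0) hφ₂
    have hW := hY.isWienerIntegral h₁ h₂ (-1)
    -- With `σ = -1` the exponent of the difference is the symmetrised stable exponent, already
    -- correctly normalised, so `τ = 1`.
    have hH := hL.fddStablyTendsto_secondOrderError hν ha hΔ_pos hΔ_lim h0 hc hπ hY h₁ h₂
      (σ := -1) (G := fun z => -(2 * ((Kp + Km) * (β * stableConst β)) * a 0 * |z| ^ β))
      (by
        have : Continuous fun z : ℝ => |z| ^ β :=
          continuous_abs.rpow_const fun _ => Or.inr h0.le
        fun_prop)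
      (stableExponent_add_neg h0 h2 (fun h => (h1 h).1) (a 0)) (τ := 1) (fun z => by rw [one_mul])
    simp only [neg_one_mul, ← sub_eq_add_neg, one_mul] at hW hH
    exact ⟨_, hW, hH⟩
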